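/- **Theorem (Suboptimality gap).** Let $K\ge 1$ and $T\ge 1$ be integers and let $\mathbf y=((\alpha_a,\beta_a))_{a=1}^K$ with $\alpha_a,\beta_a>0$. Consider the Beta–Bernoulli bandit with $K$ independent arms: $\theta_a\sim\mathrm{Beta}(\alpha_a,\beta_a)$ independently over $a$ and, given $\theta_a$, the results $R_{a,1},R_{a,2},\dots$ of the successive pulls of arm $a$ are i.i.d. $\mathrm{Bernoulli}(\theta_a)$. Let $\mathcal I(T,\mathbf y)$ be the law of the outcome $\omega=((\theta_a)_a,(R_{a,n})_{a\le K,\,n\le T})$. For an action sequence $\mathbf a_{1:T}\in\{1,\dots,K\}^T$ the reward at time $t$ is $r_t(\mathbf a_{1:t};\omega)=R_{a_t,n}$ with $n=\#\{s\le t: a_s=a_t\}$, and $\mathcal F_{t-1}(\mathbf a_{1:t-1};\omega)$ is the $\sigma$-algebra generated by $r_1,\dots,r_{t-1}$. After a result $r\in\{0,1\}$ of arm $a$ the belief $(\alpha_a,\beta_a)$ is updated to $(\alpha_a+r,\beta_a+1-r)$. For a penalty $z=(z_t(\mathbf a_{1:t};\omega,T,\mathbf y))_{t\le T}$ put $$W^z(T,\mathbf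 y)=\mathbb E_{\omega\sim\mathcal I(T,\mathbf y)}\Big[\max_{\mathbf a_{1:T}}\sum_{t=1}^T\big(r_t(\mathbf a_{1:t};\omega)-z_t(\mathbf a_{1:t};\omega,T,\mathbf y)\big)\Big].$$ The policy $\pi^z$ acts as follows: when the remaining time is $\tau\geq 1$ and the current (posterior) belief is $\mathbf y'$, it draws a fresh sample $\tilde\omega\sim\mathcal I(\tau,\mathbf y')$, takes a maximizer $\tilde{\mathbf a}^*_{1:\tau}$ of $\sum_{t=1}^{\tau}\big(r_t(\mathbf a_{1:t};\tilde\omega)-z_t(\mathbf a_{1:t};\tilde\omega,\tau,\mathbf y')\big)$, ties being broken by an arbitrary fixed rule, measurable in $\tilde\omega$ (it may depend on $\tau$ and $\mathbf y'$), and pulls the arm $\tilde a^*_1$. Let $V(\pi^z,T,\mathbf y)$ be the expected total reward of $\pi^z$ over $T$ pulls, started from the belief $\mathbf y$, where the expectation is over $\omega\sim\mathcal I(T,\mathbf y)$ and over the samples drawn by the policy. Consider the penalties $$z_t^{\mathrm{TS}}=r_t-\mathbb E[r_t\mid\theta_1,\dots,\theta_K],\qquad z_t^{\mathrm{IRS.FH}}=r_t-\mathbb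 E[\theta_{a_t}\mid R_{a_t,1},\dots,R_{a_t,T-1}],\qquad z_t^{\mathrm{IRS.V\text{-}Zero}}=r_t-\mathbb E[r_t\mid\mathcal F_{t-1}(\mathbf a_{1:t-1};\omega)]$$ (for the first one, $\pi^{\mathrm{TS}}$ is Thompson sampling). Then, for all such $K$, $T$, $\mathbf y$ and for all tie-breaking rules, $$W^{\mathrm{TS}}(T,\mathbf y)-V(\pi^{\mathrm{TS}},T,\mathbf y)\le 3K+4\sqrt{\log T}\,\sqrt{KT},$$ $$W^{\mathrm{IRS.FH}}(T,\mathbf y)-V(\pi^{\mathrm{IRS.FH}},T,\mathbf y)\le 3K+2\sqrt{\log T}\,\Big(2\sqrt{KT}-\tfrac13\sqrt{T/K}\Big),$$ $$W^{\mathrm{IRS.V\text{-}Zero}}(T,\mathbf y)-V(\pi^{\mathrm{IRS.V\text{-}Zero}},T,\mathbf y)\le 2K+\sqrt{\log T}\,\Big(2\sqrt{KT}-\tfrac13\sqrt{T/K}\Big).$$ -/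

import Mathlib

open MeasureTheory ProbabilityTheory

namespace BetaBernoulliBandit

/-- The belief about one arm: the hyperparameters of a prior `Beta(α, β)`. -/
structure BetaParam where
  α : ℝ
  β : ℝ
  α_pos : 0 < α
  β_pos : 0 < β

/-- Bayesian update of a Beta belief after one Bernoulli observation. -/
def BetaParam.update (y : BetaParam) : Bool → BetaParam
  | true => ⟨y.α + 1, y.β, by linarith [y.α_pos], y.β_pos⟩
  | false => ⟨y.α, y.β + 1, y.α_pos, by linarith [y.β_pos]⟩

/-- The belief vector of a bandit with `K` arms. -/
abbrev Belief (K : ℕ) := Fin K → BetaParam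

/-- Bayesian update of the belief vector after observing `r` from arm `a`. -/
def updateBelief {K : ℕ} (y : Belief K) (a : Fin K) (r : Bool) : Belief K :=
  Function.update y a ((y a).update r)

/-- An outcome for horizon `T`: for every arm `a`, its parameter `(ω a).1` and the results
`(ω a).2 n` of its pulls; the index `n : Fin T` stands for the pull number `n + 1`. -/
abbrev Outcome (K T : ℕ) := Fin K → ℝ × (Fin T → Bool)

/-- The law of `T` independent `Bernoulli(θ)` results (`θ` is clamped to `[0, 1]`, which has no
effect on values of a Beta variable). -/
noncomputable def pullsLaw (T : ℕ) (θ : ℝ) : Measure (Fin T → Bool) :=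
  Measure.pi fun _ => bernoulliMeasure true false (Set.projIcc (0 : ℝ) 1 zero_le_one θ)

lemma measurable_pullsLaw (T : ℕ) : Measurable (pullsLaw T) := by
  refine Measure.measurable_of_measurable_coe _ fun s _ => ?_
  have h : ∀ θ : ℝ, pullsLaw T θ s = ∑ x ∈ s.toFinite.toFinset, ∏ i : Fin T,
      bernoulliMeasure true false (Set.projIcc (0 : ℝ) 1 zero_le_one θ) {x i} := by
    intro θ
    have hs : s = ↑s.toFinite.toFinset := by simp
    conv_lhs => rw [hs, ← sum_measure_singleton]
    exact Finset.sum_congr rfl fun x _ => by rw [pullsLaw, Measure.pi_singleton]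
  simp_rw [h]
  refine Finset.measurable_sum _ fun x _ => Finset.measurable_prod _ fun i _ => ?_
  simp only [bernoulliMeasure_def, Measure.add_apply, Measure.smul_apply]
  have hp : Measurable fun θ : ℝ => Set.projIcc (0 : ℝ) 1 zero_le_one θ :=
    continuous_projIcc.measurable
  have h1 : Measurable fun p : unitInterval => ((unitInterval.toNNReal p : NNReal) : ENNReal) :=
    (ENNReal.continuous_coe.comp unitInterval.toNNReal_continuous).measurable
  have h2 : Measurable fun p : unitInterval =>
      ((unitInterval.toNNReal (unitInterval.symm p) : NNReal) : ENNReal) :=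
    (ENNReal.continuous_coe.comp
      (unitInterval.toNNReal_continuous.comp unitInterval.continuous_symm)).measurable
  exact ((h1.comp hp).mul_const _).add ((h2.comp hp).mul_const _)

/-- `pullsLaw` as a Markov kernel from parameters to results. -/
noncomputable def pullsKernel (T : ℕ) : Kernel ℝ (Fin T → Bool) :=
  ⟨pullsLaw T, measurable_pullsLaw T⟩

instance isMarkovKernel_pullsKernel (T : ℕ) : IsMarkovKernel (pullsKernel T) :=
  ⟨fun θ => by
    have : ∀ p : unitInterval, IsProbabilityMeasure (bernoulliMeasure true false p) :=
      fun p => by infer_instance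
    change IsProbabilityMeasure (pullsLaw T θ)
    unfold pullsLaw
    infer_instance⟩

/-- The joint law of the parameter and the pull results of one arm:
`θ ∼ Beta(α, β)` and, given `θ`, the results are i.i.d. `Bernoulli(θ)`. -/
noncomputable def armLaw (T : ℕ) (y : BetaParam) : Measure (ℝ × (Fin T → Bool)) :=
  (betaMeasure y.α y.β) ⊗ₘ (pullsKernel T)

instance isProbabilityMeasure_armLaw (T : ℕ) (y : BetaParam) :
    IsProbabilityMeasure (armLaw T y) := by
  have := isProbabilityMeasureBeta y.α_pos y.β_pos
  unfold armLaw
  infer_instance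

/-- The law of the outcome for horizon `T` and belief `y`; the arms are independent. -/
noncomputable def outcomeLaw {K : ℕ} (T : ℕ) (y : Belief K) : Measure (Outcome K T) :=
  Measure.pi fun a => armLaw T (y a)

instance isProbabilityMeasure_outcomeLaw {K : ℕ} (T : ℕ) (y : Belief K) :
    IsProbabilityMeasure (outcomeLaw T y) := by
  unfold outcomeLaw
  infer_instance

/-- An action sequence of length `T`. -/
abbrev Actions (K T : ℕ) := Fin T → Fin K

/-- The number of times that the arm pulled at time `t` was pulled before `t`. -/
def pullIndex {K T : ℕ} (a : Actions K T) (t : Fin T) : Fin T :=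
  ⟨(Finset.univ.filter fun s : Fin T => s < t ∧ a s = a t).card, by
    have h : (Finset.univ.filter fun s : Fin T => s < t ∧ a s = a t) ⊆ Finset.Iio t := by
      intro s hs
      simpa using (Finset.mem_filter.1 hs).2.1
    have h' := Finset.card_le_card h
    rw [Fin.card_Iio] at h'
    exact lt_of_le_of_lt h' t.isLt⟩

/-- The binary result observed at time `t` under the action sequence `a`. -/
def observation {K T : ℕ} (a : Actions K T) (t : Fin T) (ω : Outcome K T) : Bool :=
  (ω (a t)).2 (pullIndex a t)

/-- The reward `r_t(a_{1:t}; ω) ∈ {0, 1}`. -/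
def reward {K T : ℕ} (a : Actions K T) (t : Fin T) (ω : Outcome K T) : ℝ :=
  if observation a t ω then 1 else 0

/-- The posterior belief after the first `t` steps of the action sequence `a`. -/
def posterior {K T : ℕ} (y : Belief K) (a : Actions K T) (ω : Outcome K T) : ℕ → Belief K
  | 0 => y
  | t + 1 =>
    if h : t < T then
      updateBelief (posterior y a ω t) (a ⟨t, h⟩) (observation a ⟨t, h⟩ ω)
    else posterior y a ω t

/-- A randomized policy specifies, for a remaining time and a current belief, the distribution
of the arm that is pulled next. -/
abbrev Policy (K : ℕ) := ℕ → Belief K → Measure (Fin K)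

/-- The Bayesian performance `V(π, T, y)`: the expected total reward over the outcome and over
the (independent) randomization of the policy. Given the outcome `ω`, the policy follows the
action sequence `a` with the probability given by the product over `t`. -/
noncomputable def performance {K : ℕ} (π : Policy K) (T : ℕ) (y : Belief K) : ℝ :=
  ∫ ω, ∑ a : Actions K T,
    (∏ t : Fin T, (π (T - (t : ℕ)) (posterior y a ω (t : ℕ))).real {a t}) *
      ∑ t : Fin T, reward a t ω ∂(outcomeLaw T y)

/-- A penalty function `z_t(a_{1:t}; ω, T, y)`. -/
abbrev Penalty (K : ℕ) :=
  (T : ℕ) → Belief K → Fin T → Actions K T → Outcome K T → ℝ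

/-- Information of all the parameters `θ`. -/
abbrev paramInfo (K T : ℕ) : MeasurableSpace (Outcome K T) :=
  MeasurableSpace.comap (fun ω (a : Fin K) => (ω a).1) inferInstance

/-- Information of the first `T - 1` results of arm `a`. -/
abbrev armInfo {K : ℕ} (T : ℕ) (a : Fin K) : MeasurableSpace (Outcome K T) :=
  MeasurableSpace.comap
    (fun ω (n : Fin (T - 1)) => (ω a).2 (Fin.castLE (Nat.sub_le T 1) n)) inferInstance

/-- Natural filtration: the information observed strictly before time `t` under the action
sequence `a`. -/
abbrev pastInfo {K T : ℕ} (a : Actions K T) (t : Fin T) : MeasurableSpace (Outcome K T) :=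
  MeasurableSpace.comap (fun ω (s : {s : Fin T // s < t}) => reward a s ω) inferInstance

/-- The penalty of Thompson sampling: `r_t - E[r_t | θ]`. -/
noncomputable def penaltyTS (K : ℕ) : Penalty K := fun T y t a ω =>
  reward a t ω - ((outcomeLaw T y)[reward a t | paramInfo K T]) ω

/-- The penalty of IRS.FH: `r_t - E[μ_{a_t}(θ_{a_t}) | R_{a_t,1}, …, R_{a_t,T-1}]`, where the
mean reward of an arm with parameter `θ` is `θ`. -/
noncomputable def penaltyFH (K : ℕ) : Penalty K := fun T y t a ω =>
  reward a t ω - ((outcomeLaw T y)[fun ω' => (ω' (a t)).1 | armInfo T (a t)]) ω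

/-- The penalty of IRS.V-Zero: `r_t - E[r_t | F_{t-1}]`. -/
noncomputable def penaltyVZero (K : ℕ) : Penalty K := fun T y t a ω =>
  reward a t ω - ((outcomeLaw T y)[reward a t | pastInfo a t]) ω

/-- The objective of the inner problem. -/
noncomputable def innerObjective {K : ℕ} (z : Penalty K) (T : ℕ) (y : Belief K)
    (ω : Outcome K T) (a : Actions K T) : ℝ :=
  ∑ t : Fin T, (reward a t ω - z T y t a ω)

/-- The performance bound `W^z(T, y)`: the expected maximal value of the inner problem. -/
noncomputable def upperBound {K : ℕ} (z : Penalty K) (T : ℕ) (y : Belief K) : ℝ :=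
  ∫ ω, ⨆ a : Actions K T, innerObjective z T y ω a ∂(outcomeLaw T y)

/-- A rule for solving the inner problems (that is, for breaking ties in the argmax): to every
remaining time, belief and outcome it assigns an action sequence. -/
abbrev Solver (K : ℕ) := (T : ℕ) → Belief K → Outcome K T → Actions K T

/-- The rule is measurable in the outcome and almost surely returns a best action sequence. -/
def IsInnerSolver {K : ℕ} (z : Penalty K) (σ : Solver K) : Prop :=
  ∀ (T : ℕ) (y : Belief K), Measurable (σ T y) ∧
    ∀ᵐ ω ∂(outcomeLaw T y), ∀ a : Actions K T,
      innerObjective z T y ω a ≤ innerObjective z T y ω (σ T y ω)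

/-- The IRS policy: sample an outcome for the remaining time and the current belief, and take
the first action of the best action sequence. (No action is taken when no time remains.) -/
noncomputable def irsPolicy {K : ℕ} (σ : Solver K) : Policy K := fun T y =>
  if h : 0 < T then (outcomeLaw T y).map fun ω => σ T y ω ⟨0, h⟩ else 0

end BetaBernoulliBandit

/-! All three gaps come from one potential argument. Let U(τ, y) satisfy U(0, ·) ≤ 0 and dominate W
at the full horizon. Along the run of the policy, U − V accumulates the one-step losses U(τ+1, y) −
E[mean of the pulled arm + U(τ, updated belief)]. In `sub_performance_le` a loss splits into a part
depending on time alone and a part charged to the pulled arm. A pull raises α + β by one, so the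
charge for a pull after m earlier ones is at most an increment G(m+1) − G(m). The charges telescope
arm by arm, and Cauchy–Schwarz over pull counts with sum T produces √(KT).

The one-step loss is tractable because the policy draws its sample from the current posterior: the
pulled arm has the law of the first arm of an optimal sequence. For TS and IRS.FH, U(τ, y) = τ ·
E[max θ]. The factor E[max θ] is preserved on average by updating, so the loss is E[max θ] − E[mean
of the sampled arm]. In TS the sampled arm attains the maximum (`ts_step`); in IRS.FH the posterior
mean after τ further results is inserted between the two terms (`fh_step`). For IRS.V-Zero, U = W.
There the objective depends only on how often each arm is pulled, so replacing the first arm costs a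
difference of two posterior means at the final pull counts (`vzero_step`).

These differences are controlled by concentration. The posterior mean is a martingale whose step
from size s has range 1/(s+1); Hoeffding's lemma makes it sub-Gaussian with the telescoping variance
`proxy`. Infinitely many results give the sub-Gaussian bound for the Beta law itself, and
`maximal_inequality` handles pull counts that depend on the outcome. Confidence level 1/T costs K/T
per step for a union over arms, hence K in total (2K for IRS.FH, which uses two unions). The
negative term √(T/K)/3 reflects that the proxy shrinks with the remaining time; `width` keeps track
of this. -/

namespace BetaBernoulliBandit

/-! ### Beta beliefs and conjugacy. -/

/-- The sum of the two hyperparameters. -/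
noncomputable def BetaParam.size (y : BetaParam) : ℝ := y.α + y.β

/-- The mean of a Beta belief. -/
noncomputable def BetaParam.mean (y : BetaParam) : ℝ := y.α / (y.α + y.β)

/-- The predictive probability of the next result. -/
noncomputable def BetaParam.pred (y : BetaParam) : Bool → ℝ
  | true => y.α / (y.α + y.β)
  | false => y.β / (y.α + y.β)

lemma BetaParam.size_pos (y : BetaParam) : 0 < y.size := add_pos y.α_pos y.β_pos

lemma BetaParam.size_update (y : BetaParam) (r : Bool) : (y.update r).size = y.size + 1 := by
  cases r <;> simp [BetaParam.size, BetaParam.update] <;> ring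

lemma BetaParam.pred_pos (y : BetaParam) (r : Bool) : 0 < y.pred r := by
  have := y.α_pos; have := y.β_pos
  cases r <;> simp only [BetaParam.pred] <;> positivity

lemma BetaParam.pred_true_add_pred_false (y : BetaParam) : y.pred true + y.pred false = 1 := by
  have := y.α_pos; have := y.β_pos
  simp only [BetaParam.pred]; field_simp

/-- The factor x raises an exponent of the density by one, and Γ(s+1) = sΓ(s) turns the ratio of
normalising constants into the predictive probability of a success. -/
lemma betaPDFReal_mul_self {α β : ℝ} (hα : 0 < α) (hβ : 0 < β) (x : ℝ) :
    betaPDFReal α β x * x = α / (α + β) * betaPDFReal (α + 1) β x := by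
  unfold betaPDFReal
  split_ifs with h
  · have e : x ^ (α + 1 - 1) = x ^ (α - 1) * x := by
      rw [← Real.rpow_add_one h.1.ne']; ring_nf
    have hg : beta (α + 1) β = beta α β * (α / (α + β)) := by
      unfold beta
      rw [Real.Gamma_add_one hα.ne', show α + 1 + β = α + β + 1 by ring,
        Real.Gamma_add_one (add_pos hα hβ).ne']
      have := (Real.Gamma_pos_of_pos (add_pos hα hβ)).ne'
      field_simp
    rw [e, hg]
    have := (beta_pos hα hβ).ne'
    field_simp
  · simp

lemma betaPDFReal_mul_one_sub {α β : ℝ} (hα : 0 < α) (hβ : 0 < β) (x : ℝ) :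
    betaPDFReal α β x * (1 - x) = β / (α + β) * betaPDFReal α (β + 1) x := by
  unfold betaPDFReal
  split_ifs with h
  · have e : (1 - x) ^ (β + 1 - 1) = (1 - x) ^ (β - 1) * (1 - x) := by
      rw [← Real.rpow_add_one (by linarith [h.2])]; ring_nf
    have hg : beta α (β + 1) = beta α β * (β / (α + β)) := by
      unfold beta
      rw [Real.Gamma_add_one hβ.ne', show α + (β + 1) = α + β + 1 by ring,
        Real.Gamma_add_one (add_pos hα hβ).ne']
      have := (Real.Gamma_pos_of_pos (add_pos hα hβ)).ne'
      field_simp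
    rw [e, hg]
    have := (beta_pos hα hβ).ne'
    field_simp
  · simp

/-- A parameter clamped to `[0, 1]`. -/
noncomputable def clamp (θ : ℝ) : ℝ := Set.projIcc (0 : ℝ) 1 zero_le_one θ

lemma clamp_nonneg (θ : ℝ) : 0 ≤ clamp θ := (Set.projIcc (0 : ℝ) 1 zero_le_one θ).2.1

lemma clamp_le_one (θ : ℝ) : clamp θ ≤ 1 := (Set.projIcc (0 : ℝ) 1 zero_le_one θ).2.2

lemma clamp_of_mem {θ : ℝ} (h0 : 0 ≤ θ) (h1 : θ ≤ 1) : clamp θ = θ := by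
  unfold clamp; rw [Set.projIcc_of_mem zero_le_one ⟨h0, h1⟩]

@[fun_prop]
lemma measurable_clamp : Measurable clamp :=
  (continuous_subtype_val.comp continuous_projIcc).measurable

/-- The probability of a single result given the parameter. -/
noncomputable def bern (θ : ℝ) : Bool → ℝ
  | true => clamp θ
  | false => 1 - clamp θ

lemma bern_nonneg (θ : ℝ) (r : Bool) : 0 ≤ bern θ r := by
  cases r <;> simp [bern, clamp_nonneg, clamp_le_one]

lemma measurable_bern (r : Bool) : Measurable fun θ => bern θ r := by
  cases r <;> simp only [bern] <;> fun_prop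

lemma bernoulliMeasure_singleton (θ : ℝ) (r : Bool) :
    bernoulliMeasure true false (Set.projIcc (0 : ℝ) 1 zero_le_one θ) {r} =
      ENNReal.ofReal (bern θ r) := by
  rw [← ofReal_measureReal]
  congr 1
  cases r
  · rw [bernoulliMeasure_real_apply_of_notMem_of_mem _ (by simp) (by simp) (by simp)]; rfl
  · rw [bernoulliMeasure_real_apply_of_mem_of_notMem _ (by simp) (by simp) (by simp)]; rfl

lemma betaPDFReal_mul_bern (y : BetaParam) (r : Bool) (x : ℝ) :
    betaPDFReal y.α y.β x * bern x r =
      y.pred r * betaPDFReal (y.update r).α (y.update r).β x := by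
  by_cases h : 0 < x ∧ x < 1
  · cases r
    · simp only [bern, clamp_of_mem h.1.le h.2.le]
      exact betaPDFReal_mul_one_sub y.α_pos y.β_pos x
    · simp only [bern, clamp_of_mem h.1.le h.2.le]
      exact betaPDFReal_mul_self y.α_pos y.β_pos x
  · simp [betaPDFReal, h]

/-- Conjugacy of the Beta prior and the Bernoulli likelihood. -/
lemma lintegral_bern_mul (y : BetaParam) (r : Bool) {g : ℝ → ENNReal} (hg : Measurable g) :
    ∫⁻ θ, ENNReal.ofReal (bern θ r) * g θ ∂(betaMeasure y.α y.β) =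
      ENNReal.ofReal (y.pred r) *
        ∫⁻ θ, g θ ∂(betaMeasure (y.update r).α (y.update r).β) := by
  have hm : ∀ α β, Measurable (betaPDF α β) := fun α β =>
    (measurable_betaPDFReal α β).ennreal_ofReal
  unfold betaMeasure
  have hbg : Measurable fun θ => ENNReal.ofReal (bern θ r) * g θ :=
    (measurable_bern r).ennreal_ofReal.mul hg
  rw [lintegral_withDensity_eq_lintegral_mul _ (hm _ _) hbg,
    lintegral_withDensity_eq_lintegral_mul _ (hm _ _) hg, ← lintegral_const_mul _ ((hm _ _).mul hg)]
  refine lintegral_congr fun x => ?_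
  simp only [Pi.mul_apply, betaPDF]
  rw [← mul_assoc, ← mul_assoc, ← ENNReal.ofReal_mul' (bern_nonneg x r), betaPDFReal_mul_bern,
    ENNReal.ofReal_mul (y.pred_pos r).le]

lemma ae_betaMeasure_mem (α β : ℝ) : ∀ᵐ θ ∂(betaMeasure α β), 0 < θ ∧ θ < 1 := by
  unfold betaMeasure
  have hm : Measurable (betaPDF α β) := (measurable_betaPDFReal α β).ennreal_ofReal
  rw [ae_withDensity_iff hm]
  refine Filter.Eventually.of_forall fun x hx => ?_
  by_contra h
  exact hx (by simp [betaPDF, betaPDFReal, h])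

/-! ### Disintegration of the outcome law along the first result of an arm. -/

lemma pullsLaw_succ_cons {T : ℕ} (θ : ℝ) (r : Bool) (s : Set (Fin T → Bool)) :
    pullsLaw (T + 1) θ {R | R 0 = r ∧ Fin.tail R ∈ s} =
      ENNReal.ofReal (bern θ r) * pullsLaw T θ s := by
  have h := measurePreserving_piFinSuccAbove (n := T) (α := fun _ => Bool)
    (fun _ => bernoulliMeasure true false (Set.projIcc (0 : ℝ) 1 zero_le_one θ)) 0
  have h2 := h.measure_preimage (s := {r} ×ˢ s) (by measurability)
  rw [Measure.prod_prod, bernoulliMeasure_singleton] at h2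
  exact h2

/-- An arm that is not pulled loses its last result when the horizon shrinks by one; that result can
no longer be reached, and dropping it leaves the belief unchanged. -/
lemma pullsLaw_succ_init {T : ℕ} (θ : ℝ) (s : Set (Fin T → Bool)) :
    pullsLaw (T + 1) θ {R | Fin.init R ∈ s} = pullsLaw T θ s := by
  have h := measurePreserving_piFinSuccAbove (n := T) (α := fun _ => Bool)
    (fun _ => bernoulliMeasure true false (Set.projIcc (0 : ℝ) 1 zero_le_one θ)) (Fin.last T)
  have h2 := h.measure_preimage (s := Set.univ ×ˢ s) (by measurability)
  rw [Measure.prod_prod, measure_univ, one_mul] at h2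
  rw [pullsLaw, pullsLaw]
  rw [← h2]
  congr 1
  ext R
  simp [MeasurableEquiv.piFinSuccAbove, Fin.insertNthEquiv, Fin.removeNth_last]

/-- Forget the first result of an arm. -/
def armTail {T : ℕ} (x : ℝ × (Fin (T + 1) → Bool)) : ℝ × (Fin T → Bool) := (x.1, Fin.tail x.2)

/-- Forget the last result of an arm. -/
def armInit {T : ℕ} (x : ℝ × (Fin (T + 1) → Bool)) : ℝ × (Fin T → Bool) := (x.1, Fin.init x.2)

lemma measurable_armTail {T : ℕ} : Measurable (armTail (T := T)) :=
  measurable_fst.prodMk ((Measurable.of_discrete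
    (f := fun R : Fin (T + 1) → Bool => (Fin.tail R : Fin T → Bool))).comp measurable_snd)

lemma measurable_armInit {T : ℕ} : Measurable (armInit (T := T)) :=
  measurable_fst.prodMk ((Measurable.of_discrete
    (f := fun R : Fin (T + 1) → Bool => (Fin.init R : Fin T → Bool))).comp measurable_snd)

lemma armLaw_succ_tail {T : ℕ} (y : BetaParam) (r : Bool) {s : Set (ℝ × (Fin T → Bool))}
    (hs : MeasurableSet s) :
    armLaw (T + 1) y {x | x.2 0 = r ∧ armTail x ∈ s} =
      ENNReal.ofReal (y.pred r) * armLaw T (y.update r) s := by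
  have := isProbabilityMeasureBeta y.α_pos y.β_pos
  have := isProbabilityMeasureBeta (y.update r).α_pos (y.update r).β_pos
  have hm : MeasurableSet {x : ℝ × (Fin (T + 1) → Bool) | x.2 0 = r ∧ armTail x ∈ s} :=
    (measurableSet_eq_fun (by fun_prop) measurable_const).inter (measurable_armTail hs)
  rw [armLaw, armLaw, Measure.compProd_apply hm, Measure.compProd_apply hs,
    ← lintegral_bern_mul y r (Kernel.measurable_kernel_prodMk_left hs)]
  exact lintegral_congr fun θ => pullsLaw_succ_cons θ r (Prod.mk θ ⁻¹' s)

lemma armLaw_succ_init {T : ℕ} (y : BetaParam) {s : Set (ℝ × (Fin T → Bool))}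
    (hs : MeasurableSet s) :
    armLaw (T + 1) y {x | armInit x ∈ s} = armLaw T y s := by
  have := isProbabilityMeasureBeta y.α_pos y.β_pos
  have hm : MeasurableSet {x : ℝ × (Fin (T + 1) → Bool) | armInit x ∈ s} := measurable_armInit hs
  rw [armLaw, armLaw, Measure.compProd_apply hm, Measure.compProd_apply hs]
  exact lintegral_congr fun θ => pullsLaw_succ_init θ (Prod.mk θ ⁻¹' s)

/-- The outcome that remains after arm `a` has been pulled once. -/
def shift {K T : ℕ} (a : Fin K) (ω : Outcome K (T + 1)) : Outcome K T :=
  fun c => if c = a then armTail (ω c) else armInit (ω c)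

lemma measurable_shift {K T : ℕ} (a : Fin K) : Measurable (shift (T := T) a) := by
  refine measurable_pi_lambda _ fun c => ?_
  unfold shift
  split_ifs
  · exact measurable_armTail.comp (measurable_pi_apply c)
  · exact measurable_armInit.comp (measurable_pi_apply c)

/-- Preimages of boxes are again boxes up to the constraint on one arm. That arm contributes the
conjugate update through `armLaw_succ_tail`, every other arm only forgets a result through
`armLaw_succ_init`. -/
lemma map_shift_restrict {K T : ℕ} (y : Belief K) (a : Fin K) (r : Bool) :
    ((outcomeLaw (T + 1) y).restrict {ω | (ω a).2 0 = r}).map (shift a) =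
      ENNReal.ofReal ((y a).pred r) • outcomeLaw T (updateBelief y a r) := by
  have hp := (y a).pred_pos r
  have hp0 : ENNReal.ofReal ((y a).pred r) ≠ 0 := by simpa using hp
  -- `Measure.pi_eq` recognises a product measure by its values on boxes, so the scalar is first
  -- moved to the other side.
  have key : outcomeLaw T (updateBelief y a r) = (ENNReal.ofReal ((y a).pred r))⁻¹ •
      ((outcomeLaw (T + 1) y).restrict {ω | (ω a).2 0 = r}).map (shift a) := by
    refine Measure.pi_eq fun s hs => ?_
    have hms : MeasurableSet (Set.univ.pi s) := MeasurableSet.univ_pi hs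
    rw [Measure.smul_apply, Measure.map_apply (measurable_shift a) hms,
      Measure.restrict_apply (measurable_shift a hms)]
    have e : shift a ⁻¹' Set.univ.pi s ∩ {ω : Outcome K (T + 1) | (ω a).2 0 = r} =
        Set.univ.pi fun c => if c = a then {x | x.2 0 = r ∧ armTail x ∈ s c}
          else {x | armInit x ∈ s c} := by
      ext ω
      simp only [Set.mem_inter_iff, Set.mem_preimage, Set.mem_pi, Set.mem_univ, true_implies,
        Set.mem_ofPred_eq, shift]
      constructor
      · rintro ⟨h1, h2⟩ c
        have := h1 c
        split_ifs at this ⊢ with hc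
        · subst hc; exact ⟨h2, this⟩
        · exact this
      · intro h
        refine ⟨fun c => ?_, ?_⟩
        · have := h c
          split_ifs at this ⊢ with hc
          · exact this.2
          · exact this
        · have := h a
          rw [if_pos rfl] at this
          exact this.1
    rw [e, outcomeLaw, Measure.pi_pi, ← Finset.mul_prod_erase _ _ (Finset.mem_univ a),
      ← Finset.mul_prod_erase _ _ (Finset.mem_univ a), if_pos rfl, armLaw_succ_tail _ _ (hs a),
      smul_eq_mul, ← mul_assoc, ← mul_assoc, ENNReal.inv_mul_cancel hp0 ENNReal.ofReal_ne_top,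
      one_mul]
    congr 1
    · simp [updateBelief]
    · refine Finset.prod_congr rfl fun c hc => ?_
      have hca := Finset.ne_of_mem_erase hc
      rw [if_neg hca, armLaw_succ_init _ (hs c)]
      simp [updateBelief, hca]
  rw [key, smul_smul, ENNReal.mul_inv_cancel hp0 ENNReal.ofReal_ne_top, one_smul]

lemma integrable_of_bounded {α : Type*} [MeasurableSpace α] {ν : Measure α} [IsFiniteMeasure ν]
    {f : α → ℝ} (hf : Measurable f) (hb : ∃ C, ∀ x, |f x| ≤ C) : Integrable f ν := by
  obtain ⟨C, hC⟩ := hb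
  exact Integrable.of_bound hf.aestronglyMeasurable C (Filter.Eventually.of_forall hC)

/-- Disintegration of an integral along a binary result `g`. -/
lemma integral_first_result {X Y : Type*} [MeasurableSpace X] [MeasurableSpace Y] {ν : Measure X}
    [IsFiniteMeasure ν] {g : X → Bool} (hg : Measurable g) {f : X → Y} (hf : Measurable f)
    {p : Bool → ℝ} (hp : ∀ r, 0 ≤ p r) {κ : Bool → Measure Y}
    (h : ∀ r, (ν.restrict {x | g x = r}).map f = ENNReal.ofReal (p r) • κ r)
    {F : Bool → Y → ℝ} (hF : ∀ r, Measurable (F r)) (hb : ∀ r, ∃ C, ∀ ω, |F r ω| ≤ C) :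
    ∫ x, F (g x) (f x) ∂ν = ∑ r, p r * ∫ ω, F r ω ∂(κ r) := by
  choose C hC using hb
  have hms : ∀ r, MeasurableSet {x | g x = r} := fun r => measurableSet_eq_fun hg measurable_const
  have hi : Integrable (fun x => F (g x) (f x)) ν := by
    refine integrable_of_bounded ?_ ⟨max (C true) (C false), fun x => ?_⟩
    · have : Measurable fun p : Bool × Y => F p.1 p.2 := measurable_from_prod_countable_right hF
      exact this.comp (hg.prodMk hf)
    · cases g x
      · exact (hC _ _).trans (le_max_right _ _)
      · exact (hC _ _).trans (le_max_left _ _)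
  have h1 : ∀ r, ∫ x in {x | g x = r}, F (g x) (f x) ∂ν = p r * ∫ ω, F r ω ∂(κ r) := by
    intro r
    rw [setIntegral_congr_fun (g := fun x => F r (f x)) (hms r)
      (fun x (hx : g x = r) => by simp only [hx]),
      ← integral_map hf.aemeasurable (hF r).aestronglyMeasurable,
      h, integral_smul_measure, ENNReal.toReal_ofReal (hp r), smul_eq_mul]
  rw [← integral_add_compl (hms true) hi, Fintype.sum_bool, h1 true]
  have : {x | g x = true}ᶜ = {x | g x = false} := by ext x; simp
  rw [this, h1 false]

/-- One step of the bandit: integrating over the first result of arm `a`. -/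
lemma integral_outcomeLaw_succ {K T : ℕ} (y : Belief K) (a : Fin K)
    {F : Bool → Outcome K T → ℝ} (hF : ∀ r, Measurable (F r))
    (hb : ∀ r, ∃ C, ∀ ω, |F r ω| ≤ C) :
    ∫ ω, F ((ω a).2 0) (shift a ω) ∂(outcomeLaw (T + 1) y) =
      ∑ r, (y a).pred r * ∫ ω, F r ω ∂(outcomeLaw T (updateBelief y a r)) :=
  integral_first_result (by fun_prop) (measurable_shift a) (fun r => ((y a).pred_pos r).le)
    (map_shift_restrict y a) hF hb

/-- One step of a single arm: integrating over its first result. -/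
lemma integral_armLaw_succ {T : ℕ} (y : BetaParam) {F : Bool → ℝ × (Fin T → Bool) → ℝ}
    (hF : ∀ r, Measurable (F r)) (hb : ∀ r, ∃ C, ∀ x, |F r x| ≤ C) :
    ∫ x, F (x.2 0) (armTail x) ∂(armLaw (T + 1) y) =
      ∑ r, y.pred r * ∫ x, F r x ∂(armLaw T (y.update r)) := by
  refine integral_first_result (g := fun x : ℝ × (Fin (T + 1) → Bool) => x.2 0) (by fun_prop)
    measurable_armTail (fun r => (y.pred_pos r).le) (fun r => ?_) hF hb
  ext s hs
  rw [Measure.map_apply measurable_armTail hs, Measure.restrict_apply (measurable_armTail hs),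
    Measure.smul_apply, smul_eq_mul, ← armLaw_succ_tail y r hs]
  congr 1
  ext x
  exact and_comm

/-! ### Action sequences that begin with a given arm. -/

lemma pullIndex_cons_succ {K T : ℕ} (b : Fin K) (a : Actions K T) (t : Fin T) :
    (pullIndex (Fin.cons b a : Actions K (T + 1)) t.succ : ℕ) =
      (if b = a t then 1 else 0) + pullIndex a t := by
  simp only [pullIndex, Fin.cons_succ]
  rw [Finset.card_filter, Finset.card_filter, Fin.sum_univ_succ]
  simp

lemma pullIndex_cons_zero {K T : ℕ} (b : Fin K) (a : Actions K T) :
    pullIndex (Fin.cons b a : Actions K (T + 1)) 0 = 0 := by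
  ext
  simp [pullIndex]

lemma observation_cons_zero {K T : ℕ} (b : Fin K) (a : Actions K T) (ω : Outcome K (T + 1)) :
    observation (Fin.cons b a : Actions K (T + 1)) 0 ω = (ω b).2 0 := by
  simp only [observation, pullIndex_cons_zero, Fin.cons_zero]

lemma observation_cons_succ {K T : ℕ} (b : Fin K) (a : Actions K T) (t : Fin T)
    (ω : Outcome K (T + 1)) :
    observation (Fin.cons b a : Actions K (T + 1)) t.succ ω = observation a t (shift b ω) := by
  have h := pullIndex_cons_succ b a t
  simp only [observation, Fin.cons_succ, shift]
  by_cases hb : a t = b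
  · rw [if_pos hb.symm] at h
    rw [if_pos hb]
    simp only [armTail, Fin.tail]
    refine congrArg (ω (a t)).2 (Fin.ext ?_)
    rw [h, Fin.val_succ, add_comm]
  · rw [if_neg (Ne.symm hb)] at h
    rw [if_neg hb]
    simp only [armInit, Fin.init]
    refine congrArg (ω (a t)).2 (Fin.ext ?_)
    rw [h, Fin.val_castSucc, zero_add]

lemma reward_cons_succ {K T : ℕ} (b : Fin K) (a : Actions K T) (t : Fin T)
    (ω : Outcome K (T + 1)) :
    reward (Fin.cons b a : Actions K (T + 1)) t.succ ω = reward a t (shift b ω) := by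
  simp only [reward, observation_cons_succ]

lemma posterior_cons_succ {K T : ℕ} (y : Belief K) (b : Fin K) (a : Actions K T)
    (ω : Outcome K (T + 1)) (t : ℕ) :
    posterior y (Fin.cons b a : Actions K (T + 1)) ω (t + 1) =
      posterior (updateBelief y b ((ω b).2 0)) a (shift b ω) t := by
  induction t with
  | zero =>
    simp only [posterior, dif_pos (Nat.succ_pos T)]
    have : (⟨0, Nat.succ_pos T⟩ : Fin (T + 1)) = 0 := rfl
    rw [this, observation_cons_zero, Fin.cons_zero]
  | succ t ih =>
    rw [posterior, ih]
    conv_rhs => rw [posterior]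
    by_cases h : t < T
    · rw [dif_pos h, dif_pos (Nat.succ_lt_succ h)]
      have : (⟨t + 1, Nat.succ_lt_succ h⟩ : Fin (T + 1)) = Fin.succ ⟨t, h⟩ := rfl
      rw [this, observation_cons_succ, Fin.cons_succ]
    · rw [dif_neg h, dif_neg (by omega)]

/-! ### Functions of the finitely many binary results. -/

/-- All the binary results of an outcome. -/
def results {K T : ℕ} (ω : Outcome K T) : Fin K → Fin T → Bool := fun c => (ω c).2

@[fun_prop]
lemma measurable_results {K T : ℕ} : Measurable (results (K := K) (T := T)) := by
  unfold results; fun_prop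

/-- Rewards, posteriors and path probabilities see an outcome only through finitely many bits.
Measurability and boundedness are then automatic, without any regularity of the policy in the
belief. -/
lemma measurable_of_factorsThrough {Ω β : Type*} [MeasurableSpace Ω] [MeasurableSpace β]
    [DiscreteMeasurableSpace β] {g : Ω → β} (hg : Measurable g) {f : Ω → ℝ}
    (h : f.FactorsThrough g) : Measurable f := by
  have : f = Function.extend g f 0 ∘ g := by
    ext ω; exact (h.extend_apply 0 ω).symm
  rw [this]
  exact Measurable.of_discrete.comp hg

lemma bounded_of_factorsThrough {Ω β : Type*} [Finite β] {g : Ω → β} {f : Ω → ℝ}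
    (h : f.FactorsThrough g) : ∃ C, ∀ ω, |f ω| ≤ C := by
  obtain ⟨C, hC⟩ := (Set.finite_range fun b => |Function.extend g f 0 b|).bddAbove
  exact ⟨C, fun ω => by rw [← h.extend_apply 0 ω]; exact hC ⟨g ω, rfl⟩⟩

lemma observation_congr {K T : ℕ} (a : Actions K T) (t : Fin T) {ω ω' : Outcome K T}
    (h : results ω = results ω') : observation a t ω = observation a t ω' :=
  congrFun (congrFun h (a t)) _

lemma posterior_congr {K T : ℕ} (y : Belief K) (a : Actions K T) {ω ω' : Outcome K T}
    (h : results ω = results ω') (t : ℕ) : posterior y a ω t = posterior y a ω' t := by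
  induction t with
  | zero => rfl
  | succ t ih => simp only [posterior, ih, observation_congr a _ h]

/-! ### Dynamic programming and accumulation of losses. -/

/-- The probability that the policy `π` follows the action sequence `a`. -/
noncomputable def pathProb {K T : ℕ} (π : Policy K) (y : Belief K) (ω : Outcome K T)
    (a : Actions K T) : ℝ :=
  ∏ t : Fin T, (π (T - (t : ℕ)) (posterior y a ω (t : ℕ))).real {a t}

/-- The expected total reward of the policy `π` given the outcome. -/
noncomputable def pathValue {K T : ℕ} (π : Policy K) (y : Belief K) (ω : Outcome K T) : ℝ :=
  ∑ a : Actions K T, pathProb π y ω a * ∑ t : Fin T, reward a t ω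

lemma performance_eq {K : ℕ} (π : Policy K) (T : ℕ) (y : Belief K) :
    performance π T y = ∫ ω, pathValue π y ω ∂(outcomeLaw T y) := rfl

lemma pathProb_cons {K T : ℕ} (π : Policy K) (y : Belief K) (ω : Outcome K (T + 1)) (b : Fin K)
    (a : Actions K T) :
    pathProb π y ω (Fin.cons b a) =
      (π (T + 1) y).real {b} * pathProb π (updateBelief y b ((ω b).2 0)) (shift b ω) a := by
  rw [pathProb, Fin.prod_univ_succ, pathProb]
  congr 1
  refine Finset.prod_congr rfl fun t _ => ?_
  rw [Fin.val_succ, posterior_cons_succ, Nat.add_sub_add_right, Fin.cons_succ]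

lemma sum_actions_succ {K T : ℕ} (f : Actions K (T + 1) → ℝ) :
    ∑ a, f a = ∑ b, ∑ a : Actions K T, f (Fin.cons b a) := by
  rw [← Fintype.sum_prod_type', ← (Fin.consEquiv fun _ : Fin (T + 1) => Fin K).sum_comp]
  rfl

lemma sum_real_singleton {K : ℕ} (ν : Measure (Fin K)) [IsProbabilityMeasure ν] :
    ∑ b, ν.real {b} = 1 := by
  rw [sum_measureReal_singleton]; simp

/-- Lets the continuation be summed out beside the first reward. Only positive remaining times are
constrained because `irsPolicy` is the zero measure at time zero. -/
lemma sum_pathProb {K T : ℕ} {π : Policy K}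
    (hπ : ∀ τ, 0 < τ → ∀ y, IsProbabilityMeasure (π τ y)) (y : Belief K) (ω : Outcome K T) :
    ∑ a, pathProb π y ω a = 1 := by
  induction T generalizing y with
  | zero => simp [pathProb]
  | succ T ih =>
    have := hπ (T + 1) (Nat.succ_pos T) y
    simp_rw [sum_actions_succ, pathProb_cons, ← Finset.mul_sum, ih, mul_one]
    exact sum_real_singleton _

/-- The numerical value of a binary result. -/
def val (r : Bool) : ℝ := if r then 1 else 0

lemma pathValue_succ {K T : ℕ} {π : Policy K}
    (hπ : ∀ τ, 0 < τ → ∀ y, IsProbabilityMeasure (π τ y)) (y : Belief K)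
    (ω : Outcome K (T + 1)) :
    pathValue π y ω = ∑ b, (π (T + 1) y).real {b} *
      (val ((ω b).2 0) + pathValue π (updateBelief y b ((ω b).2 0)) (shift b ω)) := by
  rw [pathValue, sum_actions_succ]
  refine Finset.sum_congr rfl fun b _ => ?_
  simp_rw [pathProb_cons, Fin.sum_univ_succ, reward_cons_succ, mul_assoc]
  rw [← Finset.mul_sum]
  congr 1
  simp_rw [mul_add, Finset.sum_add_distrib]
  have : ∀ a : Actions K T, reward (Fin.cons b a : Actions K (T + 1)) 0 ω = val ((ω b).2 0) :=
    fun a => by rw [reward, observation_cons_zero]; rfl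
  simp_rw [this, ← Finset.sum_mul, sum_pathProb hπ, one_mul, pathValue]

lemma pathValue_factorsThrough {K T : ℕ} (π : Policy K) (y : Belief K) :
    Function.FactorsThrough (fun ω : Outcome K T => pathValue π y ω) results := by
  intro ω ω' h
  simp only [pathValue, pathProb, reward, posterior_congr y _ h, observation_congr _ _ h]

lemma integrable_pathValue {K T : ℕ} (π : Policy K) (y y' : Belief K) :
    Integrable (fun ω : Outcome K T => pathValue π y ω) (outcomeLaw T y') :=
  integrable_of_bounded
    (measurable_of_factorsThrough measurable_results (pathValue_factorsThrough π y))
    (bounded_of_factorsThrough (pathValue_factorsThrough π y))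

lemma val_factorsThrough {K T : ℕ} (b : Fin K) (t : Fin T) :
    Function.FactorsThrough (fun ω : Outcome K T => val ((ω b).2 t)) results := by
  intro ω ω' h
  exact congrArg val (congrFun (congrFun h b) t)

lemma sum_pred_mul_val (y : BetaParam) : ∑ r, y.pred r * val r = y.mean := by
  simp [val, BetaParam.pred, BetaParam.mean]

/-- The dynamic programming recursion for the performance of a policy. -/
lemma performance_succ {K T : ℕ} {π : Policy K}
    (hπ : ∀ τ, 0 < τ → ∀ y, IsProbabilityMeasure (π τ y)) (y : Belief K) :
    performance π (T + 1) y = ∑ b, (π (T + 1) y).real {b} *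
      ((y b).mean + ∑ r, (y b).pred r * performance π T (updateBelief y b r)) := by
  have hF : ∀ (b : Fin K) (r : Bool), Function.FactorsThrough (fun ω : Outcome K T =>
      val r + pathValue π (updateBelief y b r) ω) results := fun b r ω ω' h => by
    simp only [pathValue_factorsThrough π _ h]
  have hG : ∀ b : Fin K, Function.FactorsThrough (fun ω : Outcome K (T + 1) =>
      val ((ω b).2 0) + pathValue π (updateBelief y b ((ω b).2 0)) (shift b ω)) results := by
    intro b ω ω' h
    have h0 : (ω b).2 0 = (ω' b).2 0 := congrFun (congrFun h b) 0
    have hs : results (shift b ω) = results (shift b ω') := by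
      ext c t
      have hc : (ω c).2 = (ω' c).2 := congrFun h c
      simp only [results, shift]
      split_ifs <;> simp only [armTail, armInit, hc]
    simp only [h0, pathValue_factorsThrough π _ hs]
  rw [performance_eq, integral_congr_ae (Filter.Eventually.of_forall fun ω => pathValue_succ hπ y ω),
    integral_finsetSum]
  · refine Finset.sum_congr rfl fun b _ => ?_
    rw [integral_const_mul, integral_outcomeLaw_succ y b
      (F := fun r ω => val r + pathValue π (updateBelief y b r) ω)
      (fun r => measurable_of_factorsThrough measurable_results (hF b r))
      (fun r => bounded_of_factorsThrough (hF b r)), ← sum_pred_mul_val, ← Finset.sum_add_distrib]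
    congr 1
    refine Finset.sum_congr rfl fun r _ => ?_
    rw [integral_add (integrable_const _) (integrable_pathValue π _ _)]
    simp [performance_eq, mul_add]
  · intro b _
    exact (integrable_of_bounded (measurable_of_factorsThrough measurable_results (hG b))
      (bounded_of_factorsThrough (hG b))).const_mul _

lemma performance_zero {K : ℕ} (π : Policy K) (y : Belief K) : performance π 0 y = 0 := by
  simp [performance]

lemma performance_nonneg {K : ℕ} (π : Policy K) (T : ℕ) (y : Belief K) :
    0 ≤ performance π T y := by
  refine integral_nonneg fun ω => Finset.sum_nonneg fun a _ => mul_nonneg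
    (Finset.prod_nonneg fun t _ => measureReal_nonneg) (Finset.sum_nonneg fun t _ => ?_)
  unfold reward; split_ifs <;> norm_num

/-- Accumulation of the losses of single steps: `U` is an upper bound function, `δ` is a loss per
step, and `e` is a loss per pull that is controlled by the increments of `G`. -/
lemma sub_performance_le {K : ℕ} {π : Policy K}
    (hπ : ∀ τ, 0 < τ → ∀ y, IsProbabilityMeasure (π τ y))
    (T : ℕ) (U : ℕ → Belief K → ℝ) (δ : ℕ → ℝ) (e : ℕ → Belief K → Fin K → ℝ) (G : ℕ → ℝ) (C : ℝ)
    (hU0 : ∀ y, U 0 y ≤ 0)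
    (hU : ∀ τ, τ < T → ∀ y, U (τ + 1) y - ∑ b, (π (τ + 1) y).real {b} *
      ((y b).mean + ∑ r, (y b).pred r * U τ (updateBelief y b r)) ≤
        δ τ + ∑ b, (π (τ + 1) y).real {b} * e τ y b)
    (he : ∀ τ (y : Belief K) b (m : ℕ), τ + 1 + m ≤ T → (m : ℝ) ≤ (y b).size →
      e τ y b ≤ G (m + 1) - G m)
    (hC : ∀ n : Fin K → ℕ, ∑ b, n b = T → ∑ b, G (n b) ≤ C) (hG0 : G 0 = 0) (y : Belief K) :
    U T y - performance π T y ≤ ∑ τ ∈ Finset.range T, δ τ + C := by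
  -- Invariant: m b is the number of pulls of arm b so far, a lower bound for its size because each
  -- update adds one to the size. The unspent budget is C − ∑ G(m b).
  have main : ∀ τ (y : Belief K) (m : Fin K → ℕ), τ + ∑ b, m b = T →
      (∀ b, (m b : ℝ) ≤ (y b).size) →
      U τ y - performance π τ y ≤ ∑ i ∈ Finset.range τ, δ i + (C - ∑ b, G (m b)) := by
    intro τ
    induction τ with
    | zero =>
      intro y m hm _
      -- With no time left, m is itself a full count vector, so the unspent budget is nonnegative.
      have := hC m (by omega)
      have := hU0 y
      rw [performance_zero]
      simp only [Finset.range_zero, Finset.sum_empty]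
      linarith
    | succ τ ih =>
      intro y m hm hmy
      have := hπ (τ + 1) (Nat.succ_pos τ) y
      have h1 := hU τ (by omega) y
      have h2 := performance_succ (T := τ) hπ y
      set p : Fin K → ℝ := fun b => (π (τ + 1) y).real {b} with hp
      have hps : ∑ b, p b = 1 := sum_real_singleton _
      -- Pulling b spends G(m b + 1) − G(m b), exactly the amount by which the budget of the
      -- induction hypothesis at the incremented counts is smaller.
      have hstep : ∀ b, e τ y b + ((∑ r, (y b).pred r * U τ (updateBelief y b r)) -
          ∑ r, (y b).pred r * performance π τ (updateBelief y b r)) ≤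
          ∑ i ∈ Finset.range τ, δ i + (C - ∑ b, G (m b)) := by
        intro b
        have hmb : m b ≤ ∑ b, m b := Finset.single_le_sum (fun _ _ => Nat.zero_le _) (Finset.mem_univ b)
        have heb := he τ y b (m b) (by omega) (hmy b)
        have hsum : ∀ f : ℕ → ℝ, ∑ c, f (Function.update m b (m b + 1) c) =
            ∑ c, f (m c) + (f (m b + 1) - f (m b)) := by
          intro f
          rw [← Finset.add_sum_erase _ _ (Finset.mem_univ b),
            ← Finset.add_sum_erase (a := b) _ (fun c => f (m c)) (Finset.mem_univ b),
            Function.update_self]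
          have : ∀ c ∈ Finset.univ.erase b, f (Function.update m b (m b + 1) c) = f (m c) :=
            fun c hc => by rw [Function.update_of_ne (Finset.ne_of_mem_erase hc)]
          rw [Finset.sum_congr rfl this]
          ring
        have hsumN : ∑ c, Function.update m b (m b + 1) c = ∑ c, m c + 1 := by
          have := hsum (fun n => (n : ℝ))
          push_cast at this
          have h' : ((∑ c, Function.update m b (m b + 1) c : ℕ) : ℝ) = ((∑ c, m c + 1 : ℕ) : ℝ) := by
            push_cast; linarith
          exact_mod_cast h'
        have hih : ∀ r, U τ (updateBelief y b r) - performance π τ (updateBelief y b r) ≤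
            ∑ i ∈ Finset.range τ, δ i + (C - ∑ b, G (m b)) - (G (m b + 1) - G (m b)) := by
          intro r
          have := ih (updateBelief y b r) (Function.update m b (m b + 1)) (by omega) (by
            intro c
            by_cases hc : c = b
            · subst hc
              simp only [updateBelief, Function.update_self, BetaParam.size_update]
              push_cast
              linarith [hmy c]
            · simpa [updateBelief, hc] using hmy c)
          rw [hsum G] at this
          linarith
        have ht := mul_le_mul_of_nonneg_left (hih true) ((y b).pred_pos true).le
        have hf := mul_le_mul_of_nonneg_left (hih false) ((y b).pred_pos false).le
        have h1 := (y b).pred_true_add_pred_false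
        rw [Fintype.sum_bool, Fintype.sum_bool]
        have h1' : (y b).pred false = 1 - (y b).pred true := by linarith
        rw [h1'] at hf ⊢
        nlinarith
      have hsumstep := Finset.sum_le_sum fun b (_ : b ∈ Finset.univ) =>
        mul_le_mul_of_nonneg_left (hstep b) (measureReal_nonneg : 0 ≤ (π (τ + 1) y).real {b})
      rw [← Finset.sum_mul] at hsumstep
      change _ ≤ (∑ b, p b) * _ at hsumstep
      rw [hps, one_mul] at hsumstep
      simp only [mul_add, mul_sub, Finset.sum_add_distrib, Finset.sum_sub_distrib] at hsumstep h1 h2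
      rw [Finset.sum_range_succ]
      linarith
  have := main T y 0 (by simp) (fun b => by simpa using (y b).size_pos.le)
  simpa [hG0] using this

/-! ### Posterior means. -/

lemma BetaParam.mean_nonneg (y : BetaParam) : 0 ≤ y.mean :=
  div_nonneg y.α_pos.le y.size_pos.le

lemma BetaParam.mean_le_one (y : BetaParam) : y.mean ≤ 1 :=
  (div_le_one y.size_pos).2 (by unfold BetaParam.size; linarith [y.β_pos])

lemma BetaParam.pred_true (y : BetaParam) : y.pred true = y.mean := rfl

lemma BetaParam.pred_false (y : BetaParam) : y.pred false = 1 - y.mean := by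
  have := y.pred_true_add_pred_false
  rw [y.pred_true] at this
  linarith

/-- Together with `mean_update_false` this shows that the two possible new means differ by 1/(size +
1), the range that enters Hoeffding's lemma. -/
lemma BetaParam.mean_update_true (y : BetaParam) :
    (y.update true).mean - y.mean = (1 - y.mean) / (y.size + 1) := by
  have := y.α_pos; have := y.β_pos
  have h : y.α + 1 + y.β ≠ 0 := by positivity
  have h' : y.α + y.β + 1 ≠ 0 := by positivity
  simp only [BetaParam.mean, BetaParam.update, BetaParam.size]
  field_simp
  ring

lemma BetaParam.mean_update_false (y : BetaParam) :
    (y.update false).mean - y.mean = -y.mean / (y.size + 1) := by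
  have := y.α_pos; have := y.β_pos
  have h : y.α + (y.β + 1) ≠ 0 := by positivity
  have h' : y.α + y.β + 1 ≠ 0 := by positivity
  simp only [BetaParam.mean, BetaParam.update, BetaParam.size]
  field_simp
  ring

/-- The posterior mean of an arm after its first `n` results. -/
noncomputable def postMean {T : ℕ} (y : BetaParam) (R : Fin T → Bool) (n : ℕ) : ℝ :=
  (y.α + ∑ i : Fin T, if (i : ℕ) < n then val (R i) else 0) / (y.size + n)

lemma postMean_zero {T : ℕ} (y : BetaParam) (R : Fin T → Bool) : postMean y R 0 = y.mean := by
  simp [postMean, BetaParam.mean, BetaParam.size]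

/-- The first result is absorbed into the prior. Every later induction on the number of results
rests on this identity. -/
lemma postMean_succ {T : ℕ} (y : BetaParam) (R : Fin (T + 1) → Bool) (n : ℕ) :
    postMean y R (n + 1) = postMean (y.update (R 0)) (Fin.tail R) n := by
  simp only [postMean, Fin.sum_univ_succ, BetaParam.size_update, Fin.tail]
  cases h : R 0 <;> simp [BetaParam.update, val] <;> ring_nf

lemma postMean_init {T : ℕ} (y : BetaParam) (R : Fin (T + 1) → Bool) {n : ℕ} (hn : n ≤ T) :
    postMean y (Fin.init R) n = postMean y R n := by
  simp [postMean, Fin.sum_univ_castSucc, Fin.init, hn.not_gt]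

lemma postMean_congr {T : ℕ} (y : BetaParam) {R R' : Fin T → Bool} {n : ℕ}
    (h : ∀ i : Fin T, (i : ℕ) < n → R i = R' i) : postMean y R n = postMean y R' n := by
  unfold postMean
  congr 2
  refine Finset.sum_congr rfl fun i _ => ?_
  by_cases hi : (i : ℕ) < n
  · rw [h i hi]
  · simp [hi]

lemma postMean_mem {T : ℕ} (y : BetaParam) (R : Fin T → Bool) (n : ℕ) :
    0 ≤ postMean y R n ∧ postMean y R n ≤ 1 := by
  induction T generalizing y n with
  | zero =>
    have := y.α_pos
    have := y.β_pos
    simp only [postMean, Finset.univ_eq_empty, Finset.sum_empty, add_zero, BetaParam.size]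
    refine ⟨by positivity, ?_⟩
    rw [div_le_one (by positivity)]
    have : (0 : ℝ) ≤ n := Nat.cast_nonneg n
    linarith
  | succ T ih =>
    cases n with
    | zero => rw [postMean_zero]; exact ⟨y.mean_nonneg, y.mean_le_one⟩
    | succ n => rw [postMean_succ]; exact ih _ _ _

lemma measurable_postMean {T : ℕ} (y : BetaParam) (n : ℕ) :
    Measurable fun x : ℝ × (Fin T → Bool) => postMean y x.2 n :=
  (Measurable.of_discrete (f := fun R : Fin T → Bool => postMean y R n)).comp measurable_snd

/-! ### Moments of the parameter and orthogonality to the results. -/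

lemma map_fst_armLaw (T : ℕ) (y : BetaParam) : (armLaw T y).map Prod.fst = betaMeasure y.α y.β := by
  have := isProbabilityMeasureBeta y.α_pos y.β_pos
  exact Measure.fst_compProd _ _

lemma integral_fst_armLaw (T : ℕ) (y : BetaParam) {f : ℝ → ℝ} (hf : Measurable f) :
    ∫ x, f x.1 ∂(armLaw T y) = ∫ θ, f θ ∂(betaMeasure y.α y.β) := by
  rw [← map_fst_armLaw T y, integral_map measurable_fst.aemeasurable hf.aestronglyMeasurable]

lemma integral_betaMeasure_update (y : BetaParam) {f : ℝ → ℝ} (hf : Measurable f)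
    (hb : ∃ C, ∀ x, |f x| ≤ C) :
    ∫ θ, f θ ∂(betaMeasure y.α y.β) =
      ∑ r, y.pred r * ∫ θ, f θ ∂(betaMeasure (y.update r).α (y.update r).β) := by
  rw [← integral_fst_armLaw 1 y hf]
  have h := integral_armLaw_succ (T := 0) y (F := fun _ x => f x.1)
    (fun _ => hf.comp measurable_fst) (fun _ => hb.imp fun C hC x => hC x.1)
  simp_rw [integral_fst_armLaw 0 _ hf] at h
  exact h

/-- Size-biasing a Beta law by its parameter is the update after a success. With f = 1 it gives the
mean, with f = `clamp` the second moment. -/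
lemma integral_clamp_mul (y : BetaParam) {f : ℝ → ℝ} (hf : Measurable f) (h0 : ∀ θ, 0 ≤ f θ) :
    ∫ θ, clamp θ * f θ ∂(betaMeasure y.α y.β) =
      y.mean * ∫ θ, f θ ∂(betaMeasure (y.update true).α (y.update true).β) := by
  rw [integral_eq_lintegral_of_nonneg_ae
      (Filter.Eventually.of_forall fun θ => mul_nonneg (clamp_nonneg θ) (h0 θ))
      (measurable_clamp.mul hf).aestronglyMeasurable,
    integral_eq_lintegral_of_nonneg_ae (Filter.Eventually.of_forall h0) hf.aestronglyMeasurable]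
  simp_rw [ENNReal.ofReal_mul (clamp_nonneg _)]
  have := lintegral_bern_mul y true hf.ennreal_ofReal
  rw [show (fun θ => ENNReal.ofReal (clamp θ) * ENNReal.ofReal (f θ)) =
    fun θ => ENNReal.ofReal (bern θ true) * ENNReal.ofReal (f θ) from rfl, this,
    ENNReal.toReal_mul, ENNReal.toReal_ofReal (y.pred_pos true).le, y.pred_true]

lemma integral_clamp (y : BetaParam) : ∫ θ, clamp θ ∂(betaMeasure y.α y.β) = y.mean := by
  have := isProbabilityMeasureBeta (y.update true).α_pos (y.update true).β_pos
  have h := integral_clamp_mul y (f := fun _ => 1) measurable_const (fun _ => zero_le_one)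
  simpa using h

lemma abs_clamp_le (θ : ℝ) : |clamp θ| ≤ 1 :=
  abs_le.2 ⟨by linarith [clamp_nonneg θ], clamp_le_one θ⟩

lemma integral_clamp_sub_sq_le (y : BetaParam) :
    ∫ θ, (clamp θ - y.mean) ^ 2 ∂(betaMeasure y.α y.β) ≤ 1 / y.size := by
  have := isProbabilityMeasureBeta y.α_pos y.β_pos
  have h := integral_clamp_mul y measurable_clamp clamp_nonneg
  rw [integral_clamp] at h
  have i1 : Integrable clamp (betaMeasure y.α y.β) :=
    integrable_of_bounded measurable_clamp ⟨1, abs_clamp_le⟩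
  have i2 : Integrable (fun θ => clamp θ * clamp θ) (betaMeasure y.α y.β) :=
    integrable_of_bounded (by fun_prop) ⟨1, fun θ => by
      rw [abs_mul]; exact mul_le_one₀ (abs_clamp_le θ) (abs_nonneg _) (abs_clamp_le θ)⟩
  have i3 : Integrable (fun θ => 2 * y.mean * clamp θ) (betaMeasure y.α y.β) := i1.const_mul _
  have i4 : Integrable (fun θ => clamp θ * clamp θ - 2 * y.mean * clamp θ)
    (betaMeasure y.α y.β) := i2.sub i3
  have e : ∀ θ, (clamp θ - y.mean) ^ 2 = clamp θ * clamp θ - 2 * y.mean * clamp θ + y.mean ^ 2 :=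
    fun θ => by ring
  simp_rw [e]
  rw [integral_add i4 (integrable_const _), integral_sub i2 i3, h, integral_const_mul, integral_clamp]
  simp only [integral_const, probReal_univ, one_smul]
  have hm := y.mean_update_true
  have : (y.update true).mean = y.mean + (1 - y.mean) / (y.size + 1) := by linarith
  rw [this]
  have hs := y.size_pos
  have h0 := y.mean_nonneg
  have h1 := y.mean_le_one
  calc _ = y.mean * (1 - y.mean) / (y.size + 1) := by ring
    _ ≤ 1 / (y.size + 1) := by gcongr; nlinarith
    _ ≤ 1 / y.size := by gcongr; linarith

lemma postMean_factor_bounded {T : ℕ} (y : BetaParam) (h : (Fin T → Bool) → ℝ) (n : ℕ) :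
    ∃ C, ∀ x : ℝ × (Fin T → Bool), |h x.2 * (clamp x.1 - postMean y x.2 n)| ≤ C := by
  obtain ⟨C, hC⟩ := (Set.finite_range fun R => |h R|).bddAbove
  refine ⟨C * 1, fun x => ?_⟩
  rw [abs_mul]
  have hx : |h x.2| ≤ C := hC ⟨x.2, rfl⟩
  refine mul_le_mul hx ?_ (abs_nonneg _) ((abs_nonneg _).trans hx)
  have := postMean_mem y x.2 n
  have := clamp_nonneg x.1
  have := clamp_le_one x.1
  rw [abs_le]; constructor <;> linarith

/-- `postMean` is the conditional expectation of the parameter given the first `n` results. -/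
lemma integral_mul_clamp_sub_postMean {T : ℕ} (y : BetaParam) (n : ℕ) (hn : n ≤ T)
    (h : (Fin T → Bool) → ℝ)
    (hh : ∀ R R' : Fin T → Bool, (∀ i : Fin T, (i : ℕ) < n → R i = R' i) → h R = h R') :
    ∫ x, h x.2 * (clamp x.1 - postMean y x.2 n) ∂(armLaw T y) = 0 := by
  induction n generalizing T y with
  | zero =>
    -- With no results to depend on, h is constant; the all-`true` sequence is an arbitrary point at
    -- which to evaluate it.
    have e : ∀ x : ℝ × (Fin T → Bool), h x.2 * (clamp x.1 - postMean y x.2 0) =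
        h (fun _ => true) * (clamp x.1 - y.mean) := fun x => by
      rw [postMean_zero, hh x.2 (fun _ => true) (fun i hi => absurd hi (Nat.not_lt_zero _))]
    have := isProbabilityMeasureBeta y.α_pos y.β_pos
    simp_rw [e]
    rw [integral_const_mul, integral_fst_armLaw T y (f := fun θ => clamp θ - y.mean) (by fun_prop),
      integral_sub (integrable_of_bounded measurable_clamp ⟨1, abs_clamp_le⟩)
        (integrable_const _), integral_clamp]
    simp
  | succ n ih =>
    obtain ⟨T, rfl⟩ : ∃ T', T = T' + 1 := ⟨T - 1, by omega⟩
    have e : ∀ x : ℝ × (Fin (T + 1) → Bool), h x.2 * (clamp x.1 - postMean y x.2 (n + 1)) =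
        (fun (r : Bool) (z : ℝ × (Fin T → Bool)) => h (Fin.cons r z.2) *
          (clamp z.1 - postMean (y.update r) z.2 n)) (x.2 0) (armTail x) := fun x => by
      simp only [armTail, postMean_succ, Fin.cons_self_tail]
    simp_rw [e]
    rw [integral_armLaw_succ y
      (F := fun (r : Bool) (z : ℝ × (Fin T → Bool)) => h (Fin.cons r z.2) *
          (clamp z.1 - postMean (y.update r) z.2 n))
      (fun r => Measurable.mul
        ((Measurable.of_discrete (f := fun R : Fin T → Bool => h (Fin.cons r R))).comp
          measurable_snd)
        ((measurable_clamp.comp measurable_fst).sub (measurable_postMean _ _)))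
      (fun r => postMean_factor_bounded _ (fun R => h (Fin.cons r R)) n)]
    refine Finset.sum_eq_zero fun r _ => ?_
    rw [ih (y.update r) (by omega) (fun R => h (Fin.cons r R)), mul_zero]
    intro R R' hR
    refine hh _ _ fun i => ?_
    refine Fin.cases (fun _ => by simp) (fun i hi => ?_) i
    simpa using hR i (by simpa using hi)

/-! ### Sub-Gaussian concentration of posterior means and of the Beta law. -/

/-- The variance proxy of the posterior mean after `n` more results. -/
noncomputable def proxy (n : ℕ) (s : ℝ) : ℝ := 1 / (s + 1 / 2) - 1 / (s + n + 1 / 2)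

lemma proxy_nonneg (n : ℕ) {s : ℝ} (hs : 0 ≤ s) : 0 ≤ proxy n s := by
  unfold proxy
  rw [sub_nonneg]
  gcongr
  have : (0 : ℝ) ≤ n := Nat.cast_nonneg n
  linarith

lemma proxy_pos {n : ℕ} (hn : n ≠ 0) {s : ℝ} (hs : 0 ≤ s) : 0 < proxy n s := by
  unfold proxy
  rw [sub_pos]
  have : (0 : ℝ) < n := by positivity
  gcongr
  linarith

/-- The shift by 1/2 is what makes the sum of squared ranges telescope: (s + 1/2)(s + 3/2) = (s +
1)² − 1/4 is smaller than (s + 1)². -/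
lemma proxy_succ_ge (n : ℕ) {s : ℝ} (hs : 0 ≤ s) :
    1 / (s + 1) ^ 2 + proxy n (s + 1) ≤ proxy (n + 1) s := by
  unfold proxy
  push_cast
  have h : 1 / (s + 1) ^ 2 ≤ 1 / (s + 1 / 2) - 1 / (s + 1 + 1 / 2) := by
    rw [div_sub_div _ _ (by positivity) (by positivity), div_le_div_iff₀ (by positivity)
      (by positivity)]
    nlinarith
  rw [show s + 1 + (n : ℝ) + 1 / 2 = s + (n + 1) + 1 / 2 by ring]
  linarith

/-- Hoeffding's lemma for a Bernoulli variable. -/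
lemma bernoulli_mgf_le {p : ℝ} (h0 : 0 ≤ p) (h1 : p ≤ 1) (t : ℝ) :
    p * Real.exp (t * (1 - p)) + (1 - p) * Real.exp (t * (-p)) ≤ Real.exp (t ^ 2 / 8) := by
  have h := hasSubgaussianMGF_of_mem_Icc (μ := bernoulliMeasure true false ⟨p, h0, h1⟩)
    (X := val) (a := 0) (b := 1) Measurable.of_discrete.aemeasurable
    (Filter.Eventually.of_forall fun r => by cases r <;> simp [val])
  have h2 := h.mgf_le t
  simp only [mgf, integral_bernoulliMeasure] at h2
  simp only [val, smul_eq_mul] at h2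
  norm_num at h2
  refine (le_of_eq ?_).trans (h2.trans (le_of_eq ?_))
  · ring_nf
  · congr 1; ring

/-- One step of the posterior mean is sub-Gaussian. -/
lemma sum_pred_exp_le (y : BetaParam) (l : ℝ) :
    ∑ r, y.pred r * Real.exp (l * ((y.update r).mean - y.mean)) ≤
      Real.exp (l ^ 2 * (1 / (y.size + 1) ^ 2) / 8) := by
  have h := bernoulli_mgf_le y.mean_nonneg y.mean_le_one (l / (y.size + 1))
  rw [Fintype.sum_bool, y.pred_true, y.pred_false, y.mean_update_true, y.mean_update_false]
  refine (le_of_eq ?_).trans (h.trans (le_of_eq ?_))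
  · congr 3 <;> ring_nf
  · congr 1; rw [div_pow]; ring

/-- Supermartingale step: the exponential factor of one Hoeffding step is paid for by the decrease
of the proxy. The free x and c serve two uses, a threshold with c = 1 in the maximal inequality, and
x the initial mean with c a remainder in the bound for the Beta law. -/
lemma sum_pred_exp_mul_le (y : BetaParam) (l x c : ℝ) (n : ℕ) (hc : 0 ≤ c) :
    ∑ r, y.pred r * (Real.exp (l * ((y.update r).mean - x) +
      l ^ 2 * proxy n (y.update r).size / 8) * c) ≤
      Real.exp (l * (y.mean - x) + l ^ 2 * proxy (n + 1) y.size / 8) * c := by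
  have h := sum_pred_exp_le y l
  have hx := proxy_succ_ge n y.size_pos.le
  have e : ∀ r, y.pred r * (Real.exp (l * ((y.update r).mean - x) +
      l ^ 2 * proxy n (y.update r).size / 8) * c) =
      (y.pred r * Real.exp (l * ((y.update r).mean - y.mean))) *
        (Real.exp (l * (y.mean - x) + l ^ 2 * proxy n (y.size + 1) / 8) * c) := by
    intro r
    rw [y.size_update, mul_assoc, ← mul_assoc (Real.exp _) _ c, ← Real.exp_add]
    ring_nf
  simp_rw [e]
  rw [← Finset.sum_mul]
  refine (mul_le_mul_of_nonneg_right h (by positivity)).trans ?_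
  rw [← mul_assoc, ← Real.exp_add]
  refine mul_le_mul_of_nonneg_right (Real.exp_le_exp.2 ?_) hc
  have := mul_le_mul_of_nonneg_left hx (sq_nonneg l)
  linarith

lemma armLaw_succ_real {T : ℕ} (y : BetaParam) {S : Bool → Set (ℝ × (Fin T → Bool))}
    (hS : ∀ r, MeasurableSet (S r)) :
    (armLaw (T + 1) y).real {x | armTail x ∈ S (x.2 0)} =
      ∑ r, y.pred r * (armLaw T (y.update r)).real (S r) := by
  have h := integral_armLaw_succ y (F := fun r => (S r).indicator (fun _ => (1 : ℝ)))
    (fun r => measurable_const.indicator (hS r))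
    (fun r => ⟨1, fun x => by by_cases hx : x ∈ S r <;> simp [hx]⟩)
  have hm : MeasurableSet {x : ℝ × (Fin (T + 1) → Bool) | armTail x ∈ S (x.2 0)} := by
    have : MeasurableSet {p : Bool × (ℝ × (Fin T → Bool)) | p.2 ∈ S p.1} := by
      have e : {p : Bool × (ℝ × (Fin T → Bool)) | p.2 ∈ S p.1} =
          ⋃ r, {r} ×ˢ S r := by ext ⟨r, x⟩; simp
      rw [e]
      exact MeasurableSet.iUnion fun r => (measurableSet_singleton r).prod (hS r)
    exact (Measurable.prodMk (by fun_prop) measurable_armTail :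
      Measurable fun x : ℝ × (Fin (T + 1) → Bool) => (x.2 0, armTail x)) this
  have e : ∀ r, ∫ x, (S r).indicator (fun _ => (1 : ℝ)) x ∂(armLaw T (y.update r)) =
      (armLaw T (y.update r)).real (S r) := fun r => integral_indicator_one (hS r)
  simp_rw [e] at h
  rw [← h, ← integral_indicator_one hm]
  rfl

lemma measurableSet_of_snd {T : ℕ} (S : Set (Fin T → Bool)) :
    MeasurableSet {x : ℝ × (Fin T → Bool) | x.2 ∈ S} :=
  measurable_snd (MeasurableSet.of_discrete (s := S))

/-- Maximal inequality for the posterior means. -/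
lemma maximal_inequality {T : ℕ} (y : BetaParam) (n : ℕ) (hn : n ≤ T) (l x : ℝ) :
    (armLaw T y).real {z | ∃ k ≤ n, 0 ≤ l * (postMean y z.2 k - x)} ≤
      Real.exp (l * (y.mean - x) + l ^ 2 * proxy n y.size / 8) := by
  -- If the threshold is crossed at the start, the exponent is nonnegative and the bound is at least
  -- 1. Otherwise k = 0 cannot be the crossing time and one result can be read off.
  by_cases h0 : 0 ≤ l * (y.mean - x)
  · refine measureReal_le_one.trans (Real.one_le_exp ?_)
    have := mul_nonneg (sq_nonneg l) (proxy_nonneg n y.size_pos.le)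
    linarith
  induction n generalizing T y with
  | zero =>
    have : {z : ℝ × (Fin T → Bool) | ∃ k ≤ 0, 0 ≤ l * (postMean y z.2 k - x)} = ∅ := by
      ext z
      simpa [postMean_zero] using h0
    rw [this]
    simp only [measureReal_empty]
    positivity
  | succ n ih =>
    obtain ⟨T, rfl⟩ : ∃ T', T = T' + 1 := ⟨T - 1, by omega⟩
    have e : {z : ℝ × (Fin (T + 1) → Bool) | ∃ k ≤ n + 1, 0 ≤ l * (postMean y z.2 k - x)} =
        {z | armTail z ∈ (fun r => {z : ℝ × (Fin T → Bool) |
          ∃ k ≤ n, 0 ≤ l * (postMean (y.update r) z.2 k - x)}) (z.2 0)} := by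
      ext z
      simp only [Set.mem_ofPred_eq, armTail]
      constructor
      · rintro ⟨k, hk, h⟩
        cases k with
        | zero => rw [postMean_zero] at h; exact absurd h h0
        | succ k => rw [postMean_succ] at h; exact ⟨k, by omega, h⟩
      · rintro ⟨k, hk, h⟩
        exact ⟨k + 1, by omega, by rwa [postMean_succ]⟩
    rw [e, armLaw_succ_real y (S := fun r => {z : ℝ × (Fin T → Bool) |
      ∃ k ≤ n, 0 ≤ l * (postMean (y.update r) z.2 k - x)}) (fun r => measurableSet_of_snd
      {R | ∃ k ≤ n, 0 ≤ l * (postMean (y.update r) R k - x)})]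
    have hs := sum_pred_exp_mul_le y l x 1 n zero_le_one
    simp only [mul_one] at hs
    refine (Finset.sum_le_sum fun r _ => mul_le_mul_of_nonneg_left ?_ (y.pred_pos r).le).trans hs
    by_cases hr : 0 ≤ l * ((y.update r).mean - x)
    · refine measureReal_le_one.trans (Real.one_le_exp ?_)
      have := mul_nonneg (sq_nonneg l) (proxy_nonneg n (y.update r).size_pos.le)
      linarith
    · exact ih _ (by omega) hr

lemma exp_le_of_abs_le {x c : ℝ} (hx : |x| ≤ c) :
    Real.exp x ≤ 1 + x + x ^ 2 * (1 + Real.exp c) := by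
  by_cases h : |x| ≤ 1
  · have := (abs_le.1 (Real.abs_exp_sub_one_sub_id_le h)).2
    nlinarith [mul_nonneg (sq_nonneg x) (Real.exp_pos c).le]
  · have h1 : Real.exp x ≤ Real.exp c := Real.exp_le_exp.2 ((le_abs_self x).trans hx)
    have h2 : 1 ≤ x ^ 2 := by
      rw [← sq_abs]; nlinarith
    nlinarith [Real.exp_pos c, mul_nonneg (sub_nonneg.2 h2) (Real.exp_pos c).le]

lemma abs_mul_clamp_sub_le (y : BetaParam) (l θ : ℝ) : |l * (clamp θ - y.mean)| ≤ |l| := by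
  rw [abs_mul]
  refine mul_le_of_le_one_right (abs_nonneg _) ?_
  rw [abs_le]
  constructor <;> linarith [clamp_nonneg θ, clamp_le_one θ, y.mean_nonneg, y.mean_le_one]

lemma abs_exp_clamp_le (y : BetaParam) (l θ : ℝ) :
    |Real.exp (l * (clamp θ - y.mean))| ≤ Real.exp |l| := by
  rw [abs_of_pos (Real.exp_pos _)]
  exact Real.exp_le_exp.2 ((le_abs_self _).trans (abs_mul_clamp_sub_le y l θ))

/-- The linear term integrates to zero and the quadratic one is controlled by the variance. The
constant is crude, but the bound tends to 1 as the size grows, which is all that the limit in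
`integral_exp_clamp_le` needs. -/
lemma integral_exp_clamp_le_of_size (y : BetaParam) (l : ℝ) :
    ∫ θ, Real.exp (l * (clamp θ - y.mean)) ∂(betaMeasure y.α y.β) ≤
      1 + l ^ 2 * (1 + Real.exp |l|) / y.size := by
  have := isProbabilityMeasureBeta y.α_pos y.β_pos
  have i1 : Integrable (fun θ => 1 + l * (clamp θ - y.mean)) (betaMeasure y.α y.β) := by
    refine integrable_of_bounded (by fun_prop) ⟨1 + |l|, fun θ => ?_⟩
    refine (abs_add_le _ _).trans ?_
    rw [abs_one]
    linarith [abs_mul_clamp_sub_le y l θ]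
  have i2 : Integrable (fun θ => l ^ 2 * (1 + Real.exp |l|) * (clamp θ - y.mean) ^ 2)
      (betaMeasure y.α y.β) := by
    refine Integrable.const_mul (integrable_of_bounded (by fun_prop) ⟨1, fun θ => ?_⟩) _
    rw [abs_of_nonneg (sq_nonneg _), sq_le_one_iff_abs_le_one, abs_le]
    constructor <;> linarith [clamp_nonneg θ, clamp_le_one θ, y.mean_nonneg, y.mean_le_one]
  have i3 : Integrable (fun θ => l * (clamp θ - y.mean)) (betaMeasure y.α y.β) :=
    integrable_of_bounded (by fun_prop) ⟨_, abs_mul_clamp_sub_le y l⟩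
  calc _ ≤ ∫ θ, ((1 + l * (clamp θ - y.mean)) +
        l ^ 2 * (1 + Real.exp |l|) * (clamp θ - y.mean) ^ 2) ∂(betaMeasure y.α y.β) := by
        refine integral_mono (integrable_of_bounded (by fun_prop) ⟨_, abs_exp_clamp_le y l⟩)
          (i1.add i2) fun θ => ?_
        refine (exp_le_of_abs_le (abs_mul_clamp_sub_le y l θ)).trans (le_of_eq ?_)
        ring
    _ ≤ _ := by
        rw [integral_add i1 i2, integral_const_mul, integral_add (integrable_const _) i3,
          integral_const_mul, integral_sub (integrable_of_bounded measurable_clamp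
            ⟨1, abs_clamp_le⟩) (integrable_const _), integral_clamp]
        simp only [integral_const, probReal_univ, one_smul, sub_self, mul_zero, add_zero]
        have := mul_le_mul_of_nonneg_left (integral_clamp_sub_sq_le y)
          (by positivity : 0 ≤ l ^ 2 * (1 + Real.exp |l|))
        rw [mul_one_div] at this
        linarith

/-- A Beta variable is sub-Gaussian. -/
lemma integral_exp_clamp_le (y : BetaParam) (l : ℝ) :
    ∫ θ, Real.exp (l * (clamp θ - y.mean)) ∂(betaMeasure y.α y.β) ≤
      Real.exp (l ^ 2 / (8 * (y.size + 1 / 2))) := by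
  -- Average over n fictitious results: the motion of the posterior mean gives the proxy factor, the
  -- remaining Beta law of size `y.size + n` gives the second one. The claim is the limit n → ∞.
  have key : ∀ (n : ℕ) (y : BetaParam),
      ∫ θ, Real.exp (l * (clamp θ - y.mean)) ∂(betaMeasure y.α y.β) ≤
        Real.exp (l ^ 2 * proxy n y.size / 8) *
          (1 + l ^ 2 * (1 + Real.exp |l|) / (y.size + n)) := by
    intro n
    induction n with
    | zero =>
      intro y
      simpa [proxy] using integral_exp_clamp_le_of_size y l
    | succ n ih =>
      intro y
      rw [integral_betaMeasure_update y (f := fun θ => Real.exp (l * (clamp θ - y.mean)))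
        (by fun_prop) ⟨_, abs_exp_clamp_le y l⟩]
      have hpos : 0 < y.size + (n + 1) := by have := y.size_pos; positivity
      have hs := sum_pred_exp_mul_le y l y.mean
        (1 + l ^ 2 * (1 + Real.exp |l|) / (y.size + (n + 1))) n (by positivity)
      rw [sub_self, mul_zero, zero_add] at hs
      push_cast
      refine (Finset.sum_le_sum fun r _ => mul_le_mul_of_nonneg_left ?_ (y.pred_pos r).le).trans hs
      have e : ∀ θ, Real.exp (l * (clamp θ - y.mean)) =
          Real.exp (l * ((y.update r).mean - y.mean)) *
            Real.exp (l * (clamp θ - (y.update r).mean)) := fun θ => by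
        rw [← Real.exp_add]; ring_nf
      simp_rw [e]
      rw [integral_const_mul, Real.exp_add, mul_assoc]
      refine mul_le_mul_of_nonneg_left ((ih (y.update r)).trans (le_of_eq ?_)) (Real.exp_pos _).le
      rw [y.size_update]
      ring_nf
  refine ge_of_tendsto' (x := Filter.atTop) (f := fun n : ℕ =>
    Real.exp (l ^ 2 * proxy n y.size / 8) *
      (1 + l ^ 2 * (1 + Real.exp |l|) / (y.size + n))) ?_ fun n => key n y
  have ht : Filter.Tendsto (fun n : ℕ => y.size + (n : ℝ)) Filter.atTop Filter.atTop :=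
    Filter.tendsto_atTop_add_const_left _ _ tendsto_natCast_atTop_atTop
  have ht' : Filter.Tendsto (fun n : ℕ => y.size + (n : ℝ) + 1 / 2) Filter.atTop Filter.atTop :=
    Filter.tendsto_atTop_add_const_right _ _ ht
  have h1 : Filter.Tendsto (fun n : ℕ => proxy n y.size) Filter.atTop
      (nhds (1 / (y.size + 1 / 2) - 0)) :=
    tendsto_const_nhds.sub (ht'.const_div_atTop 1)
  have h2 := (Real.continuous_exp.tendsto _).comp ((h1.const_mul (l ^ 2)).div_const 8)
  have h3 := (ht.const_div_atTop (l ^ 2 * (1 + Real.exp |l|))).const_add 1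
  have h4 := h2.mul h3
  have e : Real.exp (l ^ 2 * (1 / (y.size + 1 / 2) - 0) / 8) * (1 + 0) =
      Real.exp (l ^ 2 / (8 * (y.size + 1 / 2))) := by
    rw [sub_zero, add_zero, mul_one]
    congr 1
    have := y.size_pos
    field_simp
  rw [← e]
  exact h4

lemma abs_exp_clamp_sub_postMean_le {T : ℕ} (y : BetaParam) (l : ℝ) (n : ℕ)
    (x : ℝ × (Fin T → Bool)) :
    |Real.exp (l * (clamp x.1 - postMean y x.2 n))| ≤ Real.exp |l| := by
  rw [abs_of_pos (Real.exp_pos _)]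
  refine Real.exp_le_exp.2 ((le_abs_self _).trans ?_)
  rw [abs_mul]
  refine mul_le_of_le_one_right (abs_nonneg _) ?_
  have := postMean_mem y x.2 n
  rw [abs_le]
  constructor <;> linarith [clamp_nonneg x.1, clamp_le_one x.1]

lemma measurable_clamp_sub_postMean {T : ℕ} (y : BetaParam) (n : ℕ) :
    Measurable fun x : ℝ × (Fin T → Bool) => clamp x.1 - postMean y x.2 n :=
  (measurable_clamp.comp measurable_fst).sub (measurable_postMean _ _)

/-- The deviation of the parameter from the posterior mean is sub-Gaussian. -/
lemma integral_exp_clamp_sub_postMean_le {T : ℕ} (y : BetaParam) (n : ℕ) (hn : n ≤ T) (l : ℝ) :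
    ∫ x, Real.exp (l * (clamp x.1 - postMean y x.2 n)) ∂(armLaw T y) ≤
      Real.exp (l ^ 2 / (8 * (y.size + n + 1 / 2))) := by
  induction n generalizing T y with
  | zero =>
    simp only [postMean_zero, Nat.cast_zero, add_zero]
    rw [integral_fst_armLaw T y (f := fun θ => Real.exp (l * (clamp θ - y.mean))) (by fun_prop)]
    exact integral_exp_clamp_le y l
  | succ n ih =>
    obtain ⟨T, rfl⟩ : ∃ T', T = T' + 1 := ⟨T - 1, by omega⟩
    have h := integral_armLaw_succ y (F := fun (r : Bool) (z : ℝ × (Fin T → Bool)) =>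
        Real.exp (l * (clamp z.1 - postMean (y.update r) z.2 n)))
      (fun r => ((measurable_clamp_sub_postMean _ n).const_mul l).exp)
      (fun r => ⟨_, abs_exp_clamp_sub_postMean_le _ l n⟩)
    have e : ∀ x : ℝ × (Fin (T + 1) → Bool),
        Real.exp (l * (clamp x.1 - postMean y x.2 (n + 1))) =
        (fun (r : Bool) (z : ℝ × (Fin T → Bool)) =>
          Real.exp (l * (clamp z.1 - postMean (y.update r) z.2 n))) (x.2 0) (armTail x) :=
      fun x => by simp only [armTail, postMean_succ]
    simp_rw [e]
    rw [h]
    have hr : ∀ r, y.pred r * ∫ x : ℝ × (Fin T → Bool),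
        Real.exp (l * (clamp x.1 - postMean (y.update r) x.2 n)) ∂(armLaw T (y.update r)) ≤
        y.pred r * Real.exp (l ^ 2 / (8 * (y.size + (n + 1 : ℕ) + 1 / 2))) := fun r => by
      refine mul_le_mul_of_nonneg_left ((ih (y.update r) (by omega)).trans (le_of_eq ?_))
        (y.pred_pos r).le
      rw [y.size_update]
      push_cast
      ring_nf
    refine (Finset.sum_le_sum fun r _ => hr r).trans (le_of_eq ?_)
    rw [← Finset.sum_mul, Fintype.sum_bool, y.pred_true_add_pred_false, one_mul]

/-- Chernoff bound for the deviation of the parameter from the posterior mean. -/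
lemma clamp_sub_postMean_tail {T : ℕ} (y : BetaParam) (n : ℕ) (hn : n ≤ T) {t : ℝ} (ht : 0 ≤ t) :
    (armLaw T y).real {x | t ≤ clamp x.1 - postMean y x.2 n} ≤
      Real.exp (-(2 * (y.size + n + 1 / 2) * t ^ 2)) := by
  have hs : 0 < y.size + n + 1 / 2 := by have := y.size_pos; positivity
  -- With S = size + n + 1/2, the exponent l²/(8S) − lt is minimal at l = 4St, with value −2St².
  have h := measure_ge_le_exp_mul_mgf (μ := armLaw T y)
    (X := fun x : ℝ × (Fin T → Bool) => clamp x.1 - postMean y x.2 n) t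
    (t := 4 * (y.size + n + 1 / 2) * t) (by positivity)
    (integrable_of_bounded (((measurable_clamp_sub_postMean _ n).const_mul _).exp)
      ⟨_, abs_exp_clamp_sub_postMean_le _ _ n⟩)
  refine h.trans ?_
  refine (mul_le_mul_of_nonneg_left (integral_exp_clamp_sub_postMean_le y n hn _)
    (Real.exp_pos _).le).trans ?_
  rw [← Real.exp_add]
  refine Real.exp_le_exp.2 (le_of_eq ?_)
  field_simp
  ring

/-- Two-sided tails of the posterior means; the side is chosen by the sign `σ`. -/
lemma postMean_tail {T : ℕ} (y : BetaParam) (n : ℕ) (hn : n ≤ T) {σ : ℝ} (hσ : σ ^ 2 = 1) {t : ℝ}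
    (ht : 0 < t) :
    (armLaw T y).real {x | ∃ k ≤ n, t ≤ σ * (postMean y x.2 k - y.mean)} ≤
      Real.exp (-(2 * t ^ 2 / proxy n y.size)) := by
  rcases Nat.eq_zero_or_pos n with rfl | hn0
  · have : {x : ℝ × (Fin T → Bool) | ∃ k ≤ 0, t ≤ σ * (postMean y x.2 k - y.mean)} = ∅ := by
      ext x
      simpa [postMean_zero] using ht
    rw [this, measureReal_empty]
    positivity
  have hv := proxy_pos hn0.ne' y.size_pos.le
  set v := proxy n y.size
  -- The slope 4t/v minimises −lt + l²v/8, with value −2t²/v; the sign σ is carried along and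
  -- disappears through σ² = 1.
  have h := maximal_inequality y n hn (σ * (4 * t / v)) (y.mean + σ * t)
  refine le_trans ?_ (h.trans (le_of_eq ?_))
  · refine measureReal_mono ?_
    rintro x ⟨k, hk, hx⟩
    refine ⟨k, hk, ?_⟩
    have e : σ * (4 * t / v) * (postMean y x.2 k - (y.mean + σ * t)) =
      4 * t / v * (σ * (postMean y x.2 k - y.mean) - σ ^ 2 * t) := by ring
    rw [e, hσ, one_mul]
    exact mul_nonneg (by positivity) (sub_nonneg.2 hx)
  · congr 1
    have e : σ * (4 * t / v) * (y.mean - (y.mean + σ * t)) + (σ * (4 * t / v)) ^ 2 * v / 8 =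
      σ ^ 2 * (-(4 * t / v * t) + (4 * t / v) ^ 2 * v / 8) := by ring
    change _ + (σ * (4 * t / v)) ^ 2 * v / 8 = _
    rw [e, hσ]
    field_simp
    ring

/-! ### Confidence radii. -/

/-- The radius of a confidence interval of level `1 / T` for the variance proxy `v / 4`. -/
noncomputable def radius (T : ℕ) (v : ℝ) : ℝ := √(v * Real.log T / 2)

lemma radius_nonneg (T : ℕ) (v : ℝ) : 0 ≤ radius T v := Real.sqrt_nonneg _

lemma radius_sq {T : ℕ} {v : ℝ} (hv : 0 ≤ v) :
    radius T v ^ 2 = v * Real.log T / 2 := by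
  have : 0 ≤ Real.log T := Real.log_natCast_nonneg T
  exact Real.sq_sqrt (by positivity)

lemma exp_neg_log_natCast {T : ℕ} (hT : 1 ≤ T) : Real.exp (-Real.log T) = 1 / T := by
  rw [Real.exp_neg, Real.exp_log (by exact_mod_cast hT), one_div]

lemma clamp_sub_postMean_radius {T N : ℕ} (hN : 1 ≤ N) (y : BetaParam) (n : ℕ) (hn : n ≤ T) :
    (armLaw T y).real {x | radius N (1 / (y.size + n + 1 / 2)) < clamp x.1 - postMean y x.2 n} ≤
      1 / N := by
  have hs : 0 < y.size + n + 1 / 2 := by have := y.size_pos; positivity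
  have hsub : {x : ℝ × (Fin T → Bool) |
      radius N (1 / (y.size + n + 1 / 2)) < clamp x.1 - postMean y x.2 n} ⊆
      {x | radius N (1 / (y.size + n + 1 / 2)) ≤ clamp x.1 - postMean y x.2 n} :=
    by intro x hx; simp only [Set.mem_ofPred_eq] at hx ⊢; exact hx.le
  refine (measureReal_mono hsub).trans
    ((clamp_sub_postMean_tail y n hn (radius_nonneg _ _)).trans (le_of_eq ?_))
  rw [radius_sq (by positivity), ← exp_neg_log_natCast hN]
  congr 1
  generalize y.size + (n : ℝ) + 1 / 2 = S at hs ⊢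
  field_simp

lemma postMean_radius {T N : ℕ} (hN : 1 ≤ N) (y : BetaParam) (n : ℕ) (hn : n ≤ T) {σ : ℝ}
    (hσ : σ ^ 2 = 1) :
    (armLaw T y).real {x | ∃ k ≤ n, radius N (proxy n y.size) < σ * (postMean y x.2 k - y.mean)} ≤
      1 / N := by
  rcases Nat.eq_zero_or_pos n with rfl | hn0
  · have : {x : ℝ × (Fin T → Bool) | ∃ k ≤ 0, radius N (proxy 0 y.size) <
        σ * (postMean y x.2 k - y.mean)} = ∅ := by
      ext x
      simpa [postMean_zero] using radius_nonneg _ _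
    rw [this, measureReal_empty]
    positivity
  have hv := proxy_pos hn0.ne' y.size_pos.le
  -- `postMean_tail` needs a positive deviation. A vanishing radius with a positive proxy forces log
  -- N = 0, and then the claimed bound is 1.
  rcases (radius_nonneg N (proxy n y.size)).eq_or_lt with h0 | h0
  · have h1 := radius_sq (T := N) hv.le
    rw [← h0] at h1
    have h2 : Real.log N = 0 := by
      have h3 : proxy n y.size * Real.log N = 0 := by linarith
      exact (mul_eq_zero.1 h3).resolve_left hv.ne'
    rw [← exp_neg_log_natCast hN, h2, neg_zero, Real.exp_zero]
    exact measureReal_le_one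
  · refine (measureReal_mono ?_).trans ((postMean_tail y n hn hσ h0).trans (le_of_eq ?_))
    · rintro x ⟨k, hk, hx⟩
      exact ⟨k, hk, hx.le⟩
    · rw [radius_sq hv.le, ← exp_neg_log_natCast hN]
      congr 1
      field_simp

/-! ### From tails to expectations. -/

/-- A variable with Gaussian upper tails has a small expectation. -/
lemma integral_le_of_tail {Ω : Type*} [MeasurableSpace Ω] {P : Measure Ω} [IsProbabilityMeasure P]
    {X : Ω → ℝ} (hX : Measurable X) (hb : ∃ C, ∀ ω, |X ω| ≤ C) {v : ℝ} (hv : 0 < v)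
    (ht : ∀ t, 0 < t → P.real {ω | t ≤ X ω} ≤ Real.exp (-(2 * t ^ 2 / v))) :
    ∫ ω, X ω ∂P ≤ √(Real.pi * v / 8) := by
  have hi := integrable_of_bounded (ν := P) hX hb
  have hpos : Integrable (fun ω => max (X ω) 0) P := hi.pos_part
  refine (integral_mono hi hpos fun ω => le_max_left _ _).trans ?_
  -- Layer-cake formula; the Gaussian integral of exp(−2t²/v) over t > 0 is √(πv/2)/2 = √(πv/8).
  rw [hpos.integral_eq_integral_meas_lt (Filter.Eventually.of_forall fun ω => le_max_right _ _)]
  have hg := integral_gaussian_Ioi (2 / v)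
  have hgi : IntegrableOn (fun t : ℝ => Real.exp (-(2 / v) * t ^ 2)) (Set.Ioi 0) :=
    (integrable_exp_neg_mul_sq (by positivity)).integrableOn
  have hle : ∫ t in Set.Ioi (0 : ℝ), P.real {a | t < max (X a) 0} ≤
      ∫ t in Set.Ioi (0 : ℝ), Real.exp (-(2 / v) * t ^ 2) := by
    refine integral_mono_of_nonneg (Filter.Eventually.of_forall fun t => measureReal_nonneg) hgi ?_
    refine (ae_restrict_iff' measurableSet_Ioi).2 (Filter.Eventually.of_forall fun t h0 => ?_)
    have h0' : (0 : ℝ) < t := h0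
    refine (measureReal_mono (fun ω hω => ?_)).trans ((ht t h0').trans (le_of_eq ?_))
    · have : t < max (X ω) 0 := hω
      rcases lt_max_iff.1 this with h | h
      · exact h.le
      · exact absurd h (not_lt.2 h0'.le)
    · congr 1; ring
  refine hle.trans (le_of_eq ?_)
  rw [hg]
  rw [show Real.pi * v / 8 = Real.pi / (2 / v) / 2 ^ 2 by field_simp; norm_num,
    Real.sqrt_div (by positivity) (2 ^ 2), Real.sqrt_sq (by norm_num)]

/-- The expectation on an event of a variable that rarely exceeds a radius. -/
lemma setIntegral_le_of_radius {Ω : Type*} [MeasurableSpace Ω] {P : Measure Ω}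
    [IsProbabilityMeasure P] {X : Ω → ℝ} (hX : Measurable X) (hb : ∀ ω, |X ω| ≤ 1) (A : Set Ω)
    {ε : ℝ} (hε : 0 ≤ ε) :
    ∫ ω in A, X ω ∂P ≤ P.real A * ε + P.real {ω | ε < X ω} := by
  have hB : MeasurableSet {ω | ε < X ω} := measurableSet_lt measurable_const hX
  calc ∫ ω in A, X ω ∂P ≤ ∫ ω in A, (ε + {ω | ε < X ω}.indicator (fun _ => (1 : ℝ)) ω) ∂P := by
        refine integral_mono (integrable_of_bounded hX ⟨1, hb⟩)
          ((integrable_const _).add ((integrable_const _).indicator hB)) fun ω => ?_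
        by_cases h : ε < X ω
        · simp only [Set.indicator, Set.mem_ofPred_eq, if_pos h]
          linarith [(abs_le.1 (hb ω)).2]
        · simp only [Set.indicator, Set.mem_ofPred_eq, if_neg h]
          linarith
    _ = P.real A * ε + (P.restrict A).real {ω | ε < X ω} := by
        rw [integral_add (integrable_const _) ((integrable_const _).indicator hB),
          integral_indicator hB]
        simp
    _ ≤ _ := by
        gcongr
        exact ENNReal.toReal_mono (measure_ne_top _ _) (Measure.restrict_le_self _)

/-! ### Resampling an arm, and the three conditional expectations. -/

/-- Resampling one coordinate preserves a product of probability measures. -/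
lemma map_update_pi {ι : Type*} [Fintype ι] [DecidableEq ι] {α : ι → Type*}
    [∀ i, MeasurableSpace (α i)] (ν : ∀ i, Measure (α i)) [∀ i, IsProbabilityMeasure (ν i)]
    (a : ι) :
    ((Measure.pi ν).prod (ν a)).map (fun p => Function.update p.1 a p.2) = Measure.pi ν := by
  have hm : Measurable fun p : (∀ i, α i) × α a => Function.update p.1 a p.2 := by fun_prop
  symm
  refine Measure.pi_eq fun s hs => ?_
  rw [Measure.map_apply hm (MeasurableSet.univ_pi hs)]
  have e : (fun p : (∀ i, α i) × α a => Function.update p.1 a p.2) ⁻¹' Set.univ.pi s =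
      (Set.univ.pi (Function.update s a Set.univ)) ×ˢ s a := by
    ext ⟨x, z⟩
    simp only [Set.mem_preimage, Set.mem_pi, Set.mem_univ, true_implies, Set.mem_prod]
    constructor
    · intro h
      refine ⟨fun i => ?_, by simpa using h a⟩
      by_cases hi : i = a
      · subst hi; simp
      · simpa [hi] using h i
    · rintro ⟨h1, h2⟩ i
      by_cases hi : i = a
      · subst hi; simpa using h2
      · simpa [hi] using h1 i
  rw [e, Measure.prod_prod, Measure.pi_pi, ← Finset.mul_prod_erase _ _ (Finset.mem_univ a),
    ← Finset.mul_prod_erase _ (fun i => ν i (s i)) (Finset.mem_univ a), Function.update_self,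
    measure_univ, one_mul, mul_comm]
  congr 1
  refine Finset.prod_congr rfl fun c hc => ?_
  rw [Function.update_of_ne (Finset.ne_of_mem_erase hc)]

/-- Resampling arm a leaves the law unchanged, so by Fubini that arm may be integrated first with
all others frozen. Orthogonality relations for the whole bandit thus reduce to a single arm. -/
lemma integral_outcomeLaw_eq_zero {K T : ℕ} (y : Belief K) (a : Fin K) {F : Outcome K T → ℝ}
    (hF : Measurable F) (hb : ∃ C, ∀ ω, |F ω| ≤ C)
    (h : ∀ ω, ∫ x, F (Function.update ω a x) ∂(armLaw T (y a)) = 0) :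
    ∫ ω, F ω ∂(outcomeLaw T y) = 0 := by
  have hm : Measurable fun p : Outcome K T × (ℝ × (Fin T → Bool)) => Function.update p.1 a p.2 :=
    by fun_prop
  have e := map_update_pi (fun c => armLaw T (y c)) a
  change ((outcomeLaw T y).prod (armLaw T (y a))).map _ = outcomeLaw T y at e
  rw [← e, integral_map hm.aemeasurable hF.aestronglyMeasurable, integral_prod]
  · simp [h]
  · exact integrable_of_bounded (hF.comp hm) (hb.imp fun C hC p => hC _)

lemma outcomeLaw_arm_real {K T : ℕ} (y : Belief K) (a : Fin K) {s : Set (ℝ × (Fin T → Bool))}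
    (hs : MeasurableSet s) :
    (outcomeLaw T y).real {ω | ω a ∈ s} = (armLaw T (y a)).real s := by
  have h := measurePreserving_eval (fun c => armLaw T (y c)) a
  rw [← h.map_eq, map_measureReal_apply h.measurable hs]
  rfl

lemma ae_clamp_eq {K T : ℕ} (y : Belief K) (a : Fin K) :
    ∀ᵐ ω ∂(outcomeLaw T y), clamp (ω a).1 = (ω a).1 := by
  have h := measurePreserving_eval (fun c => armLaw T (y c)) a
  have h1 : ∀ᵐ θ ∂((armLaw T (y a)).map Prod.fst), clamp θ = θ := by
    rw [map_fst_armLaw]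
    filter_upwards [ae_betaMeasure_mem (y a).α (y a).β] with θ hθ
    exact clamp_of_mem hθ.1.le hθ.2.le
  have h2 := ae_of_ae_map measurable_fst.aemeasurable h1
  rw [← h.map_eq] at h2
  exact ae_of_ae_map h.measurable.aemeasurable h2

lemma integral_val_pullsLaw {T : ℕ} (θ : ℝ) (n : Fin T) :
    ∫ R, val (R n) ∂(pullsLaw T θ) = clamp θ := by
  have h := measurePreserving_eval (fun _ : Fin T =>
    bernoulliMeasure true false (Set.projIcc (0 : ℝ) 1 zero_le_one θ)) n
  have e := integral_map (μ := pullsLaw T θ) h.measurable.aemeasurable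
    (f := val) Measurable.of_discrete.aestronglyMeasurable
  refine e.symm.trans ?_
  rw [show (pullsLaw T θ).map (Function.eval n) = _ from h.map_eq, integral_bernoulliMeasure]
  simp [val, clamp]

lemma abs_val_sub_le (r : Bool) {x : ℝ} (h0 : 0 ≤ x) (h1 : x ≤ 1) : |val r - x| ≤ 1 := by
  cases r <;> simp only [val, abs_le] <;> constructor <;> norm_num <;> linarith

lemma integral_armLaw_mul_val_sub_clamp {T : ℕ} (y : BetaParam) (n : Fin T) {h : ℝ → ℝ}
    (hh : Measurable h) (hb : ∀ θ, |h θ| ≤ 1) :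
    ∫ x, h x.1 * (val (x.2 n) - clamp x.1) ∂(armLaw T y) = 0 := by
  have := isProbabilityMeasureBeta y.α_pos y.β_pos
  have hv : Measurable fun x : ℝ × (Fin T → Bool) => val (x.2 n) :=
    (Measurable.of_discrete (f := fun R : Fin T → Bool => val (R n))).comp measurable_snd
  have hi : Integrable (fun x : ℝ × (Fin T → Bool) => h x.1 * (val (x.2 n) - clamp x.1))
      (armLaw T y) := by
    refine integrable_of_bounded ((hh.comp measurable_fst).mul
      (hv.sub (measurable_clamp.comp measurable_fst))) ⟨1, fun x => ?_⟩
    rw [abs_mul]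
    exact mul_le_one₀ (hb _) (abs_nonneg _) (abs_val_sub_le _ (clamp_nonneg _) (clamp_le_one _))
  rw [armLaw] at hi ⊢
  rw [Measure.integral_compProd hi]
  refine integral_eq_zero_of_ae (Filter.Eventually.of_forall fun θ => ?_)
  have : IsProbabilityMeasure (pullsLaw T θ) := (isMarkovKernel_pullsKernel T).isProbabilityMeasure θ
  change ∫ R, h θ * (val (R n) - clamp θ) ∂(pullsLaw T θ) = 0
  rw [integral_const_mul, integral_sub (integrable_of_bounded Measurable.of_discrete
      ⟨1, fun R => by simpa using abs_val_sub_le (R n) le_rfl zero_le_one⟩) (integrable_const _),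
    integral_val_pullsLaw]
  simp

/-- A criterion for conditional expectations of bounded functions. -/
lemma condExp_comap_ae_eq {Ω β : Type*} [m0 : MeasurableSpace Ω] [mβ : MeasurableSpace β]
    {P : Measure Ω} [IsProbabilityMeasure P] {φ : Ω → β} (hφ : Measurable φ) {f g : Ω → ℝ}
    (hf : Measurable f) (hfb : ∃ C, ∀ ω, |f ω| ≤ C) (hg : Measurable[mβ.comap φ] g)
    (hgb : ∃ C, ∀ ω, |g ω| ≤ C)
    (h : ∀ s, MeasurableSet s → ∫ ω, s.indicator (fun _ => (1 : ℝ)) (φ ω) * (f ω - g ω) ∂P = 0) :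
    P[f | mβ.comap φ] =ᵐ[P] g := by
  have hm : mβ.comap φ ≤ m0 := hφ.comap_le
  have hfi := integrable_of_bounded (ν := P) hf hfb
  have hgi := integrable_of_bounded (ν := P) (hg.mono hm le_rfl) hgb
  symm
  refine ae_eq_condExp_of_forall_setIntegral_eq hm hfi (fun _ _ _ => hgi.integrableOn) ?_
    hg.stronglyMeasurable.aestronglyMeasurable
  rintro _ ⟨s, hs, rfl⟩ _
  have h1 := h s hs
  have h2 : ∫ ω in φ ⁻¹' s, (f ω - g ω) ∂P = 0 := by
    rw [← integral_indicator (hφ hs), ← h1]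
    congr 1
    ext ω
    by_cases hω : φ ω ∈ s <;> simp [hω]
  rw [integral_sub hfi.integrableOn hgi.integrableOn] at h2
  linarith

lemma abs_indicator_one_le {β : Type*} (s : Set β) (b : β) :
    |s.indicator (fun _ => (1 : ℝ)) b| ≤ 1 := by
  by_cases h : b ∈ s <;> simp [h]

lemma reward_eq_val {K T : ℕ} (a : Actions K T) (t : Fin T) (ω : Outcome K T) :
    reward a t ω = val ((ω (a t)).2 (pullIndex a t)) := rfl

lemma measurable_val_result {K T : ℕ} (c : Fin K) (n : Fin T) :
    Measurable fun ω : Outcome K T => val ((ω c).2 n) :=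
  measurable_of_factorsThrough measurable_results (val_factorsThrough c n)

lemma measurable_reward {K T : ℕ} (a : Actions K T) (t : Fin T) : Measurable (reward a t) :=
  measurable_val_result _ _

lemma abs_val_le (r : Bool) : |val r| ≤ 1 := by cases r <;> simp [val]

lemma measurable_clamp_arm {K T : ℕ} (c : Fin K) :
    Measurable fun ω : Outcome K T => clamp (ω c).1 := by fun_prop

lemma condExp_reward_paramInfo {K T : ℕ} (y : Belief K) (a : Actions K T) (t : Fin T) :
    (outcomeLaw T y)[reward a t | paramInfo K T] =ᵐ[outcomeLaw T y]
      fun ω => clamp (ω (a t)).1 := by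
  have hφ : Measurable fun (ω : Outcome K T) (c : Fin K) => (ω c).1 := by fun_prop
  refine condExp_comap_ae_eq hφ (measurable_reward a t) ⟨1, fun ω => abs_val_le _⟩ ?_
    ⟨1, fun ω => abs_clamp_le _⟩ fun s hs => ?_
  · have hc : Measurable fun θ : Fin K → ℝ => clamp (θ (a t)) := by fun_prop
    exact hc.comp (comap_measurable _)
  · refine integral_outcomeLaw_eq_zero y (a t) ?_ ⟨1, fun ω => ?_⟩ fun ω => ?_
    · exact ((measurable_const.indicator hs).comp hφ).mul
        ((measurable_reward a t).sub (measurable_clamp_arm _))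
    · rw [abs_mul]
      exact mul_le_one₀ (abs_indicator_one_le _ _) (abs_nonneg _)
        (abs_val_sub_le _ (clamp_nonneg _) (clamp_le_one _))
    · have hu : ∀ x : ℝ × (Fin T → Bool), (fun c => (Function.update ω (a t) x c).1) =
          Function.update (fun c => (ω c).1) (a t) x.1 := fun x => by
        ext c
        by_cases hc : c = a t
        · subst hc; simp
        · simp [hc]
      simp only [reward_eq_val, Function.update_self, hu]
      exact integral_armLaw_mul_val_sub_clamp (y (a t)) (pullIndex a t)
        (h := fun θ => s.indicator (fun _ => (1 : ℝ))
          (Function.update (fun c => (ω c).1) (a t) θ))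
        ((measurable_const.indicator hs).comp (by fun_prop)) (fun θ => abs_indicator_one_le _ _)

lemma postMean_factorsThrough {K T : ℕ} (y : BetaParam) (c : Fin K) (n : ℕ) :
    Function.FactorsThrough (fun ω : Outcome K T => postMean y (ω c).2 n) results := by
  intro ω ω' h
  exact congrArg (fun R => postMean y R n) (congrFun h c)

lemma measurable_postMean_arm {K T : ℕ} (y : BetaParam) (c : Fin K) (n : ℕ) :
    Measurable fun ω : Outcome K T => postMean y (ω c).2 n :=
  measurable_of_factorsThrough measurable_results (postMean_factorsThrough y c n)

lemma abs_postMean_le {T : ℕ} (y : BetaParam) (R : Fin T → Bool) (n : ℕ) :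
    |postMean y R n| ≤ 1 := by
  have := postMean_mem y R n
  rw [abs_le]; constructor <;> linarith

lemma abs_clamp_sub_postMean_le {T : ℕ} (y : BetaParam) (θ : ℝ) (R : Fin T → Bool) (n : ℕ) :
    |clamp θ - postMean y R n| ≤ 1 := by
  have := postMean_mem y R n
  have := clamp_nonneg θ
  have := clamp_le_one θ
  rw [abs_le]; constructor <;> linarith

/-- The posterior mean of an arm is the conditional expectation of its parameter, also given
the results of the other arms. -/
lemma integral_mul_clamp_sub_postMean_arm {K T : ℕ} (y : Belief K) (c : Fin K) (n : ℕ) (hn : n ≤ T)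
    (h : (Fin K → Fin T → Bool) → ℝ) (hb : ∀ R, |h R| ≤ 1)
    (hh : ∀ R R' : Fin K → Fin T → Bool, (∀ d, d ≠ c → R d = R' d) →
      (∀ i : Fin T, (i : ℕ) < n → R c i = R' c i) → h R = h R') :
    ∫ ω, h (results ω) * (clamp (ω c).1 - postMean (y c) (ω c).2 n) ∂(outcomeLaw T y) = 0 := by
  refine integral_outcomeLaw_eq_zero y c ?_ ⟨1, fun ω => ?_⟩ fun ω => ?_
  · exact ((Measurable.of_discrete (f := h)).comp measurable_results).mul
      ((measurable_clamp_arm c).sub (measurable_postMean_arm _ _ _))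
  · rw [abs_mul]
    exact mul_le_one₀ (hb _) (abs_nonneg _) (abs_clamp_sub_postMean_le _ _ _ _)
  · have hu : ∀ x : ℝ × (Fin T → Bool), results (Function.update ω c x) =
        Function.update (results ω) c x.2 := fun x => by
      ext d i
      by_cases hd : d = c
      · subst hd; simp [results]
      · simp [results, hd]
    simp only [Function.update_self, hu]
    exact integral_mul_clamp_sub_postMean (y c) n hn
      (fun R => h (Function.update (results ω) c R)) fun R R' hR =>
        hh _ _ (fun d hd => by simp [hd]) (fun i hi => by simpa using hR i hi)

lemma condExp_param_armInfo {K T : ℕ} (y : Belief K) (c : Fin K) :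
    (outcomeLaw T y)[fun ω => (ω c).1 | armInfo T c] =ᵐ[outcomeLaw T y]
      fun ω => postMean (y c) (ω c).2 (T - 1) := by
  have hφ : Measurable fun (ω : Outcome K T) (n : Fin (T - 1)) =>
    (ω c).2 (Fin.castLE (Nat.sub_le T 1) n) := by fun_prop
  have h1 : (outcomeLaw T y)[fun ω => (ω c).1 | armInfo T c] =ᵐ[outcomeLaw T y]
      (outcomeLaw T y)[fun ω => clamp (ω c).1 | armInfo T c] :=
    condExp_congr_ae ((ae_clamp_eq y c).mono fun ω h => h.symm)
  refine h1.trans (condExp_comap_ae_eq hφ (measurable_clamp_arm c) ⟨1, fun ω => abs_clamp_le _⟩ ?_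
    ⟨1, fun ω => abs_postMean_le _ _ _⟩ fun s hs => ?_)
  -- The posterior mean after T − 1 results ignores the last entry, so padding with `false` exhibits
  -- it as a function of the conditioning map.
  · have hc : Measurable fun R : Fin (T - 1) → Bool => postMean (y c)
        (fun i : Fin T => if h : (i : ℕ) < T - 1 then R ⟨i, h⟩ else false) (T - 1) :=
      Measurable.of_discrete
    have e : (fun ω : Outcome K T => postMean (y c) (ω c).2 (T - 1)) =
        (fun R : Fin (T - 1) → Bool => postMean (y c)
          (fun i : Fin T => if h : (i : ℕ) < T - 1 then R ⟨i, h⟩ else false) (T - 1)) ∘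
        fun ω n => (ω c).2 (Fin.castLE (Nat.sub_le T 1) n) := by
      ext ω
      refine postMean_congr _ fun i hi => ?_
      rw [dif_pos hi]
      rfl
    rw [e]
    exact hc.comp (comap_measurable _)
  · refine integral_mul_clamp_sub_postMean_arm y c (T - 1) (Nat.sub_le T 1)
      (fun R => s.indicator (fun _ => (1 : ℝ)) fun n => R c (Fin.castLE (Nat.sub_le T 1) n))
      (fun R => abs_indicator_one_le _ _) fun R R' _ hR => ?_
    congr 1
    ext n
    rw [hR (Fin.castLE (Nat.sub_le T 1) n) n.2]

/-- Arm b has its first result moved from the data into the prior, which compensates the index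
shift; any other arm loses only a last result that lies beyond its pull index. -/
lemma postMean_cons_succ {K T : ℕ} (y : Belief K) (b : Fin K) (a : Actions K T) (t : Fin T)
    (ω : Outcome K (T + 1)) :
    postMean (y (a t)) (ω (a t)).2 (pullIndex (Fin.cons b a : Actions K (T + 1)) t.succ) =
      postMean (updateBelief y b ((ω b).2 0) (a t)) (shift b ω (a t)).2 (pullIndex a t) := by
  rw [pullIndex_cons_succ]
  by_cases h : a t = b
  · rw [if_pos h.symm, h, Nat.add_comm 1 _, postMean_succ]
    simp [updateBelief, shift, armTail]
  · rw [if_neg (Ne.symm h), zero_add]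
    simp only [updateBelief, Function.update_of_ne h, shift, if_neg h, armInit]
    exact (postMean_init _ _ (pullIndex a t).2.le).symm

/-- The reward minus the posterior mean is orthogonal to the past observations. -/
lemma integral_past_mul_reward_sub {K T : ℕ} (y : Belief K) (a : Actions K T) (t : Fin T)
    (h : (Fin T → Bool) → ℝ)
    (hh : ∀ r r' : Fin T → Bool, (∀ s, s < t → r s = r' s) → h r = h r') :
    ∫ ω, h (fun s => observation a s ω) *
      (reward a t ω - postMean (y (a t)) (ω (a t)).2 (pullIndex a t)) ∂(outcomeLaw T y) = 0 := by
  induction T generalizing y with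
  | zero => exact t.elim0
  | succ T ih =>
    obtain ⟨b, a, rfl⟩ : ∃ b a', a = Fin.cons b a' := ⟨a 0, Fin.tail a, (Fin.cons_self_tail a).symm⟩
    have hmeas : ∀ (F : Outcome K T → ℝ), Function.FactorsThrough F results →
      Measurable F ∧ ∃ C, ∀ ω, |F ω| ≤ C := fun F hF =>
      ⟨measurable_of_factorsThrough measurable_results hF, bounded_of_factorsThrough hF⟩
    refine Fin.cases (fun hh => ?_) (fun t hh => ?_) t hh
    · have e : ∀ ω : Outcome K (T + 1),
          h (fun s => observation (Fin.cons b a : Actions K (T + 1)) s ω) *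
          (reward (Fin.cons b a : Actions K (T + 1)) 0 ω -
            postMean (y ((Fin.cons b a : Actions K (T + 1)) 0))
              (ω ((Fin.cons b a : Actions K (T + 1)) 0)).2
              (pullIndex (Fin.cons b a : Actions K (T + 1)) 0)) =
          (fun (r : Bool) (_ : Outcome K T) =>
            h (fun _ => true) * (val r - (y b).mean)) ((ω b).2 0) (shift b ω) := fun ω => by
        simp only [reward, observation_cons_zero, pullIndex_cons_zero, Fin.cons_zero]
        -- Nothing precedes time zero, so h is a constant, here evaluated at an arbitrary point.
        rw [hh _ (fun _ => true) (fun s hs => absurd hs (Fin.not_lt_zero s))]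
        rw [Fin.val_zero, postMean_zero]
        rfl
      simp_rw [e]
      rw [integral_outcomeLaw_succ y b
        (F := fun (r : Bool) (_ : Outcome K T) => h (fun _ => true) * (val r - (y b).mean))
        (fun r => measurable_const) (fun r => ⟨_, fun ω => le_rfl⟩)]
      simp only [integral_const, probReal_univ, one_smul, Fintype.sum_bool, BetaParam.pred_true,
        BetaParam.pred_false, val]
      norm_num
      ring
    · have e : ∀ ω : Outcome K (T + 1),
          h (fun s => observation (Fin.cons b a : Actions K (T + 1)) s ω) *
          (reward (Fin.cons b a : Actions K (T + 1)) t.succ ω -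
            postMean (y ((Fin.cons b a : Actions K (T + 1)) t.succ))
              (ω ((Fin.cons b a : Actions K (T + 1)) t.succ)).2
              (pullIndex (Fin.cons b a : Actions K (T + 1)) t.succ)) =
          (fun (r : Bool) (ω' : Outcome K T) =>
            h (Fin.cons r fun s => observation a s ω') * (reward a t ω' -
              postMean (updateBelief y b r (a t)) (ω' (a t)).2 (pullIndex a t)))
            ((ω b).2 0) (shift b ω) := fun ω => by
        simp only [reward_cons_succ, Fin.cons_succ, postMean_cons_succ]
        congr 2
        ext s
        refine Fin.cases ?_ (fun s => ?_) s
        · rw [observation_cons_zero, Fin.cons_zero]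
        · rw [observation_cons_succ, Fin.cons_succ]
      have hF : ∀ r, Function.FactorsThrough (fun (ω' : Outcome K T) =>
            h (Fin.cons r fun s => observation a s ω') * (reward a t ω' -
              postMean (updateBelief y b r (a t)) (ω' (a t)).2 (pullIndex a t))) results := by
        intro r ω ω' hω
        have hp := postMean_factorsThrough (updateBelief y b r (a t)) (a t) (pullIndex a t) hω
        simp only [reward, observation_congr a _ hω] at hp ⊢
        rw [hp]
      simp_rw [e]
      rw [integral_outcomeLaw_succ y b
        (F := fun (r : Bool) (ω' : Outcome K T) =>
            h (Fin.cons r fun s => observation a s ω') * (reward a t ω' -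
              postMean (updateBelief y b r (a t)) (ω' (a t)).2 (pullIndex a t)))
        (fun r => (hmeas _ (hF r)).1) (fun r => (hmeas _ (hF r)).2)]
      refine Finset.sum_eq_zero fun r _ => ?_
      rw [ih (updateBelief y b r) a t (fun z => h (Fin.cons r z)) fun z z' hz => ?_, mul_zero]
      refine hh _ _ fun s => ?_
      refine Fin.cases (fun _ => by simp) (fun s hs => ?_) s
      simpa using hz s (Fin.succ_lt_succ_iff.1 hs)

/-- The results entering this posterior mean are exactly the earlier pulls of the same arm, all of
them already observed. This gives measurability with respect to `pastInfo`. -/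
lemma postMean_eq_of_past {K T : ℕ} (y : Belief K) (a : Actions K T) (t : Fin T)
    {ω ω' : Outcome K T} (h : ∀ s, s < t → observation a s ω = observation a s ω') :
    postMean (y (a t)) (ω (a t)).2 (pullIndex a t) =
      postMean (y (a t)) (ω' (a t)).2 (pullIndex a t) := by
  induction T generalizing y with
  | zero => exact t.elim0
  | succ T ih =>
    obtain ⟨b, a, rfl⟩ : ∃ b a', a = Fin.cons b a' := ⟨a 0, Fin.tail a, (Fin.cons_self_tail a).symm⟩
    refine Fin.cases (fun _ => ?_) (fun t h => ?_) t h
    · rw [pullIndex_cons_zero, Fin.val_zero, postMean_zero, postMean_zero]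
    · have h0 := h 0 (Fin.succ_pos t)
      rw [observation_cons_zero, observation_cons_zero] at h0
      simp only [Fin.cons_succ, postMean_cons_succ]
      rw [h0]
      refine ih _ a t fun s hs => ?_
      have := h s.succ (Fin.succ_lt_succ_iff.2 hs)
      rwa [observation_cons_succ, observation_cons_succ] at this

lemma condExp_reward_pastInfo {K T : ℕ} (y : Belief K) (a : Actions K T) (t : Fin T) :
    (outcomeLaw T y)[reward a t | pastInfo a t] =ᵐ[outcomeLaw T y]
      fun ω => postMean (y (a t)) (ω (a t)).2 (pullIndex a t) := by
  have hφ : Measurable fun (ω : Outcome K T) (s : {s : Fin T // s < t}) => reward a s ω :=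
    measurable_pi_lambda _ fun s => measurable_reward a s
  refine condExp_comap_ae_eq hφ (measurable_reward a t) ⟨1, fun ω => abs_val_le _⟩ ?_
    ⟨1, fun ω => abs_postMean_le _ _ _⟩ fun s hs => ?_
  -- `pastInfo` is generated by real-valued rewards; testing for the value 1 recovers the bits,
  -- whose space is discrete as factorisation requires.
  · have hψ : Measurable fun (x : {s : Fin T // s < t} → ℝ) (s : {s : Fin T // s < t}) =>
        decide (x s = 1) := by
      refine measurable_pi_lambda _ fun s => measurable_to_bool ?_
      have : (fun x : {s : Fin T // s < t} → ℝ => decide (x s = 1)) ⁻¹' {true} =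
        {x | x s = 1} := by ext x; simp
      rw [this]
      exact measurableSet_eq_fun (measurable_pi_apply s) measurable_const
    refine @measurable_of_factorsThrough _ _ (pastInfo a t) _ _ _
      (hψ.comp (comap_measurable _)) _ fun ω ω' h => postMean_eq_of_past y a t fun s hs => ?_
    have := congrFun h ⟨s, hs⟩
    simp only [Function.comp, reward] at this
    cases h1 : observation a s ω <;> cases h2 : observation a s ω' <;> simp_all
  · refine integral_past_mul_reward_sub y a t (fun r => s.indicator (fun _ => (1 : ℝ))
      fun u : {s : Fin T // s < t} => val (r u)) fun r r' h => ?_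
    congr 1
    ext u
    rw [h u u.2]

/-! ### Inner problems and their solvers. -/

/-- The inner objective of a penalty is almost surely given by `f`. -/
def IsObjective {K : ℕ} (z : Penalty K) (T : ℕ) (y : Belief K)
    (f : Outcome K T → Actions K T → ℝ) : Prop :=
  ∀ᵐ ω ∂(outcomeLaw T y), ∀ a, innerObjective z T y ω a = f ω a

lemma isObjective_of_condExp {K T : ℕ} {z : Penalty K} {y : Belief K}
    {f : Fin T → Actions K T → Outcome K T → ℝ}
    (h : ∀ t a, (fun ω => reward a t ω - z T y t a ω) =ᵐ[outcomeLaw T y] f t a) :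
    IsObjective z T y fun ω a => ∑ t, f t a ω := by
  have h' : ∀ᵐ ω ∂(outcomeLaw T y), ∀ t a, reward a t ω - z T y t a ω = f t a ω :=
    ae_all_iff.2 fun t => ae_all_iff.2 fun a => h t a
  filter_upwards [h'] with ω hω a
  exact Finset.sum_congr rfl fun t _ => hω t a

lemma upperBound_eq_iSup {K T : ℕ} {z : Penalty K} {y : Belief K}
    {f : Outcome K T → Actions K T → ℝ} (h : IsObjective z T y f) :
    upperBound z T y = ∫ ω, ⨆ a, f ω a ∂(outcomeLaw T y) := by
  refine integral_congr_ae ?_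
  filter_upwards [h] with ω hω
  simp only [hω]

lemma IsInnerSolver.ae_le {K T : ℕ} {z : Penalty K} {σ : Solver K} (hσ : IsInnerSolver z σ)
    {y : Belief K} {f : Outcome K T → Actions K T → ℝ} (h : IsObjective z T y f) :
    ∀ᵐ ω ∂(outcomeLaw T y), ∀ a, f ω a ≤ f ω (σ T y ω) := by
  filter_upwards [h, (hσ T y).2] with ω hω h2 a
  rw [← hω, ← hω]
  exact h2 a

lemma IsInnerSolver.upperBound_eq {K T : ℕ} {z : Penalty K} {σ : Solver K}
    (hσ : IsInnerSolver z σ) {y : Belief K} {f : Outcome K T → Actions K T → ℝ}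
    (h : IsObjective z T y f) :
    upperBound z T y = ∫ ω, f ω (σ T y ω) ∂(outcomeLaw T y) := by
  rw [upperBound_eq_iSup h]
  refine integral_congr_ae ?_
  filter_upwards [hσ.ae_le h] with ω hω
  have : Nonempty (Actions K T) := ⟨σ T y ω⟩
  exact le_antisymm (ciSup_le hω) (le_ciSup (Set.finite_range _).bddAbove _)

lemma isProbabilityMeasure_irsPolicy {K : ℕ} {z : Penalty K} {σ : Solver K}
    (hσ : IsInnerSolver z σ) (τ : ℕ) (hτ : 0 < τ) (y : Belief K) :
    IsProbabilityMeasure (irsPolicy σ τ y) := by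
  rw [irsPolicy, dif_pos hτ]
  exact Measure.isProbabilityMeasure_map
    ((Measurable.of_discrete (f := fun a : Actions K τ => a ⟨0, hτ⟩)).comp
      (hσ τ y).1).aemeasurable

/-- The arm that the policy pulls first. -/
def firstArm {K : ℕ} (σ : Solver K) (τ : ℕ) (y : Belief K) (ω : Outcome K (τ + 1)) : Fin K :=
  σ (τ + 1) y ω 0

lemma IsInnerSolver.measurable_firstArm {K : ℕ} {z : Penalty K} {σ : Solver K}
    (hσ : IsInnerSolver z σ) (τ : ℕ) (y : Belief K) : Measurable (firstArm σ τ y) :=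
  (Measurable.of_discrete (f := fun a : Actions K (τ + 1) => a 0)).comp (hσ (τ + 1) y).1

lemma irsPolicy_real {K : ℕ} {z : Penalty K} {σ : Solver K}
    (hσ : IsInnerSolver z σ) (τ : ℕ) (y : Belief K) (b : Fin K) :
    (irsPolicy σ (τ + 1) y).real {b} =
      (outcomeLaw (τ + 1) y).real {ω | firstArm σ τ y ω = b} := by
  rw [irsPolicy, dif_pos (Nat.succ_pos τ)]
  exact map_measureReal_apply (hσ.measurable_firstArm τ y) (measurableSet_singleton b)

lemma integral_selected {Ω : Type*} [MeasurableSpace Ω] {P : Measure Ω} {K : ℕ} {b : Ω → Fin K}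
    (hb : Measurable b) {X : Fin K → Ω → ℝ} (hX : ∀ c, Integrable (X c) P) :
    ∫ ω, X (b ω) ω ∂P = ∑ c, ∫ ω in {ω | b ω = c}, X c ω ∂P := by
  have hm : ∀ c, MeasurableSet {ω | b ω = c} := fun c => hb (measurableSet_singleton c)
  simp_rw [← integral_indicator (hm _)]
  rw [← integral_finsetSum _ fun c _ => (hX c).indicator (hm c)]
  congr 1
  ext ω
  rw [Finset.sum_eq_single (b ω)]
  · exact (Set.indicator_of_mem (s := {ω' | b ω' = b ω}) rfl _).symm
  · exact fun c _ hc => Set.indicator_of_notMem (s := {ω' | b ω' = c}) (Ne.symm hc) _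
  · simp

/-- The index b depends on the same randomness as the variables, so every X c is compared with its
own radius on the event b = c. Each arm costs one exceptional event, whence the term K δ. -/
lemma integral_selected_le {Ω : Type*} [MeasurableSpace Ω] {P : Measure Ω}
    [IsProbabilityMeasure P] {K : ℕ} {b : Ω → Fin K} (hb : Measurable b) {X : Fin K → Ω → ℝ}
    (hX : ∀ c, Measurable (X c)) (h1 : ∀ c ω, |X c ω| ≤ 1) {ε : Fin K → ℝ} (hε : ∀ c, 0 ≤ ε c)
    {δ : ℝ} (hδ : ∀ c, P.real {ω | ε c < X c ω} ≤ δ) :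
    ∫ ω, X (b ω) ω ∂P ≤ K * δ + ∑ c, P.real {ω | b ω = c} * ε c := by
  rw [integral_selected hb fun c => integrable_of_bounded (hX c) ⟨1, h1 c⟩]
  calc _ ≤ ∑ c, (P.real {ω | b ω = c} * ε c + δ) := Finset.sum_le_sum fun c _ =>
        (setIntegral_le_of_radius (hX c) (h1 c) _ (hε c)).trans (by gcongr; exact hδ c)
    _ = _ := by rw [Finset.sum_add_distrib]; simp [add_comm]

lemma integral_mean_firstArm {K : ℕ} {z : Penalty K} {σ : Solver K}
    (hσ : IsInnerSolver z σ) (τ : ℕ) (y : Belief K) :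
    ∫ ω, (y (firstArm σ τ y ω)).mean ∂(outcomeLaw (τ + 1) y) =
      ∑ b, (irsPolicy σ (τ + 1) y).real {b} * (y b).mean := by
  rw [integral_selected (hσ.measurable_firstArm τ y) (X := fun c _ => (y c).mean)
    fun c => integrable_const _]
  simp [irsPolicy_real hσ]

/-! ### Pull counts. -/

/-- The number of pulls of arm `c` in an action sequence. -/
def pullCount {K T : ℕ} (a : Actions K T) (c : Fin K) : ℕ := ∑ t, if a t = c then 1 else 0

lemma pullCount_le {K T : ℕ} (a : Actions K T) (c : Fin K) : pullCount a c ≤ T := by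
  unfold pullCount
  calc _ ≤ ∑ _t : Fin T, 1 := Finset.sum_le_sum fun t _ => by split_ifs <;> simp
    _ = T := by simp

lemma pullCount_cons {K T : ℕ} (b : Fin K) (a : Actions K T) (c : Fin K) :
    pullCount (Fin.cons b a : Actions K (T + 1)) c = (if b = c then 1 else 0) + pullCount a c := by
  rw [pullCount, Fin.sum_univ_succ, pullCount]
  simp only [Fin.cons_zero, Fin.cons_succ]

/-- In any order, the pulls of arm c read the indices 0, …, n − 1, where n is its pull count. Such a
sum therefore depends on the counts alone. -/
lemma sum_pullIndex_eq {K T : ℕ} (F : Fin K → ℕ → ℝ) (a : Actions K T) :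
    ∑ t, F (a t) (pullIndex a t) = ∑ c, ∑ i ∈ Finset.range (pullCount a c), F c i := by
  induction T generalizing F with
  | zero => simp [pullCount]
  | succ T ih =>
    obtain ⟨b, a, rfl⟩ : ∃ b a', a = Fin.cons b a' := ⟨a 0, Fin.tail a, (Fin.cons_self_tail a).symm⟩
    have h := ih (fun c i => F c ((if b = c then 1 else 0) + i)) a
    rw [Fin.sum_univ_succ, pullIndex_cons_zero]
    simp only [Fin.cons_succ, pullIndex_cons_succ, Fin.cons_zero, Fin.val_zero]
    rw [h, ← Finset.add_sum_erase _ _ (Finset.mem_univ b),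
      ← Finset.add_sum_erase (a := b) _ _ (Finset.mem_univ b), ← add_assoc]
    congr 1
    · rw [pullCount_cons, if_pos rfl, add_comm 1, Finset.sum_range_succ', add_comm]
      congr 1
      exact Finset.sum_congr rfl fun i _ => by rw [add_comm]
    · refine Finset.sum_congr rfl fun c hcb => ?_
      have hne := (Finset.ne_of_mem_erase hcb).symm
      rw [pullCount_cons, if_neg hne]
      simp only [zero_add]

/-- By order invariance, a pull put in front may be counted as the last pull of its arm. -/
lemma sum_pullIndex_cons {K T : ℕ} (F : Fin K → ℕ → ℝ) (b : Fin K) (a : Actions K T) :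
    ∑ t, F ((Fin.cons b a : Actions K (T + 1)) t) (pullIndex (Fin.cons b a : Actions K (T + 1)) t) =
      ∑ t, F (a t) (pullIndex a t) + F b (pullCount a b) := by
  rw [sum_pullIndex_eq, sum_pullIndex_eq, ← Finset.add_sum_erase _ _ (Finset.mem_univ b),
    ← Finset.add_sum_erase (a := b) _ (fun c => ∑ i ∈ Finset.range (pullCount a c), F c i)
      (Finset.mem_univ b), pullCount_cons, if_pos rfl, add_comm 1, Finset.sum_range_succ]
  have : ∀ c ∈ Finset.univ.erase b, ∑ i ∈ Finset.range (pullCount (Fin.cons b a :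
      Actions K (T + 1)) c), F c i = ∑ i ∈ Finset.range (pullCount a c), F c i := fun c hcb => by
    rw [pullCount_cons, if_neg (Finset.ne_of_mem_erase hcb).symm, zero_add]
  rw [Finset.sum_congr rfl this]
  ring

/-! ### IRS.V-Zero. -/

/-- The inner objective of IRS.V-Zero. -/
noncomputable def vzeroObjective {K T : ℕ} (y : Belief K) (ω : Outcome K T) (a : Actions K T) : ℝ :=
  ∑ t, postMean (y (a t)) (ω (a t)).2 (pullIndex a t)

lemma isObjective_vzero {K : ℕ} (T : ℕ) (y : Belief K) :
    IsObjective (penaltyVZero K) T y (vzeroObjective y) := by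
  refine isObjective_of_condExp fun t a => ?_
  filter_upwards [condExp_reward_pastInfo y a t] with ω hω
  simp only [penaltyVZero, sub_sub_cancel]
  exact hω

lemma vzeroObjective_factorsThrough {K T : ℕ} (y : Belief K) {ω ω' : Outcome K T}
    (h : results ω = results ω') : vzeroObjective y ω = vzeroObjective y ω' := by
  ext a
  exact Finset.sum_congr rfl fun t _ => postMean_factorsThrough _ _ _ h

lemma vzeroObjective_cons {K T : ℕ} (y : Belief K) (ω : Outcome K (T + 1)) (b : Fin K)
    (a : Actions K T) :
    vzeroObjective y ω (Fin.cons b a) =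
      (y b).mean + vzeroObjective (updateBelief y b ((ω b).2 0)) (shift b ω) a := by
  rw [vzeroObjective, Fin.sum_univ_succ]
  simp only [Fin.cons_zero, pullIndex_cons_zero, Fin.cons_succ, postMean_cons_succ, Fin.val_zero,
    postMean_zero, vzeroObjective]

/-- Pulling arm `b` first instead of the first arm of the best sequence. -/
lemma vzeroObjective_sub {K T : ℕ} (y : Belief K) (ω : Outcome K (T + 1)) (b : Fin K)
    (a : Actions K (T + 1)) :
    vzeroObjective y ω a - vzeroObjective y ω (Fin.cons b (Fin.tail a)) =
      postMean (y (a 0)) (ω (a 0)).2 (pullCount (Fin.tail a) (a 0)) -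
        postMean (y b) (ω b).2 (pullCount (Fin.tail a) b) := by
  have h := fun c => sum_pullIndex_cons (fun c n => postMean (y c) (ω c).2 n) c (Fin.tail a)
  have h1 := h (a 0)
  have h2 := h b
  rw [Fin.cons_self_tail] at h1
  unfold vzeroObjective
  rw [h1, h2]
  ring

lemma measurable_of_results_solver {K T : ℕ} {z : Penalty K} {σ : Solver K}
    (hσ : IsInnerSolver z σ) (y : Belief K) {f : Outcome K T → ℝ}
    (h : ∀ ω ω', results ω = results ω' → σ T y ω = σ T y ω' → f ω = f ω') : Measurable f :=
  measurable_of_factorsThrough (measurable_results.prodMk (hσ T y).1)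
    fun ω ω' hω => h ω ω' (Prod.ext_iff.1 hω).1 (Prod.ext_iff.1 hω).2

lemma abs_vzeroObjective_le {K T : ℕ} (y : Belief K) (ω : Outcome K T) (a : Actions K T) :
    |vzeroObjective y ω a| ≤ T := by
  refine (Finset.abs_sum_le_sum_abs _ _).trans ?_
  calc _ ≤ ∑ _t : Fin T, (1 : ℝ) := Finset.sum_le_sum fun t _ => abs_postMean_le _ _ _
    _ = T := by simp

lemma abs_postMean_sub_mean_le {T : ℕ} (y : BetaParam) (R : Fin T → Bool) (n : ℕ) :
    |postMean y R n - y.mean| ≤ 1 := by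
  have := postMean_mem y R n
  have := y.mean_nonneg
  have := y.mean_le_one
  rw [abs_le]; constructor <;> linarith

/-- The count m may depend on the outcome, in particular on future results of the arm; the maximal
inequality absorbs this by covering all counts up to n at once. -/
lemma outcomeLaw_tail_le {K T N : ℕ} (hN : 1 ≤ N) (y : Belief K) (n : ℕ) (hn : n ≤ T) (c : Fin K)
    {m : Outcome K T → ℕ} (hm : ∀ ω, m ω ≤ n) :
    (outcomeLaw T y).real {ω | radius N (proxy n (y c).size) <
      postMean (y c) (ω c).2 (m ω) - (y c).mean} ≤ 1 / N := by
  have e := outcomeLaw_arm_real (T := T) y c (measurableSet_of_snd {R | ∃ k ≤ n,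
    radius N (proxy n (y c).size) < 1 * (postMean (y c) R k - (y c).mean)})
  refine le_trans ?_ (e.le.trans (postMean_radius hN (y c) n hn (σ := 1) (one_pow 2)))
  refine measureReal_mono fun ω hω => ?_
  refine ⟨m ω, hm ω, ?_⟩
  rw [one_mul]
  exact hω

/-- For a fixed arm no union over arms is needed, and integrating the maximal tail avoids a
logarithm. This is the origin of √(π/8). -/
lemma integral_mean_sub_postMean_le {K T : ℕ} (y : Belief K) (n : ℕ) (hn : n ≤ T) (c : Fin K)
    {m : Outcome K T → ℕ} (hm : ∀ ω, m ω ≤ n)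
    (hX : Measurable fun ω : Outcome K T => postMean (y c) (ω c).2 (m ω)) :
    ∫ ω, ((y c).mean - postMean (y c) (ω c).2 (m ω)) ∂(outcomeLaw T y) ≤
      √(Real.pi * proxy n (y c).size / 8) := by
  rcases Nat.eq_zero_or_pos n with rfl | hn0
  · have : ∀ ω, m ω = 0 := fun ω => Nat.le_zero.1 (hm ω)
    simp only [this, postMean_zero, sub_self, integral_zero]
    positivity
  refine integral_le_of_tail (X := fun ω => (y c).mean - postMean (y c) (ω c).2 (m ω))
    (measurable_const.sub hX) ⟨1, fun ω => ?_⟩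
    (proxy_pos hn0.ne' (y c).size_pos.le) fun t ht => ?_
  · rw [abs_sub_comm]
    exact abs_postMean_sub_mean_le _ _ _
  · have e := outcomeLaw_arm_real (T := T) y c (measurableSet_of_snd {R | ∃ k ≤ n,
      t ≤ -1 * (postMean (y c) R k - (y c).mean)})
    refine le_trans ?_ (e.le.trans (postMean_tail (y c) n hn (σ := -1) (by norm_num) ht))
    refine measureReal_mono fun ω hω => ⟨m ω, hm ω, ?_⟩
    have : t ≤ (y c).mean - postMean (y c) (ω c).2 (m ω) := hω
    linarith

/-- The loss of IRS.V-Zero in a single step. -/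
lemma vzero_step {K N : ℕ} (hN : 1 ≤ N) {σ : Solver K} (hσ : IsInnerSolver (penaltyVZero K) σ)
    (τ : ℕ) (y : Belief K) :
    upperBound (penaltyVZero K) (τ + 1) y - ∑ b, (irsPolicy σ (τ + 1) y).real {b} *
      ((y b).mean + ∑ r, (y b).pred r * upperBound (penaltyVZero K) τ (updateBelief y b r)) ≤
      K * (1 / N) + ∑ b, (irsPolicy σ (τ + 1) y).real {b} *
        (radius N (proxy τ (y b).size) + √(Real.pi * proxy τ (y b).size / 8)) := by
  have := isProbabilityMeasure_irsPolicy hσ (τ + 1) (Nat.succ_pos τ) y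
  set p : Fin K → ℝ := fun b => (irsPolicy σ (τ + 1) y).real {b} with hp
  have hp1 : ∑ b, p b = 1 := sum_real_singleton _
  have hp0 : ∀ b, 0 ≤ p b := fun b => measureReal_nonneg
  set P := outcomeLaw (τ + 1) y with hP
  set X : Fin K → Outcome K (τ + 1) → ℝ := fun c ω =>
    postMean (y c) (ω c).2 (pullCount (Fin.tail (σ (τ + 1) y ω)) c) with hX
  have hXm : ∀ c, Measurable (X c) := fun c => measurable_of_results_solver hσ y
    fun ω ω' h1 h2 => by
      simp only [hX, h2]
      exact postMean_factorsThrough _ _ _ h1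
  have hXi : ∀ c, Integrable (X c) P := fun c =>
    integrable_of_bounded (hXm c) ⟨1, fun ω => abs_postMean_le _ _ _⟩
  have hXbm : Measurable fun ω => X (firstArm σ τ y ω) ω := measurable_of_results_solver hσ y
    fun ω ω' h1 h2 => by
      simp only [hX, firstArm, h2]
      exact postMean_factorsThrough _ _ _ h1
  have hXbi : Integrable (fun ω => X (firstArm σ τ y ω) ω) P :=
    integrable_of_bounded hXbm ⟨1, fun ω => abs_postMean_le _ _ _⟩
  have hmi : Integrable (fun ω => (y (firstArm σ τ y ω)).mean) P :=
    integrable_of_bounded ((Measurable.of_discrete (f := fun c => (y c).mean)).comp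
      (hσ.measurable_firstArm τ y)) ⟨1, fun ω => abs_le.2
        ⟨by linarith [(y (firstArm σ τ y ω)).mean_nonneg], (y _).mean_le_one⟩⟩
  have hW := hσ.upperBound_eq (isObjective_vzero (τ + 1) y)
  have hWi : Integrable (fun ω => vzeroObjective y ω (σ (τ + 1) y ω)) P :=
    integrable_of_bounded (measurable_of_results_solver hσ y fun ω ω' h1 h2 => by
      rw [h2, vzeroObjective_factorsThrough y h1]) ⟨_, fun ω => abs_vzeroObjective_le _ _ _⟩
  -- Keep the tail of the optimal sequence and put b in front: this competitor is worth at most the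
  -- mean of b plus the optimum of the shifted problem, and by order invariance it loses only a
  -- difference of final posterior means.
  have hb : ∀ b, ∫ ω, vzeroObjective y ω (σ (τ + 1) y ω) ∂P -
      ((y b).mean + ∑ r, (y b).pred r * upperBound (penaltyVZero K) τ (updateBelief y b r)) ≤
      ∫ ω, X (firstArm σ τ y ω) ω ∂P - ∫ ω, X b ω ∂P := by
    intro b
    have : Nonempty (Fin K) := ⟨b⟩
    have hsf : ∀ r, Function.FactorsThrough (fun ω : Outcome K τ =>
        ⨆ a, vzeroObjective (updateBelief y b r) ω a) results := fun r ω ω' h => by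
      simp only [vzeroObjective_factorsThrough _ h]
    have hFf : ∀ r, Function.FactorsThrough (fun ω : Outcome K τ =>
        (y b).mean + ⨆ a, vzeroObjective (updateBelief y b r) ω a) results := fun r ω ω' h => by
      simp only [vzeroObjective_factorsThrough _ h]
    have hF := integral_outcomeLaw_succ y b (F := fun r ω =>
      (y b).mean + ⨆ a : Actions K τ, vzeroObjective (updateBelief y b r) ω a)
      (fun r => measurable_of_factorsThrough measurable_results (hFf r))
      (fun r => bounded_of_factorsThrough (hFf r))
    have e : ∑ r, (y b).pred r * ∫ ω, ((y b).mean +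
        ⨆ a : Actions K τ, vzeroObjective (updateBelief y b r) ω a)
          ∂(outcomeLaw τ (updateBelief y b r)) =
        (y b).mean + ∑ r, (y b).pred r * upperBound (penaltyVZero K) τ (updateBelief y b r) := by
      have e1 : ∀ r, ∫ ω, ((y b).mean +
          ⨆ a : Actions K τ, vzeroObjective (updateBelief y b r) ω a)
          ∂(outcomeLaw τ (updateBelief y b r)) =
          (y b).mean + upperBound (penaltyVZero K) τ (updateBelief y b r) := fun r => by
        rw [upperBound_eq_iSup (isObjective_vzero τ _), integral_add (integrable_const _)
          (integrable_of_bounded (measurable_of_factorsThrough measurable_results (hsf r))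
            (bounded_of_factorsThrough (hsf r)))]
        simp
      have h1 := (y b).pred_true_add_pred_false
      simp only [e1, Fintype.sum_bool]
      linear_combination (y b).mean * h1
    rw [← e, ← hF, ← integral_sub hXbi (hXi b)]
    have hGf : Function.FactorsThrough (fun ω : Outcome K (τ + 1) => (y b).mean +
        ⨆ a : Actions K τ, vzeroObjective (updateBelief y b ((ω b).2 0)) (shift b ω) a)
        results := fun ω ω' h => by
      have h0 : (ω b).2 0 = (ω' b).2 0 := congrFun (congrFun h b) 0
      have hs : results (shift b ω) = results (shift b ω') := by
        ext c t
        have hc : (ω c).2 = (ω' c).2 := congrFun h c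
        simp only [results, shift]
        split_ifs <;> simp only [armTail, armInit, hc]
      simp only [h0, vzeroObjective_factorsThrough _ hs]
    have hGi : Integrable (fun ω : Outcome K (τ + 1) => (y b).mean +
        ⨆ a : Actions K τ, vzeroObjective (updateBelief y b ((ω b).2 0)) (shift b ω) a) P :=
      integrable_of_bounded (measurable_of_factorsThrough measurable_results hGf)
        (bounded_of_factorsThrough hGf)
    rw [← integral_sub hWi hGi]
    refine integral_mono (hWi.sub hGi) (hXbi.sub (hXi b)) fun ω => ?_
    have h1 := vzeroObjective_sub y ω b (σ (τ + 1) y ω)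
    have h2 := vzeroObjective_cons y ω b (Fin.tail (σ (τ + 1) y ω))
    have h3 : vzeroObjective (updateBelief y b ((ω b).2 0)) (shift b ω)
        (Fin.tail (σ (τ + 1) y ω)) ≤
        ⨆ a : Actions K τ, vzeroObjective (updateBelief y b ((ω b).2 0)) (shift b ω) a :=
      le_ciSup (f := fun a : Actions K τ =>
        vzeroObjective (updateBelief y b ((ω b).2 0)) (shift b ω) a)
        (Set.finite_range _).bddAbove _
    simp only [hX, firstArm]
    linarith
  -- Average over b with the weights of the policy. The loss becomes E[X − mean] at the first arm of
  -- the sampled optimum plus E[mean − X] at an arm independent of the outcome.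
  have hsum := Finset.sum_le_sum fun b (_ : b ∈ Finset.univ) =>
    mul_le_mul_of_nonneg_left (hb b) (hp0 b)
  simp only [mul_sub, Finset.sum_sub_distrib, ← Finset.sum_mul, hp1, one_mul] at hsum
  -- Here the arm is chosen by the outcome, hence radii and exceptional events; in `hlow` the arm is
  -- fixed and expectations suffice.
  have hup : ∫ ω, (X (firstArm σ τ y ω) ω - (y (firstArm σ τ y ω)).mean) ∂P ≤
      K * (1 / N) + ∑ b, p b * radius N (proxy τ (y b).size) := by
    have h := integral_selected_le (P := P) (hσ.measurable_firstArm τ y)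
      (X := fun c ω => X c ω - (y c).mean) (fun c => (hXm c).sub_const _)
      (fun c ω => abs_postMean_sub_mean_le _ _ _) (fun c => radius_nonneg N (proxy τ (y c).size))
      (fun c => outcomeLaw_tail_le hN y τ (Nat.le_succ τ) c
        (m := fun ω => pullCount (Fin.tail (σ (τ + 1) y ω)) c) fun ω => pullCount_le _ _)
    refine h.trans (le_of_eq ?_)
    simp only [hp, irsPolicy_real hσ, hP]
  have hlow : ∀ b, p b * (y b).mean - p b * ∫ ω, X b ω ∂P ≤
      p b * √(Real.pi * proxy τ (y b).size / 8) := by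
    intro b
    have h := integral_mean_sub_postMean_le y τ (Nat.le_succ τ) b
      (m := fun ω => pullCount (Fin.tail (σ (τ + 1) y ω)) b) (fun ω => pullCount_le _ _) (hXm b)
    rw [integral_sub (integrable_const _) (hXi b)] at h
    simp only [integral_const, probReal_univ, one_smul] at h
    rw [← mul_sub]
    exact mul_le_mul_of_nonneg_left h (hp0 b)
  have hlow' := Finset.sum_le_sum fun b (_ : b ∈ Finset.univ) => hlow b
  rw [Finset.sum_sub_distrib] at hlow'
  rw [integral_sub hXbi hmi, integral_mean_firstArm hσ τ y] at hup
  rw [hW]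
  simp only [mul_add, Finset.sum_add_distrib] at hsum ⊢
  change _ - ∑ b, p b * (y b).mean ≤ _ at hup
  linarith

/-! ### The potential τ · E[max θ]. -/

/-- The expected parameter of the best arm. -/
noncomputable def bestMean {K : ℕ} (τ : ℕ) (y : Belief K) : ℝ :=
  ∫ ω, ⨆ c, clamp (ω c).1 ∂(outcomeLaw τ y)

lemma clamp_le_iSup {K : ℕ} (θ : Fin K → ℝ) (c : Fin K) : clamp (θ c) ≤ ⨆ c, clamp (θ c) :=
  le_ciSup (f := fun c => clamp (θ c)) (Set.finite_range _).bddAbove c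

lemma measurable_iSup_clamp {K T : ℕ} :
    Measurable fun ω : Outcome K T => ⨆ c, clamp (ω c).1 :=
  Measurable.iSup fun c => measurable_clamp_arm c

lemma abs_iSup_clamp_le {K T : ℕ} (ω : Outcome K T) : |⨆ c, clamp (ω c).1| ≤ 1 :=
  abs_le.2 ⟨by linarith [Real.iSup_nonneg fun c : Fin K => clamp_nonneg (ω c).1],
    Real.iSup_le (fun c => clamp_le_one _) zero_le_one⟩

lemma integrable_iSup_clamp {K T : ℕ} (y : Belief K) :
    Integrable (fun ω : Outcome K T => ⨆ c, clamp (ω c).1) (outcomeLaw T y) :=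
  integrable_of_bounded measurable_iSup_clamp ⟨1, abs_iSup_clamp_le⟩

/-- Tower property: a pull reveals information and leaves the parameters alone, as `shift` does. -/
lemma bestMean_succ {K : ℕ} (τ : ℕ) (y : Belief K) (b : Fin K) :
    bestMean (τ + 1) y = ∑ r, (y b).pred r * bestMean τ (updateBelief y b r) := by
  have h := integral_outcomeLaw_succ y b (F := fun _ (ω : Outcome K τ) => ⨆ c, clamp (ω c).1)
    (fun _ => measurable_iSup_clamp) (fun _ => ⟨1, abs_iSup_clamp_le⟩)
  unfold bestMean
  rw [← h]
  congr 1
  ext ω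
  congr 1
  ext c
  unfold shift
  split_ifs <;> rfl

/-- Since updating preserves E[max θ] on average, τ of the τ + 1 copies cancel and only the regret
of the present pull remains. -/
lemma bestMean_step {K : ℕ} {z : Penalty K} {σ : Solver K} (hσ : IsInnerSolver z σ) (τ : ℕ)
    (y : Belief K) :
    ((τ + 1 : ℕ) : ℝ) * bestMean (τ + 1) y - ∑ b, (irsPolicy σ (τ + 1) y).real {b} *
      ((y b).mean + ∑ r, (y b).pred r * (τ * bestMean τ (updateBelief y b r))) =
      bestMean (τ + 1) y - ∫ ω, (y (firstArm σ τ y ω)).mean ∂(outcomeLaw (τ + 1) y) := by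
  have := isProbabilityMeasure_irsPolicy hσ (τ + 1) (Nat.succ_pos τ) y
  have hp1 : ∑ b, (irsPolicy σ (τ + 1) y).real {b} = 1 := sum_real_singleton _
  rw [integral_mean_firstArm hσ]
  have e : ∀ b, ∑ r, (y b).pred r * (τ * bestMean τ (updateBelief y b r)) =
      τ * bestMean (τ + 1) y := fun b => by
    rw [bestMean_succ τ y b, Finset.mul_sum]
    exact Finset.sum_congr rfl fun r _ => by ring
  simp only [e, mul_add, Finset.sum_add_distrib, ← Finset.sum_mul, hp1]
  push_cast
  ring

lemma integrable_clamp_arm {K T : ℕ} (y : Belief K) (c : Fin K) :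
    Integrable (fun ω : Outcome K T => clamp (ω c).1) (outcomeLaw T y) :=
  integrable_of_bounded (measurable_clamp_arm c) ⟨1, fun _ => abs_clamp_le _⟩

lemma integrable_postMean_arm {K T : ℕ} (y : Belief K) (c : Fin K) (n : ℕ) :
    Integrable (fun ω : Outcome K T => postMean (y c) (ω c).2 n) (outcomeLaw T y) :=
  integrable_of_bounded (measurable_postMean_arm (y c) c n) ⟨1, fun _ => abs_postMean_le _ _ _⟩

lemma integrable_comp_selected {Ω : Type*} [MeasurableSpace Ω] {P : Measure Ω} [IsFiniteMeasure P]
    {K : ℕ} {b : Ω → Fin K} (hb : Measurable b) {X : Fin K → Ω → ℝ} (hX : ∀ c, Measurable (X c))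
    (h1 : ∀ c ω, |X c ω| ≤ 1) : Integrable (fun ω => X (b ω) ω) P := by
  have hm : Measurable fun p : Fin K × Ω => X p.1 p.2 := measurable_from_prod_countable_right hX
  exact integrable_of_bounded (hm.comp (hb.prodMk measurable_id)) ⟨1, fun ω => h1 _ _⟩

/-! ### Thompson sampling -/

lemma isObjective_ts {K : ℕ} (T : ℕ) (y : Belief K) :
    IsObjective (penaltyTS K) T y fun ω a => ∑ t, clamp (ω (a t)).1 := by
  refine isObjective_of_condExp (f := fun t a ω => clamp (ω (a t)).1) fun t a => ?_
  filter_upwards [condExp_reward_paramInfo y a t] with ω hω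
  simp only [penaltyTS, sub_sub_cancel]
  exact hω

lemma upperBound_ts_le {K : ℕ} {σ : Solver K} (hσ : IsInnerSolver (penaltyTS K) σ) (T : ℕ)
    (y : Belief K) : upperBound (penaltyTS K) T y ≤ T * bestMean T y := by
  rw [hσ.upperBound_eq (isObjective_ts T y), integral_finsetSum]
  · calc _ ≤ ∑ _t : Fin T, bestMean T y := Finset.sum_le_sum fun t _ => ?_
      _ = _ := by simp
    refine integral_mono (integrable_comp_selected (b := fun ω => σ T y ω t)
      (X := fun c (ω : Outcome K T) => clamp (ω c).1)
      ((Measurable.of_discrete (f := fun a : Actions K T => a t)).comp (hσ T y).1)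
      (fun c => measurable_clamp_arm c) fun c ω => abs_clamp_le _) (integrable_iSup_clamp y)
      fun ω => clamp_le_iSup (fun c => (ω c).1) _
  · exact fun t _ => integrable_comp_selected (b := fun ω => σ T y ω t)
      (X := fun c (ω : Outcome K T) => clamp (ω c).1)
      ((Measurable.of_discrete (f := fun a : Actions K T => a t)).comp (hσ T y).1)
      (fun c => measurable_clamp_arm c) fun c ω => abs_clamp_le _

/-- If the objective adds up scores of the arms, then the first arm of a solution has the best
score. -/
lemma IsInnerSolver.score_le {K : ℕ} {z : Penalty K} {σ : Solver K} (hσ : IsInnerSolver z σ)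
    {τ : ℕ} {y : Belief K} {g : Outcome K (τ + 1) → Fin K → ℝ}
    (h : IsObjective z (τ + 1) y fun ω a => ∑ t, g ω (a t)) :
    ∀ᵐ ω ∂(outcomeLaw (τ + 1) y), ∀ c, g ω c ≤ g ω (firstArm σ τ y ω) := by
  filter_upwards [hσ.ae_le h] with ω hω c
  -- The competitor changes only the first action, so all other scores cancel.
  have := hω (Fin.cons c (Fin.tail (σ (τ + 1) y ω)))
  simp only [Fin.sum_univ_succ, Fin.cons_zero, Fin.cons_succ, Fin.tail] at this
  exact le_of_add_le_add_right this

/-- In the sample, the first arm attains max θ, so the loss is the expected excess of a selected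
parameter over its prior mean. -/
lemma ts_step {K N : ℕ} (hN : 1 ≤ N) {σ : Solver K} (hσ : IsInnerSolver (penaltyTS K) σ)
    (τ : ℕ) (y : Belief K) :
    ((τ + 1 : ℕ) : ℝ) * bestMean (τ + 1) y - ∑ b, (irsPolicy σ (τ + 1) y).real {b} *
      ((y b).mean + ∑ r, (y b).pred r * (τ * bestMean τ (updateBelief y b r))) ≤
      K * (1 / N) + ∑ b, (irsPolicy σ (τ + 1) y).real {b} *
        radius N (1 / ((y b).size + 1 / 2)) := by
  have hf := hσ.measurable_firstArm τ y
  have hms := integrable_comp_selected (P := outcomeLaw (τ + 1) y) hf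
    (X := fun c _ => (y c).mean) (fun c => measurable_const)
    (fun c _ => abs_le.2 ⟨by linarith [(y c).mean_nonneg], (y c).mean_le_one⟩)
  rw [bestMean_step hσ, bestMean, ← integral_sub (integrable_iSup_clamp y) hms]
  have h := integral_selected_le (P := outcomeLaw (τ + 1) y) hf
    (X := fun c ω => clamp (ω c).1 - (y c).mean) (fun c => (measurable_clamp_arm c).sub_const _)
    (fun c ω => by
      have := abs_clamp_sub_postMean_le (y c) (ω c).1 (ω c).2 0
      rwa [postMean_zero] at this)
    (fun c => radius_nonneg N (1 / ((y c).size + 1 / 2)))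
    (δ := 1 / N) (fun c => by
      have h1 := clamp_sub_postMean_radius (T := τ + 1) hN (y c) 0 (Nat.zero_le _)
      simp only [postMean_zero, Nat.cast_zero, add_zero] at h1
      have hm : Measurable fun x : ℝ × (Fin (τ + 1) → Bool) => clamp x.1 - (y c).mean := by fun_prop
      exact (outcomeLaw_arm_real y c (measurableSet_lt measurable_const hm)).le.trans h1)
  simp only [irsPolicy_real hσ]
  refine le_trans (integral_mono_ae ((integrable_iSup_clamp y).sub hms)
    (integrable_comp_selected hf (X := fun c ω => clamp (ω c).1 - (y c).mean)
      (fun c => (measurable_clamp_arm c).sub_const _) (fun c ω => by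
      have := abs_clamp_sub_postMean_le (y c) (ω c).1 (ω c).2 0
      rwa [postMean_zero] at this)) ?_) h
  filter_upwards [hσ.score_le (g := fun ω c => clamp (ω c).1) (isObjective_ts (τ + 1) y)] with ω hω
  have : Nonempty (Fin K) := ⟨firstArm σ τ y ω⟩
  exact sub_le_sub_right (ciSup_le hω) _

/-! ### IRS.FH -/

lemma isObjective_fh {K : ℕ} (T : ℕ) (y : Belief K) :
    IsObjective (penaltyFH K) T y fun ω a => ∑ t, postMean (y (a t)) (ω (a t)).2 (T - 1) := by
  refine isObjective_of_condExp (f := fun t a ω => postMean (y (a t)) (ω (a t)).2 (T - 1))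
    fun t a => ?_
  filter_upwards [condExp_param_armInfo (T := T) y (a t)] with ω hω
  simp only [penaltyFH, sub_sub_cancel]
  exact hω

lemma exists_argmax {K : ℕ} (hK : 1 ≤ K) : ∃ f : (Fin K → ℝ) → Fin K, ∀ (v : Fin K → ℝ) c, v c ≤ v (f v) := by
  have : Nonempty (Fin K) := ⟨⟨0, hK⟩⟩
  choose f hf using fun v : Fin K → ℝ => Finite.exists_max v
  exact ⟨f, hf⟩

/-- Jensen's inequality for the maximum, proved by selection: the arm with the largest posterior
mean has, on average, a parameter equal to that mean, and this parameter is at most max θ. -/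
lemma integral_iSup_postMean_le {K T : ℕ} (hK : 1 ≤ K) (y : Belief K) (n : ℕ) (hn : n ≤ T) :
    ∫ ω, ⨆ c, postMean (y c) (ω c).2 n ∂(outcomeLaw T y) ≤ bestMean T y := by
  have : Nonempty (Fin K) := ⟨⟨0, hK⟩⟩
  obtain ⟨f, hf⟩ := exists_argmax hK
  set b : Outcome K T → Fin K := fun ω => f fun c => postMean (y c) (ω c).2 n with hb
  have hbm : Measurable b :=
    (Measurable.of_discrete (f := fun R : Fin K → Fin T → Bool =>
      f fun c => postMean (y c) (R c) n)).comp measurable_results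
  have e1 : ∀ ω : Outcome K T, ⨆ c, postMean (y c) (ω c).2 n =
      postMean (y (b ω)) (ω (b ω)).2 n := fun ω =>
    le_antisymm (ciSup_le fun c => hf (fun c => postMean (y c) (ω c).2 n) c)
      (le_ciSup (f := fun c => postMean (y c) (ω c).2 n) (Set.finite_range _).bddAbove (b ω))
  have i1 := integrable_comp_selected (P := outcomeLaw T y) hbm
    (X := fun c (ω : Outcome K T) => postMean (y c) (ω c).2 n)
    (fun c => measurable_postMean_arm (y c) c n) (fun c ω => abs_postMean_le _ _ _)
  have i2 := integrable_comp_selected (P := outcomeLaw T y) hbm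
    (X := fun c (ω : Outcome K T) => clamp (ω c).1)
    (fun c => measurable_clamp_arm c) (fun c ω => abs_clamp_le _)
  have h0 : ∫ ω, (clamp (ω (b ω)).1 - postMean (y (b ω)) (ω (b ω)).2 n) ∂(outcomeLaw T y) = 0 := by
    rw [integral_selected hbm (X := fun c (ω : Outcome K T) =>
      clamp (ω c).1 - postMean (y c) (ω c).2 n)
      fun c => (integrable_clamp_arm y c).sub (integrable_postMean_arm y c n)]
    -- The event that c is selected involves only the first n results of c, besides those of the
    -- other arms, so it is orthogonal to the posterior error of c.
    refine Finset.sum_eq_zero fun c _ => ?_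
    have hc : MeasurableSet {ω | b ω = c} := hbm (measurableSet_singleton c)
    rw [← integral_indicator hc, ← integral_mul_clamp_sub_postMean_arm y c n hn
      (fun R => if (f fun c => postMean (y c) (R c) n) = c then 1 else 0)
      (fun R => by split_ifs <;> simp) fun R R' h1 h2 => ?_]
    · congr 1
      ext ω
      by_cases h : b ω = c
      · have h' : (f fun c => postMean (y c) (results ω c) n) = c := h
        rw [Set.indicator_of_mem (show ω ∈ {ω | b ω = c} from h), if_pos h', one_mul]
      · have h' : ¬ (f fun c => postMean (y c) (results ω c) n) = c := h
        rw [Set.indicator_of_notMem (show ω ∉ {ω | b ω = c} from h), if_neg h', zero_mul]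
    · have : (fun c => postMean (y c) (R c) n) = fun c => postMean (y c) (R' c) n := by
        ext d
        by_cases hd : d = c
        · subst hd; exact postMean_congr _ h2
        · rw [h1 d hd]
      simp only [this]
  rw [integral_sub i2 i1] at h0
  simp_rw [e1]
  have h2 : ∫ ω, clamp (ω (b ω)).1 ∂(outcomeLaw T y) ≤ bestMean T y :=
    integral_mono i2 (integrable_iSup_clamp y) fun ω => clamp_le_iSup (fun c => (ω c).1) _
  linarith

lemma measurable_iSup_postMean {K T : ℕ} (y : Belief K) (n : ℕ) :
    Measurable fun ω : Outcome K T => ⨆ c, postMean (y c) (ω c).2 n :=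
  Measurable.iSup fun c => measurable_postMean_arm (y c) c n

lemma abs_iSup_postMean_le {K T : ℕ} (y : Belief K) (n : ℕ) (ω : Outcome K T) :
    |⨆ c, postMean (y c) (ω c).2 n| ≤ 1 :=
  abs_le.2 ⟨by linarith [Real.iSup_nonneg fun c : Fin K => (postMean_mem (y c) (ω c).2 n).1],
    Real.iSup_le (fun c => (postMean_mem _ _ _).2) zero_le_one⟩

lemma upperBound_fh_le {K : ℕ} (hK : 1 ≤ K) {σ : Solver K} (hσ : IsInnerSolver (penaltyFH K) σ)
    (T : ℕ) (y : Belief K) : upperBound (penaltyFH K) T y ≤ T * bestMean T y := by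
  have hi : ∀ t : Fin T, Integrable (fun ω : Outcome K T =>
      postMean (y (σ T y ω t)) (ω (σ T y ω t)).2 (T - 1)) (outcomeLaw T y) := fun t =>
    integrable_comp_selected (b := fun ω => σ T y ω t)
      (X := fun c (ω : Outcome K T) => postMean (y c) (ω c).2 (T - 1))
      ((Measurable.of_discrete (f := fun a : Actions K T => a t)).comp (hσ T y).1)
      (fun c => measurable_postMean_arm (y c) c _) fun c ω => abs_postMean_le _ _ _
  rw [hσ.upperBound_eq (isObjective_fh T y), integral_finsetSum _ fun t _ => hi t]
  calc _ ≤ ∑ _t : Fin T, bestMean T y := Finset.sum_le_sum fun t _ => ?_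
    _ = _ := by simp
  refine (integral_mono (hi t) (integrable_of_bounded (measurable_iSup_postMean y (T - 1))
    ⟨1, abs_iSup_postMean_le y _⟩) fun ω => ?_).trans
    (integral_iSup_postMean_le hK y (T - 1) (Nat.sub_le T 1))
  exact le_ciSup (f := fun c => postMean (y c) (ω c).2 (T - 1)) (Set.finite_range _).bddAbove _

lemma radius_mono (N : ℕ) {v w : ℝ} (h : v ≤ w) : radius N v ≤ radius N w := by
  unfold radius
  have : 0 ≤ Real.log N := Real.log_natCast_nonneg N
  gcongr

/-- Dropping the prior size makes the radius the same for all arms and beliefs, so that it can be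
charged to time. -/
lemma outcomeLaw_clamp_sub_postMean_le {K T N : ℕ} (hN : 1 ≤ N) (y : Belief K) (n : ℕ)
    (hn : n ≤ T) (c : Fin K) :
    (outcomeLaw T y).real {ω | radius N (1 / (n + 1 / 2)) <
      clamp (ω c).1 - postMean (y c) (ω c).2 n} ≤ 1 / N := by
  have e := outcomeLaw_arm_real y c (T := T) (measurableSet_lt measurable_const
    (measurable_clamp_sub_postMean (T := T) (y c) n) :
      MeasurableSet {x | radius N (1 / ((y c).size + n + 1 / 2)) < clamp x.1 - postMean (y c) x.2 n})
  refine le_trans ?_ (e.le.trans (clamp_sub_postMean_radius hN (y c) n hn))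
  refine measureReal_mono fun ω hω => lt_of_le_of_lt (radius_mono N ?_) hω
  have := (y c).size_pos
  gcongr
  linarith

/-- The posterior mean of the sampled arm after τ results is inserted between max θ and its prior
mean. Every parameter is within a common radius of its own posterior mean, which the sampled arm
maximises; the other difference is a deviation of the sampled arm alone. -/
lemma fh_step {K N : ℕ} (hN : 1 ≤ N) {σ : Solver K} (hσ : IsInnerSolver (penaltyFH K) σ)
    (τ : ℕ) (y : Belief K) :
    ((τ + 1 : ℕ) : ℝ) * bestMean (τ + 1) y - ∑ b, (irsPolicy σ (τ + 1) y).real {b} *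
      ((y b).mean + ∑ r, (y b).pred r * (τ * bestMean τ (updateBelief y b r))) ≤
      (2 * (K * (1 / N)) + radius N (1 / (τ + 1 / 2))) +
        ∑ b, (irsPolicy σ (τ + 1) y).real {b} * radius N (proxy τ (y b).size) := by
  have hf := hσ.measurable_firstArm τ y
  set P := outcomeLaw (τ + 1) y
  have hms := integrable_comp_selected (P := P) hf
    (X := fun c _ => (y c).mean) (fun c => measurable_const)
    (fun c _ => abs_le.2 ⟨by linarith [(y c).mean_nonneg], (y c).mean_le_one⟩)
  have hps := integrable_comp_selected (P := P) hf
    (X := fun c ω => postMean (y c) (ω c).2 τ) (fun c => measurable_postMean_arm (y c) c τ)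
    (fun c ω => abs_postMean_le _ _ _)
  have h1 : ∫ ω, (postMean (y (firstArm σ τ y ω)) (ω (firstArm σ τ y ω)).2 τ -
      (y (firstArm σ τ y ω)).mean) ∂P ≤ K * (1 / N) +
        ∑ b, (irsPolicy σ (τ + 1) y).real {b} * radius N (proxy τ (y b).size) := by
    simp only [irsPolicy_real hσ]
    exact integral_selected_le hf (X := fun c ω => postMean (y c) (ω c).2 τ - (y c).mean)
      (fun c => (measurable_postMean_arm (y c) c τ).sub_const _)
      (fun c ω => abs_postMean_sub_mean_le _ _ _) (fun c => radius_nonneg N (proxy τ (y c).size))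
      (fun c => outcomeLaw_tail_le hN y τ (Nat.le_succ τ) c (m := fun _ => τ) fun _ => le_rfl)
  set ε := radius N (1 / ((τ : ℝ) + 1 / 2)) with hε
  have hε0 : 0 ≤ ε := radius_nonneg _ _
  set B : Fin K → Set (Outcome K (τ + 1)) := fun c =>
    {ω | ε < clamp (ω c).1 - postMean (y c) (ω c).2 τ} with hB
  have hBm : ∀ c, MeasurableSet (B c) := fun c => measurableSet_lt measurable_const
    ((measurable_clamp_arm c).sub (measurable_postMean_arm (y c) c τ))
  have hBi : ∀ c, Integrable ((B c).indicator fun _ => (1 : ℝ)) P := fun c =>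
    (integrable_const _).indicator (hBm c)
  have hsi : Integrable (fun ω => ∑ c, (B c).indicator (fun _ => (1 : ℝ)) ω) P :=
    integrable_finsetSum _ fun c _ => hBi c
  have h2 : ∫ ω, ((⨆ c, clamp (ω c).1) -
      postMean (y (firstArm σ τ y ω)) (ω (firstArm σ τ y ω)).2 τ) ∂P ≤ ε + K * (1 / N) := by
    calc _ ≤ ∫ ω, (ε + ∑ c, (B c).indicator (fun _ => (1 : ℝ)) ω) ∂P := by
          refine integral_mono_ae ((integrable_iSup_clamp y).sub hps)
            ((integrable_const _).add hsi) ?_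
          have ho := isObjective_fh (τ + 1) y
          filter_upwards [hσ.score_le (g := fun ω c => postMean (y c) (ω c).2 τ) ho] with ω hω
          have : Nonempty (Fin K) := ⟨firstArm σ τ y ω⟩
          rw [sub_le_iff_le_add]
          refine ciSup_le fun c => ?_
          have h3 : (B c).indicator (fun _ => (1 : ℝ)) ω ≤
              ∑ c, (B c).indicator (fun _ => (1 : ℝ)) ω :=
            Finset.single_le_sum (f := fun c => (B c).indicator (fun _ => (1 : ℝ)) ω)
              (fun c _ => Set.indicator_nonneg (fun _ _ => zero_le_one) _) (Finset.mem_univ c)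
          have h4 := hω c
          by_cases h5 : ω ∈ B c
          · rw [Set.indicator_of_mem h5] at h3
            have := (abs_le.1 (abs_clamp_sub_postMean_le (y c) (ω c).1 (ω c).2 τ)).2
            linarith
          · rw [Set.indicator_of_notMem h5] at h3
            have h6 : ¬ ε < clamp (ω c).1 - postMean (y c) (ω c).2 τ := h5
            linarith
      _ = ε + ∑ c, P.real (B c) := by
          rw [integral_add (integrable_const _) hsi, integral_finsetSum _ fun c _ => hBi c]
          congr 1
          · simp
          · exact Finset.sum_congr rfl fun c _ => integral_indicator_one (hBm c)
      _ ≤ _ := by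
          gcongr
          calc _ ≤ ∑ _c : Fin K, (1 / N : ℝ) := Finset.sum_le_sum fun c _ =>
                outcomeLaw_clamp_sub_postMean_le hN y τ (Nat.le_succ τ) c
            _ = _ := by simp
  rw [bestMean_step hσ, bestMean]
  rw [integral_sub hps hms] at h1
  rw [integral_sub (integrable_iSup_clamp y) hps] at h2
  linarith

/-! ### Numerical inequalities. -/

lemma sqrt_inv_le_sub {m : ℝ} (hm : 0 ≤ m) :
    √(1 / (m + 1 / 2)) ≤ 2 * √(m + 1) - 2 * √m := by
  have hu := Real.sqrt_nonneg m
  have hv : 0 < √(m + 1) := Real.sqrt_pos.2 (by linarith)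
  have hw : 0 < √(m + 1 / 2) := Real.sqrt_pos.2 (by linarith)
  have hu2 := Real.sq_sqrt hm
  have hv2 := Real.sq_sqrt (by linarith : 0 ≤ m + 1)
  have hw2 := Real.sq_sqrt (by linarith : 0 ≤ m + 1 / 2)
  rw [one_div, Real.sqrt_inv, ← one_div, div_le_iff₀ hw]
  set u := √m
  set v := √(m + 1)
  set w := √(m + 1 / 2)
  -- Concavity of the square root at the midpoint; combine with (v − u)(v + u) = 1.
  have h1 : u + v ≤ 2 * w := by
    refine le_of_pow_le_pow_left₀ two_ne_zero (by positivity) ?_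
    nlinarith [sq_nonneg (u - v)]
  have h2 : (v - u) * (u + v) = 1 := by linear_combination hv2 - hu2
  have h3 : 0 ≤ v - u := by
    by_contra h
    nlinarith
  nlinarith

lemma radius_inv_le (T : ℕ) {m s : ℝ} (hm : 0 ≤ m) (hs : m ≤ s) :
    radius T (1 / (s + 1 / 2)) ≤ √(Real.log T / 2) * (2 * √(m + 1)) -
      √(Real.log T / 2) * (2 * √m) := by
  have hL : 0 ≤ Real.log T := Real.log_natCast_nonneg T
  have h1 : radius T (1 / (s + 1 / 2)) ≤ radius T (1 / (m + 1 / 2)) :=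
    radius_mono T (by gcongr)
  refine h1.trans ?_
  rw [radius, mul_div_assoc, mul_comm, Real.sqrt_mul (by positivity), ← mul_sub]
  exact mul_le_mul_of_nonneg_left (sqrt_inv_le_sub hm) (Real.sqrt_nonneg _)

lemma sum_sqrt_le {K T : ℕ} {n : Fin K → ℕ} (hn : ∑ b, n b = T) :
    ∑ b, √(n b : ℝ) ≤ √((K : ℝ) * T) := by
  refine Real.le_sqrt_of_sq_le ?_
  have h := sq_sum_le_card_mul_sum_sq (s := Finset.univ) (f := fun b => √(n b : ℝ))
  refine h.trans (le_of_eq ?_)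
  simp only [Real.sq_sqrt (Nat.cast_nonneg _), Finset.card_univ, Fintype.card_fin]
  rw [← Nat.cast_sum, hn]

lemma proxy_le_inv (n : ℕ) {s : ℝ} (hs : 0 ≤ s) : proxy n s ≤ 1 / (s + 1 / 2) := by
  unfold proxy
  have : (0 : ℝ) ≤ 1 / (s + n + 1 / 2) := by positivity
  linarith

lemma sqrt_half_le (L : ℝ) : √(L / 2) ≤ 3 / 4 * √L := by
  rcases le_or_gt L 0 with h | h
  · rw [Real.sqrt_eq_zero_of_nonpos (by linarith), Real.sqrt_eq_zero_of_nonpos h]; simp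
  · refine Real.sqrt_le_iff.2 ⟨by positivity, ?_⟩
    rw [mul_pow, Real.sq_sqrt h.le]
    linarith

/-- A bound for the total width of the confidence intervals with the horizon `T`. -/
noncomputable def width (T : ℝ) (x : ℝ) : ℝ := 2 * √x - x * √x / (3 * T)

/-- With q = m + 1/2 and q + τ ≤ T, the proxy is at most 1/q − 1/T, and √(1 − x) ≤ 1 − x/2 bounds
its root by 1/√q − √q/(2T). This is the derivative of `width T` at the midpoint q, and both of its
terms compare with the increment over [m, m + 1] in the right direction. -/
lemma sqrt_proxy_le {T τ m : ℕ} {s : ℝ} (hs : (m : ℝ) ≤ s) (h : τ + 1 + m ≤ T) :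
    √(proxy τ s) ≤ width T (m + 1) - width T m := by
  have hT : (τ : ℝ) + 1 + m ≤ T := by exact_mod_cast h
  have hm : (0 : ℝ) ≤ m := Nat.cast_nonneg m
  have hτ : (0 : ℝ) ≤ τ := Nat.cast_nonneg τ
  set q : ℝ := m + 1 / 2 with hq
  have hq0 : 0 < q := by positivity
  have hT0 : (0 : ℝ) < T := by linarith
  have hqT : q ≤ T := by linarith
  have hw : 0 < √q := Real.sqrt_pos.2 hq0
  have h1 : proxy τ s ≤ 1 / q * (1 - q / T) := by
    have e : proxy τ s = τ / ((s + 1 / 2) * (s + τ + 1 / 2)) := by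
      unfold proxy
      have h1 : s + 1 / 2 ≠ 0 := by linarith
      have h2 : s + τ + 1 / 2 ≠ 0 := by linarith
      rw [div_sub_div _ _ h1 h2]
      congr 1
      ring
    have h2 : proxy τ s ≤ τ / (q * (q + τ)) := by
      rw [e]
      have : q + τ ≤ s + τ + 1 / 2 := by linarith
      have h1 : q ≤ s + 1 / 2 := by linarith
      exact div_le_div_of_nonneg_left hτ (by positivity)
        (mul_le_mul h1 this (by positivity) (hq0.le.trans h1))
    refine h2.trans ?_
    rw [show 1 / q * (1 - q / T) = (T - q) / (q * T) by field_simp,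
      div_le_div_iff₀ (by positivity) (by positivity)]
    have : (τ : ℝ) * T ≤ (T - q) * (q + τ) := by nlinarith
    nlinarith
  have h2 : √(proxy τ s) ≤ 1 / √q - √q / (2 * T) := by
    have e : 1 / √q - √q / (2 * T) = 1 / √q * (1 - q / (2 * T)) := by
      rw [show 1 / √q * (1 - q / (2 * T)) = 1 / √q - q / √q / (2 * T) by ring, Real.div_sqrt]
    have hq2 : q / (2 * T) ≤ 1 / 2 := by
      rw [div_le_iff₀ (by positivity)]; linarith
    have h3 : 0 ≤ 1 - q / (2 * T) := by linarith
    rw [e]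
    refine Real.sqrt_le_iff.2 ⟨by positivity, h1.trans ?_⟩
    rw [mul_pow, div_pow, one_pow, Real.sq_sqrt hq0.le]
    refine mul_le_mul_of_nonneg_left ?_ (by positivity)
    have : q / T = 2 * (q / (2 * T)) := by field_simp
    nlinarith [sq_nonneg (q / (2 * T))]
  refine h2.trans ?_
  have h4 := sqrt_inv_le_sub hm
  rw [one_div, Real.sqrt_inv, ← one_div] at h4
  change 1 / √q ≤ _ at h4
  have hu := Real.sqrt_nonneg (m : ℝ)
  have hv : 0 < √((m : ℝ) + 1) := Real.sqrt_pos.2 (by linarith)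
  have hu2 := Real.sq_sqrt hm
  have hv2 := Real.sq_sqrt (by linarith : (0 : ℝ) ≤ m + 1)
  have hw2 := Real.sq_sqrt hq0.le
  -- Midpoint inequality for x^(3/2), whose derivative 3/2 · √x is concave.
  have h5 : (m + 1) * √((m : ℝ) + 1) - m * √(m : ℝ) ≤ 3 / 2 * √q := by
    set u := √(m : ℝ)
    set v := √((m : ℝ) + 1)
    set w := √q
    have hvu : v ^ 2 - u ^ 2 = 1 := by linarith
    have hS : u ^ 2 + v ^ 2 = 2 * w ^ 2 := by rw [hu2, hv2, hw2, hq]; ring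
    have h6 : 2 / 3 * (u ^ 2 + v ^ 2 + u * v) ≤ w * (u + v) := by
      refine le_of_pow_le_pow_left₀ two_ne_zero (by positivity) ?_
      have e : (w * (u + v)) ^ 2 = (u ^ 2 + v ^ 2) / 2 * (u + v) ^ 2 := by rw [hS]; ring
      rw [e]
      nlinarith [mul_nonneg (sq_nonneg (u - v)) (by positivity : 0 ≤ u ^ 2 + v ^ 2 + 4 * (u * v))]
    have e : (m + 1) * v - m * u = v ^ 3 - u ^ 3 := by
      linear_combination (-v) * hv2 + u * hu2
    rw [e]
    have huv : 0 < u + v := by linarith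
    have h7 : (v ^ 3 - u ^ 3) * (u + v) = u ^ 2 + v ^ 2 + u * v := by
      linear_combination (u ^ 2 + v ^ 2 + u * v) * hvu
    refine le_of_mul_le_mul_right ?_ huv
    rw [h7]
    linarith
  unfold width
  have h8 : ((m + 1) * √((m : ℝ) + 1) - m * √(m : ℝ)) / (3 * T) ≤ 3 / 2 * √q / (3 * T) := by
    gcongr
  have e : 3 / 2 * √q / (3 * T) = √q / (2 * T) := by field_simp
  rw [e, sub_div] at h8
  linarith

/-- Cauchy–Schwarz is used twice: it bounds ∑ √n above by √(KT), and T² ≤ (∑ √n)(∑ n√n) then bounds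
∑ n√n below by T√(T/K). -/
lemma sum_width_le {K T : ℕ} (hK : 1 ≤ K) (hT : 1 ≤ T) {n : Fin K → ℕ} (hn : ∑ b, n b = T) :
    ∑ b, width T (n b) ≤ 2 * √((K : ℝ) * T) - 1 / 3 * √((T : ℝ) / K) := by
  have hK' : (0 : ℝ) < K := by exact_mod_cast hK
  have hT' : (0 : ℝ) < T := by exact_mod_cast hT
  have h1 := sum_sqrt_le hn
  have hnT : ∑ b, (n b : ℝ) = T := by rw [← Nat.cast_sum, hn]
  have h2 : (T : ℝ) ^ 2 ≤ (∑ b, √(n b : ℝ)) * ∑ b, n b * √(n b : ℝ) := by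
    rw [← hnT]
    refine Finset.sum_sq_le_sum_mul_sum_of_sq_le_mul _ (fun b _ => Real.sqrt_nonneg _)
      (fun b _ => by positivity) fun b _ => le_of_eq ?_
    have := Real.mul_self_sqrt (Nat.cast_nonneg (α := ℝ) (n b))
    linear_combination (-(n b : ℝ)) * this
  have hX : 0 ≤ ∑ b, n b * √(n b : ℝ) := Finset.sum_nonneg fun b _ => by positivity
  have h3 : (T : ℝ) ^ 2 ≤ √((K : ℝ) * T) * ∑ b, n b * √(n b : ℝ) :=
    h2.trans (mul_le_mul_of_nonneg_right h1 hX)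
  have hA : 0 < √((K : ℝ) * T) := Real.sqrt_pos.2 (by positivity)
  have e1 : √((K : ℝ) * T) * √((T : ℝ) / K) = T := by
    rw [← Real.sqrt_mul (by positivity), show (K : ℝ) * T * (T / K) = T ^ 2 by field_simp,
      Real.sqrt_sq hT'.le]
  have h4 : T * √((T : ℝ) / K) ≤ ∑ b, n b * √(n b : ℝ) := by
    refine le_of_mul_le_mul_left ?_ hA
    refine le_trans (le_of_eq ?_) h3
    linear_combination (T : ℝ) * e1
  simp only [width, Finset.sum_sub_distrib, ← Finset.mul_sum, ← Finset.sum_div]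
  have h5 : 1 / 3 * √((T : ℝ) / K) ≤ (∑ b, n b * √(n b : ℝ)) / (3 * T) := by
    rw [le_div_iff₀ (by positivity)]
    linarith
  linarith

/-- Tangents of exp at −1/2, −1 and −3/2 bound the right side below by parabolas in x, which beat
the line on [0.8, 1.2], [1.2, 1.55] and [1.55, 2.2]; from 2.2 on the line is negative. -/
lemma exp_neg_half_sq_ge {x : ℝ} (hx : 4 / 5 ≤ x) :
    5 / 3 * (0.627 - 0.2928 * x) ≤ Real.exp (-(x ^ 2 / 2)) := by
  have tangent : ∀ c, Real.exp (-c) * (1 + c - x ^ 2 / 2) ≤ Real.exp (-(x ^ 2 / 2)) := fun c => by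
    have h := Real.add_one_le_exp (c - x ^ 2 / 2)
    have e : Real.exp (-(x ^ 2 / 2)) = Real.exp (-c) * Real.exp (c - x ^ 2 / 2) := by
      rw [← Real.exp_add]; ring_nf
    rw [e]
    exact mul_le_mul_of_nonneg_left (by linarith) (Real.exp_pos _).le
  have h1 := Real.exp_one_lt_d9
  have hhalf : Real.exp (1 / 2) ≤ 1.6488 := by
    refine le_of_pow_le_pow_left₀ two_ne_zero (by norm_num) ?_
    rw [← Real.exp_nat_mul]
    norm_num at h1 ⊢
    linarith
  have e1 : (0.36787 : ℝ) ≤ Real.exp (-1) := by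
    rw [Real.exp_neg, ← one_div, le_div_iff₀ (Real.exp_pos _)]
    linarith
  have e2 : (0.6064 : ℝ) ≤ Real.exp (-(1 / 2)) := by
    rw [Real.exp_neg, ← one_div, le_div_iff₀ (Real.exp_pos _)]
    linarith
  have e3 : (0.223 : ℝ) ≤ Real.exp (-(3 / 2)) := by
    have : Real.exp (-(3 / 2)) = Real.exp (-1) * Real.exp (-(1 / 2)) := by
      rw [← Real.exp_add]; norm_num
    rw [this]
    refine le_trans (by norm_num) (mul_le_mul e1 e2 (by norm_num) (Real.exp_pos _).le)
  rcases le_total x 1.2 with h | h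
  · refine le_trans ?_ (tangent (1 / 2))
    have hp : 0 ≤ 1 + 1 / 2 - x ^ 2 / 2 := by nlinarith
    refine le_trans ?_ (mul_le_mul_of_nonneg_right e2 hp)
    nlinarith [mul_nonneg (sub_nonneg.2 hx) (sub_nonneg.2 h)]
  rcases le_total x 1.55 with h' | h'
  · refine le_trans ?_ (tangent 1)
    have hp : 0 ≤ 1 + 1 - x ^ 2 / 2 := by nlinarith
    refine le_trans ?_ (mul_le_mul_of_nonneg_right e1 hp)
    nlinarith [mul_nonneg (sub_nonneg.2 h) (sub_nonneg.2 h')]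
  rcases le_total x 2.2 with h'' | h''
  · refine le_trans ?_ (tangent (3 / 2))
    have hp : 0 ≤ 1 + 3 / 2 - x ^ 2 / 2 := by nlinarith
    refine le_trans ?_ (mul_le_mul_of_nonneg_right e3 hp)
    nlinarith [mul_nonneg (sub_nonneg.2 h') (sub_nonneg.2 h'')]
  · exact le_trans (by linarith) (Real.exp_pos _).le

/-- With x = √(log T), √T becomes exp(x²/2). The decimals bound 1/√2 by 0.7072 and √(π/8) by 0.627,
and 0.2928 = 1 − 0.7072; T ≥ 2 gives x ≥ 4/5. -/
lemma vzero_constant {T : ℕ} (hT : 2 ≤ T) :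
    5 / 3 * √T * (√(Real.log T / 2) + √(Real.pi / 8) - √(Real.log T)) ≤ 1 := by
  have hT' : (2 : ℝ) ≤ T := by exact_mod_cast hT
  have hT0 : (0 : ℝ) < T := by linarith
  set x := √(Real.log T) with hx
  have hL : 0 ≤ Real.log T := Real.log_natCast_nonneg T
  have hx0 : 0 ≤ x := Real.sqrt_nonneg _
  have hx2 : x ^ 2 = Real.log T := Real.sq_sqrt hL
  have hx1 : 4 / 5 ≤ x := by
    refine Real.le_sqrt_of_sq_le ?_
    have := Real.log_le_log (by norm_num) hT'
    have := Real.log_two_gt_d9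
    norm_num at *
    linarith
  have h1 : √(Real.log T / 2) ≤ 0.7072 * x := by
    refine Real.sqrt_le_iff.2 ⟨by positivity, ?_⟩
    rw [mul_pow, hx2]
    norm_num
    linarith
  have h2 : √(Real.pi / 8) ≤ 0.627 := by
    refine Real.sqrt_le_iff.2 ⟨by norm_num, ?_⟩
    have := Real.pi_lt_d4
    norm_num at *
    linarith
  have h3 : √(T : ℝ) * Real.exp (-(x ^ 2 / 2)) = 1 := by
    have e : √(T : ℝ) = Real.exp (x ^ 2 / 2) := by
      rw [hx2, Real.exp_half, Real.exp_log hT0]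
    rw [e, ← Real.exp_add]
    simp
  have h4 := exp_neg_half_sq_ge hx1
  calc _ ≤ √(T : ℝ) * (5 / 3 * (0.627 - 0.2928 * x)) := by
        have h5 : √(Real.log T / 2) + √(Real.pi / 8) - x ≤ 0.627 - 0.2928 * x := by linarith
        have := mul_le_mul_of_nonneg_left h5 (by positivity : 0 ≤ 5 / 3 * √(T : ℝ))
        linarith
    _ ≤ √(T : ℝ) * Real.exp (-(x ^ 2 / 2)) :=
        mul_le_mul_of_nonneg_left h4 (Real.sqrt_nonneg _)
    _ = 1 := h3

lemma sqrt_div_le_sqrt_mul {K T : ℕ} (hK : 1 ≤ K) : √((T : ℝ) / K) ≤ √((K : ℝ) * T) := by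
  have hK' : (1 : ℝ) ≤ K := by exact_mod_cast hK
  refine Real.sqrt_le_sqrt ?_
  have hT : (0 : ℝ) ≤ T := Nat.cast_nonneg T
  rw [div_le_iff₀ (by linarith)]
  nlinarith [mul_nonneg hT (sub_nonneg.2 hK'), mul_nonneg (mul_nonneg hT (sub_nonneg.2 hK'))
    (by linarith : (0 : ℝ) ≤ K)]

lemma width_total_le {K T : ℕ} (hK : 1 ≤ K) :
    2 * √((K : ℝ) * T) - 1 / 3 * √((T : ℝ) / K) ≤ 5 / 3 * √T * K := by
  have hK' : (1 : ℝ) ≤ K := by exact_mod_cast hK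
  have hu : 1 ≤ √(K : ℝ) := Real.one_le_sqrt.2 hK'
  have hu2 := Real.sq_sqrt (by linarith : (0 : ℝ) ≤ K)
  rw [Real.sqrt_mul (by linarith), Real.sqrt_div' _ (by linarith)]
  set u := √(K : ℝ)
  have e : 2 * (u * √(T : ℝ)) - 1 / 3 * (√(T : ℝ) / u) = √(T : ℝ) * (2 * u - 1 / (3 * u)) := by
    field_simp
  rw [e, ← hu2, mul_right_comm, mul_comm _ (√(T : ℝ))]
  refine mul_le_mul_of_nonneg_left ?_ (Real.sqrt_nonneg _)
  rw [sub_le_iff_le_add, ← sub_le_iff_le_add', le_div_iff₀ (by positivity)]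
  -- In u = √K the claim is 5u³ − 6u² + 1 = (u − 1)(5u² − u − 1) ≥ 0.
  nlinarith [mul_nonneg (sub_nonneg.2 hu) (by nlinarith : 0 ≤ 5 * u ^ 2 - u - 1)]

lemma sum_range_inv_natCast {T : ℕ} (hT : 1 ≤ T) (c : ℝ) :
    ∑ _τ ∈ Finset.range T, c * (1 / T) = c := by
  have : (T : ℝ) ≠ 0 := by positivity
  simp
  field_simp

/-! ### The gaps with their natural constants, and the theorem. -/

theorem ts_gap {K T : ℕ} (hT : 1 ≤ T) (y : Belief K) {σ : Solver K}
    (hσ : IsInnerSolver (penaltyTS K) σ) :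
    upperBound (penaltyTS K) T y - performance (irsPolicy σ) T y ≤
      K + √(Real.log T / 2) * (2 * √((K : ℝ) * T)) := by
  have h := sub_performance_le (isProbabilityMeasure_irsPolicy hσ) T
    (fun τ y => τ * bestMean τ y) (fun _ => K * (1 / T))
    (fun _ y b => radius T (1 / ((y b).size + 1 / 2)))
    (fun n => √(Real.log T / 2) * (2 * √n)) (√(Real.log T / 2) * (2 * √((K : ℝ) * T)))
    (fun y => by simp) (fun τ _ y => ts_step hT hσ τ y)
    (fun τ y b m _ hm => by
      simpa using radius_inv_le T (Nat.cast_nonneg m) hm)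
    (fun n hn => by
      rw [← Finset.mul_sum, ← Finset.mul_sum]
      gcongr
      exact sum_sqrt_le hn) (by simp) y
  rw [sum_range_inv_natCast hT] at h
  linarith [upperBound_ts_le hσ T y]

theorem fh_gap {K T : ℕ} (hK : 1 ≤ K) (hT : 1 ≤ T) (y : Belief K) {σ : Solver K}
    (hσ : IsInnerSolver (penaltyFH K) σ) :
    upperBound (penaltyFH K) T y - performance (irsPolicy σ) T y ≤
      2 * K + √(Real.log T / 2) * (2 * √T) + √(Real.log T / 2) * (2 * √((K : ℝ) * T)) := by
  have h := sub_performance_le (isProbabilityMeasure_irsPolicy hσ) T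
    (fun τ y => τ * bestMean τ y)
    (fun τ => 2 * (K * (1 / T)) + radius T (1 / (τ + 1 / 2)))
    (fun τ y b => radius T (proxy τ (y b).size))
    (fun n => √(Real.log T / 2) * (2 * √n)) (√(Real.log T / 2) * (2 * √((K : ℝ) * T)))
    (fun y => by simp) (fun τ _ y => fh_step hT hσ τ y)
    (fun τ y b m _ hm => by
      refine (radius_mono T (proxy_le_inv τ (y b).size_pos.le)).trans ?_
      simpa using radius_inv_le T (Nat.cast_nonneg m) hm)
    (fun n hn => by
      rw [← Finset.mul_sum, ← Finset.mul_sum]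
      gcongr
      exact sum_sqrt_le hn) (by simp) y
  -- The radii charged to time telescope like the pulls of one single arm, hence √T in place of
  -- √(KT).
  have hr : ∑ τ ∈ Finset.range T, radius T (1 / ((τ : ℝ) + 1 / 2)) ≤
      √(Real.log T / 2) * (2 * √T) := by
    calc _ ≤ ∑ τ ∈ Finset.range T, (√(Real.log T / 2) * (2 * √((τ + 1 : ℕ) : ℝ)) -
          √(Real.log T / 2) * (2 * √(τ : ℝ))) := Finset.sum_le_sum fun τ _ => by
          simpa using radius_inv_le T (Nat.cast_nonneg τ) le_rfl
      _ = _ := by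
          rw [Finset.sum_range_sub fun τ : ℕ => √(Real.log T / 2) * (2 * √(τ : ℝ))]
          simp
  rw [Finset.sum_add_distrib] at h
  simp_rw [← mul_assoc (2 : ℝ) (K : ℝ)] at h
  rw [sum_range_inv_natCast hT] at h
  linarith [upperBound_fh_le hK hσ T y]

theorem vzero_gap {K T : ℕ} (hK : 1 ≤ K) (hT : 1 ≤ T) (y : Belief K) {σ : Solver K}
    (hσ : IsInnerSolver (penaltyVZero K) σ) :
    upperBound (penaltyVZero K) T y - performance (irsPolicy σ) T y ≤
      K + (√(Real.log T / 2) + √(Real.pi / 8)) *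
        (2 * √((K : ℝ) * T) - 1 / 3 * √((T : ℝ) / K)) := by
  have h := sub_performance_le (isProbabilityMeasure_irsPolicy hσ) T
    (upperBound (penaltyVZero K)) (fun _ => K * (1 / T))
    (fun τ y b => radius T (proxy τ (y b).size) + √(Real.pi * proxy τ (y b).size / 8))
    (fun n => (√(Real.log T / 2) + √(Real.pi / 8)) * width T n)
    ((√(Real.log T / 2) + √(Real.pi / 8)) * (2 * √((K : ℝ) * T) - 1 / 3 * √((T : ℝ) / K)))
    (fun y => by
      rw [hσ.upperBound_eq (isObjective_vzero 0 y)]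
      simp [vzeroObjective])
    (fun τ _ y => vzero_step hT hσ τ y)
    (fun τ y b m hτ hm => by
      have hL : 0 ≤ Real.log T := Real.log_natCast_nonneg T
      have hp := proxy_nonneg τ (y b).size_pos.le
      have hw := sqrt_proxy_le hm hτ
      rw [radius, mul_div_assoc, mul_comm (proxy _ _), Real.sqrt_mul (by positivity),
        mul_div_right_comm, Real.sqrt_mul (by positivity), ← add_mul, ← mul_sub]
      push_cast
      gcongr)
    (fun n hn => by
      rw [← Finset.mul_sum]
      gcongr
      exact sum_width_le hK hT hn) (by simp [width]) y
  rwa [sum_range_inv_natCast hT] at h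

end BetaBernoulliBandit

open BetaBernoulliBandit in
theorem mainTheorem3 (K T : ℕ) (hK : 1 ≤ K) (hT : 1 ≤ T) (y : Belief K) :
    (∀ σ : Solver K, IsInnerSolver (penaltyTS K) σ →
      upperBound (penaltyTS K) T y - performance (irsPolicy σ) T y ≤
        3 * K + 4 * √(Real.log T) * √((K : ℝ) * T)) ∧
    (∀ σ : Solver K, IsInnerSolver (penaltyFH K) σ →
      upperBound (penaltyFH K) T y - performance (irsPolicy σ) T y ≤
        3 * K + 2 * √(Real.log T) *
          (2 * √((K : ℝ) * T) - 1 / 3 * √((T : ℝ) / K))) ∧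
    (∀ σ : Solver K, IsInnerSolver (penaltyVZero K) σ →
      upperBound (penaltyVZero K) T y - performance (irsPolicy σ) T y ≤
        2 * K + √(Real.log T) *
          (2 * √((K : ℝ) * T) - 1 / 3 * √((T : ℝ) / K))) := by
  have hK0 : (0 : ℝ) ≤ K := Nat.cast_nonneg K
  have hK1 : (1 : ℝ) ≤ K := by exact_mod_cast hK
  have hT1 : (1 : ℝ) ≤ T := by exact_mod_cast hT
  have hhalf := sqrt_half_le (Real.log T)
  have hx := Real.sqrt_nonneg (Real.log T)
  have hA := Real.sqrt_nonneg ((K : ℝ) * T)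
  have hxA := mul_nonneg hx hA
  have hdiv := sqrt_div_le_sqrt_mul (T := T) hK
  have hTA : √(T : ℝ) ≤ √((K : ℝ) * T) := Real.sqrt_le_sqrt (by nlinarith)
  have hhA := mul_le_mul_of_nonneg_right hhalf hA
  refine ⟨fun σ hσ => ?_, fun σ hσ => ?_, fun σ hσ => ?_⟩
  · have h := ts_gap hT y hσ
    -- √(1/2) ≤ 3/4 leaves 3/2 in front of √(log T)·√(KT), below 4.
    nlinarith
  · have h := fh_gap hK hT y hσ
    have h1 := mul_le_mul_of_nonneg_left hTA (Real.sqrt_nonneg (Real.log T / 2))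
    have h2 := mul_le_mul_of_nonneg_left hdiv hx
    -- The left coefficient of √(log T)·√(KT) is at most 4 · 3/4 = 3, the right one at least 2(2 −
    -- 1/3) = 10/3 because √(T/K) ≤ √(KT).
    nlinarith
  · have hS : 0 ≤ 2 * √((K : ℝ) * T) - 1 / 3 * √((T : ℝ) / K) := by linarith
    -- At T = 1 the logarithm vanishes and `vzero_constant` is not available; there W ≤ 1 ≤ 2K and V
    -- ≥ 0 suffice.
    rcases hT.eq_or_lt with rfl | hT2
    · have h0 := performance_nonneg (irsPolicy σ) 1 y
      have h1 : upperBound (penaltyVZero K) 1 y ≤ 1 := by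
        rw [hσ.upperBound_eq (isObjective_vzero 1 y)]
        refine (le_abs_self _).trans ((abs_integral_le_integral_abs).trans ?_)
        refine (integral_mono_of_nonneg (Filter.Eventually.of_forall fun ω => abs_nonneg _)
          (integrable_const (1 : ℝ)) (Filter.Eventually.of_forall fun ω => ?_)).trans
          (by simp)
        simpa using abs_vzeroObjective_le y ω (σ 1 y ω)
      have h2 := mul_nonneg hx hS
      linarith
    · have h := vzero_gap hK hT y hσ
      have hc := vzero_constant hT2
      have hw := width_total_le (T := T) hK
      refine h.trans ?_
      set S := 2 * √((K : ℝ) * T) - 1 / 3 * √((T : ℝ) / K)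
      set c := √(Real.log T / 2) + √(Real.pi / 8) - √(Real.log T) with hcdef
      -- The excess of √(log T/2) + √(π/8) over √(log T) is absorbed by the second K of the bound.
      have key : c * S ≤ K := by
        rcases le_total c 0 with h0 | h0
        · exact (mul_nonpos_of_nonpos_of_nonneg h0 hS).trans hK0
        · calc c * S ≤ c * (5 / 3 * √T * K) := mul_le_mul_of_nonneg_left hw h0
            _ = (5 / 3 * √T * c) * K := by ring
            _ ≤ 1 * K := mul_le_mul_of_nonneg_right hc hK0
            _ = K := one_mul _
      have e : (√(Real.log T / 2) + √(Real.pi / 8)) * S = c * S + √(Real.log T) * S := by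
        rw [hcdef]; ring
      linarith
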